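/- Let $M$ be a smooth (Hausdorff, second countable, finite-dimensional) manifold, let $(A\to M,\rho,[\cdot,\cdot])$ be a Lie algebroid, and let $\underline{E}=E_0[0]\oplus\dots\oplus E_{n-1}[n-1]$ be a graded vector bundle over $M$, with all $E_i$ smooth real vector bundles of finite rank. For a Lie algebroid $A'\to M$ write $\Omega^s(A',E_i)=\Gamma(\wedge^s A'^*\otimes E_i)$ and $\Omega(A',\underline{E})=\bigoplus_{s,i}\Omega^s(A',E_i)$, where elements of $\Omega^s(A',E_i)$ have total degree $s+i$; let $\mathbf{d}_{A'}$ be the Lie algebroid differential on $\Omega^\bullet(A')$ and $H^\bullet(A')$ its cohomology. An $n$-connection of $A'$ on $\underline{E}$ is an $\mathbb{R}$-linear operator $\mathcal{D}$ on $\Omega(A',\underline{E})$ that raises the total degree by $1$ and satisfies $\mathcal{D}(\omega\wedge\eta)=\mathbf{d}_{A'}\omega\wedge\eta+(-1)^{l}\omega\wedge\mathcal{D}\eta$ for $\omega\in\Omega^l(A')$ and $\eta\in\Omega(A',\underline{E})$. It is an $n$-representation (an $n$-term representation up to homotopy) if moreover $\mathcal{D}^2=0$. For an $n$-connection $\mathcal{D}$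 of $A$ on $\underline{E}$ and $m\ge 1$, let $R_{\mathcal{D}}^m$ be the $\underline{\mathrm{End}}(\underline{E})$-valued form on $A$ of total degree $2m$ whose action on $\Omega(A,\underline{E})$ is $\mathcal{D}^{2m}$. Let $\mathrm{gtr}$ be the graded trace, i.e. $\mathrm{gtr}(\phi)=(-1)^i\,\mathrm{tr}(\phi)$ for $\phi\in\Gamma(\mathrm{End}(E_i))$ and $\mathrm{gtr}=0$ on $\mathrm{Hom}(E_i,E_j)$ for $i\ne j$. The form $\mathrm{gtr}(R_{\mathcal{D}}^m)\in\Omega^{2m}(A)$ is closed, and its class $\sigma^m_A(\underline{E})=[\mathrm{gtr}(R_{\mathcal{D}}^m)]\in H^{2m}(A)$ does not depend on $\mathcal{D}$. The $A$-Pontryagin algebra $\mathrm{Pont}^\bullet_A(\underline{E})\subseteq H^\bullet(A)$ is the $\mathbb{R}$-subalgebra generated by the classes $\sigma_A^m(\underline{E})$, $m\ge1$, and $\mathrm{Pont}^l_A(\underline{E})\subseteq H^l(A)$ is its part of degree $l$. Theorem. Assume that there is a Lie subalgebroid $B\subseteq A$ over $M$ of codimension $q$ (i.e. $\operatorname{rank}A-\operatorname{rank}B=q$),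 with an $n$-representation $\mathcal{D}\colon\Omega(B,\underline{E})_\bullet\to\Omega(B,\underline{E})_{\bullet+1}$ of $B$ on $\underline{E}$. Then $\mathrm{Pont}^l_A(\underline{E})=0$ for all $l>2q$. -/

import Mathlib

open scoped Manifold Bundle DirectSum TensorProduct Topology

noncomputable section

namespace Algebroid

section Forms

variable (R L P : Type*) [CommRing R] [LieRing L] [Module R L] [AddCommGroup P] [Module R P]

/-- `P`-valued `k`-forms on `L`: alternating `R`-multilinear maps `Lᵏ → P`.  For `R = C^∞(M)`,
`L = Γ(A)` and `P = Γ(E)` this is `Ωᵏ(A, E) = Γ(⋀ᵏ A* ⊗ E)`. -/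
abbrev Form (k : ℕ) : Type _ := L [⋀^Fin k]→ₗ[R] P

variable {R L P}

/-- Koszul's formula for the differential of a `k`-form `α`,
`∑ᵢ (-1)ⁱ ⁅aᵢ, α(a₀, …, âᵢ, …, aₖ)⁆ + ∑_{i<j} (-1)^{i+j} α(⁅aᵢ, aⱼ⁆, a₀, …, âᵢ, …, âⱼ, …, aₖ)`.
In the second sum the entry `⁅aᵢ, aⱼ⁆` is moved to the place of `aⱼ`, which turns the sign into
`-(-1)ⁱ`. -/
def koszul [LieRingModule L R] {k : ℕ} (α : Form R L R k) (a : Fin (k + 1) → L) : R :=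
  ∑ i : Fin (k + 1), (-1 : ℤ) ^ (i : ℕ) •
    (⁅a i, α (i.removeNth a)⁆ -
      ∑ j ∈ Finset.Ioi i, α (i.removeNth (Function.update a j ⁅a i, a j⁆)))

set_option linter.unusedSectionVars false

section Aux

variable {k : ℕ} (α : Form R L R k)

theorem form_zsmul (v : Fin k → L) (i : Fin k) (c : ℤ) (y : L) :
    α (Function.update v i (c • y)) = c • α (Function.update v i y) := by
  rw [← Int.cast_smul_eq_zsmul R, α.map_update_smul, Int.cast_smul_eq_zsmul]

/-- `α` as a `ℤ`-multilinear alternating map composed with an additive map. -/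
def formComp (g : R →+ R) : L [⋀^Fin k]→ₗ[ℤ] R where
  toFun v := g (α v)
  map_update_add' := by
    intro inst v i y z
    obtain rfl : inst = instDecidableEqFin k := Subsingleton.elim _ _
    simp
  map_update_smul' := by
    intro inst v i c y
    obtain rfl : inst = instDecidableEqFin k := Subsingleton.elim _ _
    rw [form_zsmul, map_zsmul]
  map_eq_zero_of_eq' v p q hv hpq := by
    simp [α.map_eq_zero_of_eq v hv hpq]

/-- `v ↦ ∑ⱼ α(v₁, …, [x, vⱼ], …, vₖ)` as an alternating map. -/
def adForm (x : L) : L [⋀^Fin k]→ₗ[ℤ] R where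
  toFun v := ∑ j, α (Function.update v j ⁅x, v j⁆)
  map_update_add' := by
    intro inst v i y z
    obtain rfl : inst = instDecidableEqFin k := Subsingleton.elim _ _
    rw [← Finset.sum_add_distrib]
    refine Finset.sum_congr rfl fun j _ => ?_
    rcases eq_or_ne j i with rfl | h
    · simp
    · simp only [Function.update_of_ne h, Function.update_comm h.symm, α.map_update_add]
  map_update_smul' := by
    intro inst v i c y
    obtain rfl : inst = instDecidableEqFin k := Subsingleton.elim _ _
    rw [Finset.smul_sum]
    refine Finset.sum_congr rfl fun j _ => ?_
    rcases eq_or_ne j i with rfl | h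
    · simp [form_zsmul]
    · simp only [Function.update_of_ne h, Function.update_comm h.symm, form_zsmul]
  map_eq_zero_of_eq' v p q hv hpq := by
    rw [Fintype.sum_eq_add p q hpq]
    · have : Function.update v q ⁅x, v q⁆ =
          Function.update v p ⁅x, v p⁆ ∘ Equiv.swap p q := by
        ext r
        rcases eq_or_ne r p with rfl | h1
        · simp [Function.update_of_ne hpq, Function.update_of_ne hpq.symm, hv]
        rcases eq_or_ne r q with rfl | h2
        · simp [hv]
        · simp [Equiv.swap_apply_of_ne_of_ne h1 h2, Function.update_of_ne h1,
            Function.update_of_ne h2]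
      rw [this, α.map_swap _ hpq, add_neg_cancel]
    · rintro r ⟨h1, h2⟩
      exact α.map_eq_zero_of_eq _ (by simp [Function.update_of_ne h1.symm,
        Function.update_of_ne h2.symm, hv]) hpq

variable [LieRingModule L R]

/-- `x ↦ 2 ⁅x, α(·)⁆ - adForm x`. -/
def preKoszul : L →ₗ[ℤ] L [⋀^Fin k]→ₗ[ℤ] R :=
  AddMonoidHom.toIntLinearMap
    { toFun := fun x => (2 : ℤ) • formComp α (LieRingModule.toEnd L R x) - adForm α x
      map_zero' := by ext v; simp [formComp, adForm]
      map_add' := by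
        intro x y; ext v
        simp [formComp, adForm, Finset.sum_add_distrib]; ring }

theorem koszul_term_symm (a : Fin (k + 1) → L) {i j : Fin (k + 1)} (h : i ≠ j) :
    (-1 : ℤ) ^ (i : ℕ) • α (i.removeNth (Function.update a j ⁅a i, a j⁆)) =
      (-1 : ℤ) ^ (j : ℕ) • α (j.removeNth (Function.update a i ⁅a j, a i⁆)) := by
  have key := α.neg_one_pow_smul_map_removeNth_add_eq_zero_of_eq (i := i) (j := j)
    (v := Function.update (Function.update a i ⁅a i, a j⁆) j ⁅a i, a j⁆)
    (by simp [Function.update_of_ne h]) h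
  have h1 : i.removeNth (Function.update (Function.update a i ⁅a i, a j⁆) j ⁅a i, a j⁆) =
      i.removeNth (Function.update a j ⁅a i, a j⁆) := by
    rw [Function.update_comm h]; simp
  have h2 : j.removeNth (Function.update (Function.update a i ⁅a i, a j⁆) j ⁅a i, a j⁆) =
      j.removeNth (Function.update a i ((-1 : ℤ) • ⁅a j, a i⁆)) := by
    simp
  obtain ⟨r, hr⟩ := Fin.exists_succAbove_eq h
  have h3 : ∀ y, j.removeNth (Function.update a i y) = Function.update (j.removeNth a) r y := by
    intro y; subst hr; simp
  rw [h1, h2, h3, form_zsmul, ← h3] at key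
  have := eq_neg_of_add_eq_zero_left key
  rw [this]; simp

theorem removeNth_update_sum (a : Fin (k + 1) → L) (i : Fin (k + 1)) :
    adForm α (a i) (i.removeNth a) =
      ∑ j ∈ Finset.univ.erase i, α (i.removeNth (Function.update a j ⁅a i, a j⁆)) := by
  have : (Finset.univ.erase i) = Finset.univ.map i.succAboveEmb := by
    ext j
    simp only [Finset.mem_erase, Finset.mem_univ, and_true, Finset.mem_map, true_and,
      Fin.succAboveEmb_apply]
    exact Fin.exists_succAbove_eq_iff.symm
  rw [this, Finset.sum_map]
  change ∑ j, α (Function.update (i.removeNth a) j ⁅a i, i.removeNth a j⁆) = _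
  refine Finset.sum_congr rfl fun j _ => ?_
  simp [Fin.removeNth]

theorem two_koszul (a : Fin (k + 1) → L) :
    (2 : ℤ) • koszul α a = AlternatingMap.alternatizeUncurryFin (preKoszul α) a := by
  have hS : ∑ i : Fin (k + 1), (-1 : ℤ) ^ (i : ℕ) • adForm α (a i) (i.removeNth a) =
      (2 : ℤ) • ∑ i : Fin (k + 1), (-1 : ℤ) ^ (i : ℕ) •
        ∑ j ∈ Finset.Ioi i, α (i.removeNth (Function.update a j ⁅a i, a j⁆)) := by
    have e1 : ∀ i : Fin (k + 1), (-1 : ℤ) ^ (i : ℕ) • adForm α (a i) (i.removeNth a) =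
        ∑ j ∈ Finset.Ioi i, (-1 : ℤ) ^ (i : ℕ) •
          α (i.removeNth (Function.update a j ⁅a i, a j⁆)) +
        ∑ j ∈ Finset.Iio i, (-1 : ℤ) ^ (j : ℕ) •
          α (j.removeNth (Function.update a i ⁅a j, a i⁆)) := by
      intro i
      rw [removeNth_update_sum, Finset.smul_sum]
      have : (Finset.univ.erase i) = Finset.Ioi i ∪ Finset.Iio i := by
        ext j; simp [lt_or_lt_iff_ne, eq_comm]
      rw [this, Finset.sum_union (Finset.disjoint_left.2 fun x hx hx' =>
        lt_asymm (Finset.mem_Ioi.1 hx) (Finset.mem_Iio.1 hx'))]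
      congr 1
      exact Finset.sum_congr rfl fun j hj => koszul_term_symm α a (Finset.mem_Iio.1 hj).ne'
    rw [Finset.sum_congr rfl fun i _ => e1 i, Finset.sum_add_distrib, two_smul]
    simp_rw [Finset.smul_sum]
    congr 1
    exact Finset.sum_comm' (by simp)
  rw [AlternatingMap.alternatizeUncurryFin_apply]
  have : ∀ i : Fin (k + 1), preKoszul α (a i) (i.removeNth a) =
      (2 : ℤ) • ⁅a i, α (i.removeNth a)⁆ - adForm α (a i) (i.removeNth a) := fun i => rfl
  simp_rw [this, koszul, smul_sub, Finset.sum_sub_distrib, hS, smul_sub, Finset.smul_sum]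
  congr 1
  exact Finset.sum_congr rfl fun i _ => smul_comm _ _ _

end Aux

section Differential

variable [LieRingModule L R] [LieRinehartRing R L] [Algebra ℝ R] {k : ℕ}

theorem two_cancel {x y : R} (h : (2 : ℤ) • x = (2 : ℤ) • y) : x = y := by
  rw [← Int.cast_smul_eq_zsmul ℝ, ← Int.cast_smul_eq_zsmul ℝ] at h
  exact smul_right_injective R (by norm_num : ((2 : ℤ) : ℝ) ≠ 0) h

theorem koszul_update_add (α : Form R L R k) (a : Fin (k + 1) → L) (i : Fin (k + 1)) (y z : L) :
    koszul α (Function.update a i (y + z)) =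
      koszul α (Function.update a i y) + koszul α (Function.update a i z) := by
  apply two_cancel
  rw [smul_add, two_koszul, two_koszul, two_koszul, AlternatingMap.map_update_add]

theorem koszul_swap (α : Form R L R k) (a : Fin (k + 1) → L) {i j : Fin (k + 1)} (h : i ≠ j) :
    koszul α (a ∘ Equiv.swap i j) = - koszul α a := by
  apply two_cancel
  rw [smul_neg, two_koszul, two_koszul, AlternatingMap.map_swap _ _ h]

theorem koszul_eq_zero (α : Form R L R k) (a : Fin (k + 1) → L) {i j : Fin (k + 1)}
    (h : a i = a j) (hij : i ≠ j) : koszul α a = 0 := by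
  apply two_cancel
  rw [smul_zero, two_koszul, AlternatingMap.map_eq_zero_of_eq _ _ h hij]

theorem koszul_cons_smul (α : Form R L R k) (f : R) (x : L) (v : Fin k → L) :
    koszul α (Fin.cons (f • x) v : Fin (k + 1) → L) =
      f • koszul α (Fin.cons x v : Fin (k + 1) → L) := by
  have h0 : Finset.Ioi (0 : Fin (k + 1)) = Finset.univ.map (Fin.succEmb k) := by
    ext j; refine Fin.cases (by simp) (fun j => by simp) j
  have hs : ∀ m : Fin k, Finset.Ioi m.succ = (Finset.Ioi m).map (Fin.succEmb k) := by
    intro m; ext j; refine Fin.cases (by simp) (fun j => by simp) j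
  have expand : ∀ y : L, koszul α (Fin.cons y v : Fin (k + 1) → L) =
      (⁅y, α v⁆ - ∑ j, α (Function.update v j ⁅y, v j⁆)) +
      ∑ m : Fin k, (-1 : ℤ) ^ (m + 1 : ℕ) •
        (⁅v m, α (m.succ.removeNth (Fin.cons y v : Fin (k + 1) → L))⁆ -
          ∑ j ∈ Finset.Ioi m, α (m.succ.removeNth
            (Fin.cons y (Function.update v j ⁅v m, v j⁆) : Fin (k + 1) → L))) := by
    intro y
    rw [koszul, Fin.sum_univ_succ, h0, Finset.sum_map]
    simp only [hs, Finset.sum_map, Fin.cons_zero, Fin.cons_succ,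
      Fin.coe_succEmb, Fin.val_zero, pow_zero, one_smul, Fin.removeNth_zero, Fin.tail_cons,
      Fin.val_succ, ← Fin.cons_update]
  have hrem : ∀ (m : Fin k) (y : L) (w : Fin k → L),
      (-1 : ℤ) ^ (m : ℕ) • α (m.succ.removeNth (Fin.cons y w : Fin (k + 1) → L)) =
        α (Function.update w m y) := by
    intro m y w
    obtain ⟨r, rfl⟩ : ∃ r, k = r + 1 := ⟨k - 1, by have := m.pos; omega⟩
    have e : m.succ.removeNth (Fin.cons y w : Fin (r + 1 + 1) → L) =
        Matrix.vecCons y (m.removeNth w) := Fin.cons_comp_succ_succAbove _ _ _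
    rw [e, ← AlternatingMap.map_insertNth, Fin.insertNth_removeNth]
  have expand' : ∀ y : L, koszul α (Fin.cons y v : Fin (k + 1) → L) =
      (⁅y, α v⁆ - ∑ j, α (Function.update v j ⁅y, v j⁆)) -
      ∑ m : Fin k, (⁅v m, α (Function.update v m y)⁆ -
          ∑ j ∈ Finset.Ioi m, α (Function.update (Function.update v j ⁅v m, v j⁆) m y)) := by
    intro y
    rw [expand, sub_eq_add_neg (⁅y, α v⁆ - _), ← Finset.sum_neg_distrib]
    congr 1
    refine Finset.sum_congr rfl fun m _ => ?_
    rw [pow_succ, mul_neg_one, neg_smul, smul_sub, ← lie_zsmul, hrem, Finset.smul_sum]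
    simp_rw [hrem]
  rw [expand', expand']
  have hb : ∀ y : L, ⁅f • x, y⁆ = f • ⁅x, y⁆ - ⁅y, f⁆ • x := by
    intro y
    rw [← lie_skew, LieRinehartRing.leibniz_smul_right, ← lie_skew x y]
    simp only [smul_neg]; abel
  simp only [hb, LieRinehartRing.lie_smul_eq_mul, AlternatingMap.map_update_sub,
    AlternatingMap.map_update_smul,
    Finset.sum_sub_distrib, smul_eq_mul, Finset.sum_add_distrib,
    LieRinehartRing.leibniz_mul_right, mul_sub, Finset.mul_sum]
  ring

/-- The differential of a form, given by Koszul's formula. -/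
def dForm (α : Form R L R k) : Form R L R (k + 1) where
  toFun := koszul α
  map_update_add' := by
    intro inst a i y z
    obtain rfl : inst = instDecidableEqFin _ := Subsingleton.elim _ _
    exact koszul_update_add α a i y z
  map_update_smul' := by
    intro inst a i f y
    obtain rfl : inst = instDecidableEqFin _ := Subsingleton.elim _ _
    have h0 : ∀ (b : Fin (k + 1) → L) (z : L),
        koszul α (Function.update b 0 (f • z)) = f • koszul α (Function.update b 0 z) := by
      intro b z
      have : ∀ u, Function.update b 0 u = (Fin.cons u (Fin.tail b) : Fin (k + 1) → L) := by
        intro u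
        rw [← Fin.cons_self_tail b, Fin.update_cons_zero, Fin.tail_cons]
      rw [this, this, koszul_cons_smul]
    rcases eq_or_ne i 0 with rfl | hi
    · exact h0 a y
    · have sw : ∀ u, Function.update a i u =
          Function.update (a ∘ Equiv.swap 0 i) 0 u ∘ Equiv.swap 0 i := by
        intro u; ext r
        rcases eq_or_ne r i with rfl | h1
        · simp
        rcases eq_or_ne r 0 with rfl | h2
        · simp [Function.update_of_ne hi, Function.update_of_ne hi.symm]
        · simp [Equiv.swap_apply_of_ne_of_ne h2 h1, Function.update_of_ne h1,
            Function.update_of_ne h2]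
      rw [sw, sw, koszul_swap _ _ hi.symm, koszul_swap _ _ hi.symm, h0, smul_neg]
  map_eq_zero_of_eq' a i j h hij := koszul_eq_zero α a h hij

theorem dForm_apply (α : Form R L R k) (a : Fin (k + 1) → L) : dForm α a = koszul α a := rfl

variable [LieAlgebra ℝ L] [LieRinehartAlgebra ℝ R L]

/-- The differential `d : Ωᵏ → Ωᵏ⁺¹` as an `ℝ`-linear map. -/
def d (k : ℕ) : Form R L R k →ₗ[ℝ] Form R L R (k + 1) where
  toFun := dForm
  map_add' α β := by
    ext a
    simp only [dForm_apply, koszul, AlternatingMap.add_apply, lie_add,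
      ← Finset.sum_add_distrib, ← smul_add]
    refine Finset.sum_congr rfl fun i _ => ?_
    congr 1
    rw [Finset.sum_add_distrib]; abel
  map_smul' c α := by
    ext a
    simp only [dForm_apply, koszul, AlternatingMap.smul_apply, lie_smul, RingHom.id_apply,
      ← Finset.smul_sum, ← smul_sub]
    simp only [Finset.smul_sum, smul_comm c]

end Differential

section Wedge

variable [Algebra ℝ R] [Module ℝ P] [IsScalarTower ℝ R P] {p q : ℕ}

/-- The wedge product `α ∧ β` of an `R`-valued and a `P`-valued form, i.e. the sum over
`(p, q)`-shuffles `∑ sign(σ) α(a_{σ(1)}, …, a_{σ(p)}) • β(a_{σ(p+1)}, …, a_{σ(p+q)})`. -/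
def wedge (α : Form R L R p) : Form R L P q →ₗ[ℝ] Form R L P (p + q) where
  toFun β := ((TensorProduct.lid R P).toLinearMap.compAlternatingMap
    (α.domCoprod β)).domDomCongr finSumFinEquiv
  map_add' β γ := by
    ext v
    rw [← AlternatingMap.domCoprod'_apply, ← AlternatingMap.domCoprod'_apply,
      ← AlternatingMap.domCoprod'_apply, TensorProduct.tmul_add, map_add]
    simp
  map_smul' c β := by
    have h : ∀ (n : ℕ) (γ : Form R L P n), c • γ = algebraMap ℝ R c • γ := by
      intro n γ; ext v; simp
    ext v
    rw [RingHom.id_apply, h, h, ← AlternatingMap.domCoprod'_apply,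
      ← AlternatingMap.domCoprod'_apply, TensorProduct.tmul_smul, map_smul]
    simp

end Wedge

end Forms

section Graded

variable (R L : Type*) [CommRing R] [LieRing L] [Module R L] [Algebra ℝ R]
  {n : ℕ} (P : Fin n → Type*) [∀ i, AddCommGroup (P i)] [∀ i, Module R (P i)]
  [∀ i, Module ℝ (P i)] [∀ i, IsScalarTower ℝ R (P i)]

/-- `⨁_{s,i} Ωˢ(L, Pᵢ)`: forms with values in the graded module `P₀[0] ⊕ … ⊕ P_{n-1}[n-1]`. -/
abbrev GForm : Type _ := ⨁ s : ℕ × Fin n, Form R L (P s.2) s.1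

variable {R L P}

/-- The elements of total degree `k`; forms in `Ωˢ(L, Pᵢ)` have total degree `s + i`. -/
def homogeneous (k : ℕ) : Submodule ℝ (GForm R L P) where
  carrier := {η | ∀ s : ℕ × Fin n, s.1 + (s.2 : ℕ) ≠ k → η s = 0}
  add_mem' h h' s hs := by simp [h s hs, h' s hs]
  zero_mem' s _ := rfl
  smul_mem' c η h s hs := by
    have := h s hs
    change c • η s = 0
    rw [this, smul_zero]

/-- Left multiplication `η ↦ α ∧ η` on forms with values in a graded module. -/
def gWedge {p : ℕ} (α : Form R L R p) : GForm R L P →ₗ[ℝ] GForm R L P :=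
  DirectSum.toModule ℝ _ _ fun s =>
    (DirectSum.lof ℝ (ℕ × Fin n) (fun t => Form R L (P t.2) t.1) (p + s.1, s.2)).comp (wedge α)

variable [LieRingModule L R] [LieRinehartRing R L] [LieAlgebra ℝ L] [LieRinehartAlgebra ℝ R L]

/-- `D` is a connection up to homotopy (an `n`-connection): it raises the total degree by one and
`D(α ∧ η) = dα ∧ η + (-1)^{|α|} α ∧ Dη`. -/
structure IsConnection (D : Module.End ℝ (GForm R L P)) : Prop where
  degree : ∀ k : ℕ, ∀ η ∈ homogeneous (R := R) (L := L) (P := P) k, D η ∈ homogeneous (k + 1)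
  leibniz : ∀ (p : ℕ) (α : Form R L R p) (η : GForm R L P),
    D (gWedge α η) = gWedge (d p α) η + (-1 : ℝ) ^ p • gWedge α (D η)

/-- `D` is a representation up to homotopy (an `n`-representation): a connection up to homotopy
with `D² = 0`. -/
structure IsRepresentation (D : Module.End ℝ (GForm R L P)) : Prop extends IsConnection D where
  flat : D ∘ₗ D = 0

end Graded

section Cohomology

variable (R L : Type*) [CommRing R] [LieRing L] [Module R L] [Algebra ℝ R]
  [LieRingModule L R] [LieRinehartRing R L] [LieAlgebra ℝ L] [LieRinehartAlgebra ℝ R L]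

/-- Closed `k`-forms. -/
def cocycles (k : ℕ) : Submodule ℝ (Form R L R k) := LinearMap.ker (d k)

/-- Exact `k`-forms. -/
def coboundaries : (k : ℕ) → Submodule ℝ (Form R L R k)
  | 0 => ⊥
  | k + 1 => LinearMap.range (d k)

/-- The cohomology `Hᵏ`: closed forms modulo exact forms, as a subspace of all `k`-forms modulo
exact forms. -/
def Cohomology (k : ℕ) : Submodule ℝ (Form R L R k ⧸ coboundaries R L k) :=
  (cocycles R L k).map (coboundaries R L k).mkQ

variable {R L}

/-- The cohomology class of a closed form. -/
def cohClass {k : ℕ} (α : Form R L R k) (hα : α ∈ cocycles R L k) : Cohomology R L k :=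
  ⟨(coboundaries R L k).mkQ α, Submodule.mem_map_of_mem hα⟩

variable (R L)

theorem one_mem_cocycles :
    AlternatingMap.constOfIsEmpty R L (Fin 0) (1 : R) ∈ cocycles R L 0 := by
  rw [cocycles, LinearMap.mem_ker]
  ext a
  have h : ∀ x : L, ⁅x, (1 : R)⁆ = 0 := fun x =>
    (LieRinehartAlgebra.anchor ℝ R L x).map_one_eq_zero
  change koszul _ a = 0
  simp [koszul, h]

variable {R L}

/-- A graded subspace `⨁ Sₖ` of `⨁ Hᵏ` is a (unital) subalgebra: it contains the class of the
constant function `1` and is closed under the product `[α] · [β] = [α ∧ β]`.  (The wedge product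
of two closed forms is always closed by the Leibniz rule, so `hαβ` is no restriction; it is there
only because the class `[α ∧ β]` is formed from it.) -/
structure IsSubalgebra (S : ∀ k, Submodule ℝ (Cohomology R L k)) : Prop where
  one_mem : cohClass _ (one_mem_cocycles R L) ∈ S 0
  mul_mem : ∀ (p q : ℕ) (α : Form R L R p) (β : Form R L R q) (hα : α ∈ cocycles R L p)
    (hβ : β ∈ cocycles R L q) (hαβ : wedge α β ∈ cocycles R L (p + q)),
    cohClass α hα ∈ S p → cohClass β hβ ∈ S q → cohClass (wedge α β) hαβ ∈ S (p + q)

end Cohomology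

section Geometry

open scoped ContDiff

variable {EM : Type*} [NormedAddCommGroup EM] [NormedSpace ℝ EM]
  {M : Type*} [TopologicalSpace M] [ChartedSpace EM M]

variable (EM M) in
/-- `C^∞(M)`. -/
abbrev Fun : Type _ := C^∞⟮𝓘(ℝ, EM), M; ℝ⟯

variable (EM) in
/-- `Γ(V)`, the smooth sections of the vector bundle `V`. -/
abbrev Sec (F : Type*) [NormedAddCommGroup F] [NormedSpace ℝ F] (V : M → Type*)
    [TopologicalSpace (Bundle.TotalSpace F V)] [∀ x, TopologicalSpace (V x)] [FiberBundle F V] :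
    Type _ := Cₛ^∞⟮𝓘(ℝ, EM); F, V⟯

section Module

variable {F : Type*} [NormedAddCommGroup F] [NormedSpace ℝ F] {V : M → Type*}
  [TopologicalSpace (Bundle.TotalSpace F V)] [∀ x, AddCommGroup (V x)] [∀ x, Module ℝ (V x)]
  [∀ x, TopologicalSpace (V x)] [FiberBundle F V] [VectorBundle ℝ F V]

/-- Multiplication of sections by smooth functions. -/
instance : SMul (Fun EM M) (Sec EM F V) :=
  ⟨fun f s => ⟨fun x => f x • s x, f.contMDiff.smul_section s.contMDiff⟩⟩

@[simp] theorem fun_smul_apply (f : Fun EM M) (s : Sec EM F V) (x : M) :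
    (f • s) x = f x • s x := rfl

instance : Module (Fun EM M) (Sec EM F V) where
  one_smul s := by ext x; simp
  mul_smul f g s := by ext x; simp [mul_smul]
  smul_zero f := by ext x; simp
  smul_add f s t := by ext x; simp
  add_smul f g s := by ext x; simp [add_smul]
  zero_smul s := by ext x; simp

instance : IsScalarTower ℝ (Fun EM M) (Sec EM F V) where
  smul_assoc c f s := by ext x; simp [mul_smul]

end Module

section Derivative

variable [IsManifold 𝓘(ℝ, EM) ∞ M]

/-- Smooth vector fields on `M`. -/
abbrev VField (EM M : Type*) [NormedAddCommGroup EM] [NormedSpace ℝ EM] [TopologicalSpace M]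
    [ChartedSpace EM M] [IsManifold 𝓘(ℝ, EM) ∞ M] : Type _ :=
  Sec (M := M) EM EM (TangentSpace 𝓘(ℝ, EM))

/-- The derivative `X(f)` of a smooth function along a smooth vector field. -/
def lieDeriv (X : VField EM M) (f : Fun EM M) : Fun EM M :=
  ⟨fun x => mfderiv 𝓘(ℝ, EM) 𝓘(ℝ, ℝ) f x (X x), by
    have h1 : ContMDiff 𝓘(ℝ, EM).tangent 𝓘(ℝ, ℝ).tangent ∞
        (tangentMap 𝓘(ℝ, EM) 𝓘(ℝ, ℝ) f) := f.contMDiff.contMDiff_tangentMap (by simp)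
    have h2 := h1.comp X.contMDiff
    exact (contMDiff_snd_tangentBundle_modelSpace ℝ 𝓘(ℝ, ℝ)).comp h2⟩

theorem lieDeriv_apply (X : VField EM M) (f : Fun EM M) (x : M) :
    lieDeriv X f x = mfderiv 𝓘(ℝ, EM) 𝓘(ℝ, ℝ) f x (X x) := rfl

theorem fun_mdiff (f : Fun EM M) (x : M) : MDifferentiableAt 𝓘(ℝ, EM) 𝓘(ℝ, ℝ) f x :=
  f.contMDiff.mdifferentiableAt (by simp)

theorem lieDeriv_add (X : VField EM M) (f g : Fun EM M) :
    lieDeriv X (f + g) = lieDeriv X f + lieDeriv X g := by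
  ext x
  have := mfderiv_add (fun_mdiff f x) (fun_mdiff g x)
  exact DFunLike.congr_fun this (X x)

theorem lieDeriv_mul (X : VField EM M) (f g : Fun EM M) :
    lieDeriv X (f * g) = f * lieDeriv X g + lieDeriv X f * g := by
  ext x
  have := DFunLike.congr_fun
    ((fun_mdiff f x).hasMFDerivAt.mul (fun_mdiff g x).hasMFDerivAt).mfderiv (X x)
  refine this.trans ?_
  change f x * _ + g x * _ = f x * _ + _ * g x
  rw [mul_comm (g x)]; rfl

theorem lieDeriv_smul (X : VField EM M) (c : ℝ) (f : Fun EM M) :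
    lieDeriv X (c • f) = c • lieDeriv X f := by
  ext x
  exact DFunLike.congr_fun ((fun_mdiff f x).hasMFDerivAt.const_smul c).mfderiv (X x)

end Derivative

section Structure

variable [IsManifold 𝓘(ℝ, EM) ∞ M]

/-- A vector bundle `V → M` with a smooth vector bundle morphism `V → TM` over the identity. -/
class AnchoredBundle (EM : Type*) [NormedAddCommGroup EM] [NormedSpace ℝ EM]
    {M : Type*} [TopologicalSpace M] [ChartedSpace EM M] [IsManifold 𝓘(ℝ, EM) ∞ M]
    (F : Type*) [NormedAddCommGroup F] [NormedSpace ℝ F] (V : M → Type*)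
    [TopologicalSpace (Bundle.TotalSpace F V)] [∀ x, AddCommGroup (V x)] [∀ x, Module ℝ (V x)]
    [∀ x, TopologicalSpace (V x)] [FiberBundle F V] [VectorBundle ℝ F V] where
  anchor : ∀ x : M, V x →ₗ[ℝ] TangentSpace 𝓘(ℝ, EM) x
  contMDiff_anchor : ∀ a : Sec EM F V, ContMDiff 𝓘(ℝ, EM) 𝓘(ℝ, EM).tangent ∞
    fun x => (⟨x, anchor x (a x)⟩ : TangentBundle 𝓘(ℝ, EM) M)

variable {F : Type*} [NormedAddCommGroup F] [NormedSpace ℝ F] {V : M → Type*}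
  [TopologicalSpace (Bundle.TotalSpace F V)] [∀ x, AddCommGroup (V x)] [∀ x, Module ℝ (V x)]
  [∀ x, TopologicalSpace (V x)] [FiberBundle F V] [VectorBundle ℝ F V]

/-- The anchor `Γ(V) → 𝔛(M)` on sections. -/
def rho [AnchoredBundle EM F V] (a : Sec EM F V) : VField EM M :=
  ⟨fun x => AnchoredBundle.anchor F x (a x), AnchoredBundle.contMDiff_anchor a⟩

theorem rho_add [AnchoredBundle EM F V] (a b : Sec EM F V) : rho (a + b) = rho a + rho b := by
  ext x; simp [rho]

theorem rho_fsmul [AnchoredBundle EM F V] (f : Fun EM M) (a : Sec EM F V) :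
    rho (f • a) = f • rho a := by
  ext x; simp [rho]

theorem rho_smul [AnchoredBundle EM F V] (c : ℝ) (a : Sec EM F V) :
    rho (c • a) = c • rho a := by
  ext x; simp [rho]

/-- A Lie algebroid structure on the vector bundle `V → M`: an anchor and a Lie bracket on `Γ(V)`
satisfying the Leibniz rule `[a, f b] = f [a, b] + ρ(a)(f) b`.  The last field says that the anchor
preserves brackets, `ρ[a, b] = [ρ(a), ρ(b)]` as derivations of `C^∞(M)`. -/
class LieAlgebroid (EM : Type*) [NormedAddCommGroup EM] [NormedSpace ℝ EM]
    {M : Type*} [TopologicalSpace M] [ChartedSpace EM M] [IsManifold 𝓘(ℝ, EM) ∞ M]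
    (F : Type*) [NormedAddCommGroup F] [NormedSpace ℝ F] (V : M → Type*)
    [TopologicalSpace (Bundle.TotalSpace F V)] [∀ x, AddCommGroup (V x)] [∀ x, Module ℝ (V x)]
    [∀ x, TopologicalSpace (V x)] [FiberBundle F V] [VectorBundle ℝ F V]
    extends AnchoredBundle EM F V where
  bracket : Sec EM F V →ₗ[ℝ] Sec EM F V →ₗ[ℝ] Sec EM F V
  bracket_self : ∀ a : Sec EM F V, bracket a a = 0
  jacobi : ∀ a b c : Sec EM F V, bracket a (bracket b c) = bracket (bracket a b) c + bracket b (bracket a c)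
  leibniz : ∀ (a b : Sec EM F V) (f : Fun EM M),
    bracket a (f • b) = f • bracket a b + lieDeriv (rho a) f • b
  rho_bracket : ∀ (a b : Sec EM F V) (f : Fun EM M),
    lieDeriv (rho (bracket a b)) f =
      lieDeriv (rho a) (lieDeriv (rho b) f) - lieDeriv (rho b) (lieDeriv (rho a) f)

variable [LieAlgebroid EM F V]

instance : LieRing (Sec EM F V) where
  bracket a b := LieAlgebroid.bracket a b
  add_lie a b c := by simp
  lie_add a b c := by simp
  lie_self := LieAlgebroid.bracket_self
  leibniz_lie := LieAlgebroid.jacobi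

instance : LieAlgebra ℝ (Sec EM F V) where
  lie_smul c a b := (LieAlgebroid.bracket a).map_smul c b

/-- Sections act on functions through the anchor, `⁅a, f⁆ = ρ(a)(f)`. -/
instance : LieRingModule (Sec EM F V) (Fun EM M) where
  bracket a f := lieDeriv (rho a) f
  add_lie a b f := by
    ext x
    change lieDeriv (rho (a + b)) f x = lieDeriv (rho a) f x + lieDeriv (rho b) f x
    rw [rho_add]; exact map_add (mfderiv 𝓘(ℝ, EM) 𝓘(ℝ, ℝ) f x) (rho a x) (rho b x)
  lie_add a f g := lieDeriv_add _ _ _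
  leibniz_lie a b f := by
    change lieDeriv (rho a) (lieDeriv (rho b) f) = lieDeriv (rho (LieAlgebroid.bracket a b)) f +
      lieDeriv (rho b) (lieDeriv (rho a) f)
    rw [LieAlgebroid.rho_bracket]; abel

instance : LieRinehartRing (Fun EM M) (Sec EM F V) where
  lie_smul_eq_mul' f g a := by
    ext x
    change lieDeriv (rho (f • a)) g x = f x * lieDeriv (rho a) g x
    rw [rho_fsmul]; exact map_smul (mfderiv 𝓘(ℝ, EM) 𝓘(ℝ, ℝ) g x) (f x) (rho a x)
  leibniz_mul_right' a f g := lieDeriv_mul _ _ _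
  leibniz_smul_right' a b f := LieAlgebroid.leibniz a b f

instance : LieRinehartAlgebra ℝ (Fun EM M) (Sec EM F V) where
  smul_lie c a f := by
    ext x
    change lieDeriv (rho (c • a)) f x = c • lieDeriv (rho a) f x
    rw [rho_smul]; exact map_smul (mfderiv 𝓘(ℝ, EM) 𝓘(ℝ, ℝ) f x) c (rho a x)
  lie_smul c a f := lieDeriv_smul _ _ _

variable (EM F V) in
/-- A Lie subalgebroid over `M`: a smooth subbundle (near every point it is spanned by finitely many
pointwise independent smooth sections) whose sections are closed under the bracket. -/
structure LieSubalgebroid where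
  fiber : ∀ x, Submodule ℝ (V x)
  subbundle : ∀ x₀, ∃ (r : ℕ) (s : Fin r → Sec EM F V), ∀ᶠ x in 𝓝 x₀,
    LinearIndependent ℝ (fun i => s i x) ∧ Submodule.span ℝ (Set.range fun i => s i x) = fiber x
  lie_mem : ∀ a b : Sec EM F V, (∀ x, a x ∈ fiber x) → (∀ x, b x ∈ fiber x) →
    ∀ x, ⁅a, b⁆ x ∈ fiber x

namespace LieSubalgebroid

/-- `Γ(B) ⊆ Γ(V)` as a Lie-Rinehart subalgebra. -/
def sections (B : LieSubalgebroid EM F V) : LieRinehartSubalgebra (Fun EM M) (Sec EM F V) where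
  carrier := {a | ∀ x, a x ∈ B.fiber x}
  add_mem' ha hb x := add_mem (ha x) (hb x)
  zero_mem' x := zero_mem _
  smul_mem' f a ha x := Submodule.smul_mem _ (f x) (ha x)
  lie_mem' {a b} ha hb := B.lie_mem a b ha hb

/-- `B` has codimension `q`, i.e. `V / B` has rank `q`. -/
def HasCodim (B : LieSubalgebroid EM F V) (q : ℕ) : Prop :=
  ∀ x, Module.finrank ℝ (B.fiber x) + q = Module.finrank ℝ (V x)

end LieSubalgebroid

end Structure

section Pontryagin

variable [IsManifold 𝓘(ℝ, EM) ∞ M]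
  {F : Type*} [NormedAddCommGroup F] [NormedSpace ℝ F] {V : M → Type*}
  [TopologicalSpace (Bundle.TotalSpace F V)] [∀ x, AddCommGroup (V x)] [∀ x, Module ℝ (V x)]
  [∀ x, TopologicalSpace (V x)] [FiberBundle F V] [VectorBundle ℝ F V] [LieAlgebroid EM F V]
  {n : ℕ} {FE : Fin n → Type*} [∀ i, NormedAddCommGroup (FE i)] [∀ i, NormedSpace ℝ (FE i)]
  {E : Fin n → M → Type*} [∀ i, TopologicalSpace (Bundle.TotalSpace (FE i) (E i))]
  [∀ i x, AddCommGroup (E i x)] [∀ i x, Module ℝ (E i x)] [∀ i x, TopologicalSpace (E i x)]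
  [∀ i, FiberBundle (FE i) (E i)] [∀ i, VectorBundle ℝ (FE i) (E i)]

variable (EM F V FE E) in
/-- `Ω(V, E₀[0] ⊕ … ⊕ E_{n-1}[n-1])`. -/
abbrev BundleForm : Type _ :=
  GForm (Fun EM M) (Sec EM F V) fun i => Sec EM (FE i) (E i)

/-- A section `e ∈ Γ(Eᵢ) = Ω⁰(V, Eᵢ)` as a form. -/
def zeroForm (i : Fin n) (e : Sec EM (FE i) (E i)) : BundleForm EM F V FE E :=
  DirectSum.lof ℝ (ℕ × Fin n)
    (fun s => Form (Fun EM M) (Sec EM F V) (Sec EM (FE s.2) (E s.2)) s.1) (0, i)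
    (AlternatingMap.constOfIsEmpty _ _ (Fin 0) e)

/-- `τ ∈ Ω²ᵐ(V)` is the graded trace of the `m`-th power `R_Dᵐ` of the curvature of `D`, where
`R_Dᵐ` is the `End`-valued form acting as `D²ᵐ`.  The graded trace only involves the components of
`R_Dᵐ` in `Ω²ᵐ(V, End(Eᵢ))`.  These are denoted `K i`; they are determined by
`R_Dᵐ(a₁, …, a₂ₘ)(e) = (D²ᵐ e)(a₁, …, a₂ₘ)` for sections `e` of `Eᵢ`. -/
def IsGradedTraceCurvPow (D : Module.End ℝ (BundleForm EM F V FE E)) (m : ℕ)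
    (τ : Form (Fun EM M) (Sec EM F V) (Fun EM M) (2 * m)) : Prop :=
  ∃ K : ∀ i : Fin n, (Fin (2 * m) → Sec EM F V) → ∀ x : M, E i x →ₗ[ℝ] E i x,
    (∀ i a (e : Sec EM (FE i) (E i)) x,
      K i a x (e x) = ((D ^ (2 * m)) (zeroForm i e)) (2 * m, i) a x) ∧
    ∀ a x, τ a x = ∑ i : Fin n, (-1 : ℝ) ^ (i : ℕ) * LinearMap.trace ℝ (E i x) (K i a x)

variable (EM F V FE E) in
/-- `c ∈ H²ᵐ(V)` is the `m`-th Pontryagin character `[gtr(R_Dᵐ)]` of the graded bundle, for some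
connection up to homotopy `D` of `V` on it. -/
def IsPontryaginCharacter (m : ℕ) (c : Cohomology (Fun EM M) (Sec EM F V) (2 * m)) : Prop :=
  ∃ (D : Module.End ℝ (BundleForm EM F V FE E))
    (τ : Form (Fun EM M) (Sec EM F V) (Fun EM M) (2 * m)) (hτ : τ ∈ cocycles _ _ (2 * m)),
    IsConnection D ∧ IsGradedTraceCurvPow D m τ ∧ c = cohClass τ hτ

variable (EM F V FE E) in
/-- The degree `l` part `Pontˡ ⊆ Hˡ(V)` of the subalgebra of `H(V)` generated by the Pontryagin
characters (for all `m ≥ 1`) of the graded bundle `E₀[0] ⊕ … ⊕ E_{n-1}[n-1]`: the intersection of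
the degree `l` parts of all subalgebras containing them. -/
def pontryagin (l : ℕ) : Submodule ℝ (Cohomology (Fun EM M) (Sec EM F V) l) :=
  sInf {T | ∃ S : ∀ k, Submodule ℝ (Cohomology (Fun EM M) (Sec EM F V) k),
    IsSubalgebra S ∧
    (∀ m, 1 ≤ m → ∀ c, IsPontryaginCharacter EM F V FE E m c → c ∈ S (2 * m)) ∧ T = S l}

end Pontryagin

end Geometry

end Algebroid

end

open scoped ContDiff

/-! This is the argument of Bott's vanishing theorem. Say that a form on A has order p along B if it
vanishes as soon as fewer than p of its arguments lie in Γ(A) outside Γ(B). Orders add under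
products (`VanishesTo.star`). Since A/B has rank q, order greater than q forces a form to be zero:
an adapted local frame has only q entries outside B (`form_eq_zero`).

A Pontryagin character comes with some n-connection D of A. Let D₁ be the flat n-connection of B.
With a bundle projection pr from A to B, adding the form-linear operator built from pr*(D₁ - D|B) to
D gives an n-connection D' of A that restricts to D₁ (`exists_extension`). Its curvature restricts
to zero on B, so it has order 1, and D'^(2m) and its graded trace have order m
(`vanishesTo_curvature`, `vanishesTo_pow`, `vanishesTo_trace`). Thus every character has a
representative whose order is half its degree. The classes with such representatives form a
subalgebra (`halfFiltration_isSubalgebra`), which therefore contains the Pontryagin algebra. In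
degree l > 2q the order is at least ⌈l/2⌉ > q, so nothing survives.

The remaining point is Chern–Weil theory: passing from D to D' changes the trace by an exact form
(`exists_isTrace_pow_sub`). Along the segment from D to D', the derivative of a power of the
curvature is, up to graded commutators of form-linear operators, a graded commutator with the
connection (`transgression`). The graded trace kills the former and turns the latter into a
differential (`isTrace_commutator`, `isTrace_comm_connection`).

Two devices organise the calculations. Forms are replaced by functions of lists, with the degree
read off from the length. Products and differentials are then given by recursion on the first entry,
through the derivation rule for contractions and Cartan's formula, so identities become inductions
on lists without transport between degrees. Traces are computed in local frames multiplied by a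
cut-off χ, so that all data are global; identities hold up to factors χ, which are removed pointwise
because each point has a frame with χ = 1 nearby. -/

noncomputable section

namespace Algebroid

/-! ### Exterior calculus on functions of lists: contraction, shuffle product, order along a subset.
-/

section ListCalculus

set_option linter.unusedSectionVars false

variable {R L P Q N : Type*} [CommRing R] [AddCommGroup P] [Module R P] [AddCommGroup Q]
  [Module R Q] [AddCommGroup N] [Module R N]

/-- The grading involution `(-1)^{deg}` on functions of lists. -/
def sgn (f : List L → P) : List L → P := fun l => (-1 : ℤ) ^ l.length • f l

/-- The contraction `ι_a f`. -/
def contr (a : L) (f : List L → P) : List L → P := fun l => f (a :: l)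

theorem contr_apply (a : L) (f : List L → P) (l : List L) : contr a f l = f (a :: l) := rfl

/-- The signed shuffle product along a bilinear pairing: it is determined by
`ι_a (f ⋆ g) = ι_a f ⋆ g + (-1)^{deg f} f ⋆ ι_a g`. -/
def starAux (B : P →ₗ[R] Q →ₗ[R] N) : List L → (List L → P) → (List L → Q) → N
  | [], f, g => B (f []) (g [])
  | a :: l, f, g => starAux B l (contr a f) g + starAux B l (sgn f) (contr a g)

/-- The signed shuffle product of two functions of lists. -/
def star (B : P →ₗ[R] Q →ₗ[R] N) (f : List L → P) (g : List L → Q) : List L → N :=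
  fun l => starAux B l f g

variable (B : P →ₗ[R] Q →ₗ[R] N)

@[simp] theorem star_nil (f : List L → P) (g : List L → Q) : star B f g [] = B (f []) (g []) := rfl

theorem contr_star (a : L) (f : List L → P) (g : List L → Q) :
    contr a (star B f g) = star B (contr a f) g + star B (sgn f) (contr a g) := rfl

theorem star_cons (a : L) (l : List L) (f : List L → P) (g : List L → Q) :
    star B f g (a :: l) = star B (contr a f) g l + star B (sgn f) (contr a g) l := rfl

theorem contr_sgn (a : L) (f : List L → P) : contr a (sgn f) = - sgn (contr a f) := by
  ext l; simp [contr, sgn, pow_succ]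

theorem sgn_cons (a : L) (l : List L) (f : List L → P) :
    sgn f (a :: l) = - sgn (contr a f) l := congrFun (contr_sgn a f) l

theorem sgn_sgn (f : List L → P) : sgn (sgn f) = f := by
  ext l; simp [sgn, smul_smul, ← mul_pow]

theorem sgn_add (f g : List L → P) : sgn (f + g) = sgn f + sgn g := by ext l; simp [sgn]
theorem sgn_neg (f : List L → P) : sgn (-f) = - sgn f := by ext l; simp [sgn]
theorem sgn_zero : sgn (0 : List L → P) = 0 := by ext l; simp [sgn]
theorem sgn_smul (r : R) (f : List L → P) : sgn (r • f) = r • sgn f := by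
  ext l; exact smul_comm _ _ _
theorem sgn_zsmul (r : ℤ) (f : List L → P) : sgn (r • f) = r • sgn f := by
  ext l; exact smul_comm ((-1 : ℤ) ^ l.length) r (f l)
theorem sgn_comp (φ : P →ₗ[R] Q) (f : List L → P) : sgn (fun l => φ (f l)) = fun l => φ (sgn f l) := by
  ext l; simp [sgn]
theorem contr_add (a : L) (f g : List L → P) : contr a (f + g) = contr a f + contr a g := rfl
theorem star_add_left (f f' : List L → P) (g : List L → Q) :
    star B (f + f') g = star B f g + star B f' g := by
  ext l
  induction l generalizing f f' g with
  | nil => simp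
  | cons a l ih =>
    rw [star_cons, contr_add, sgn_add, ih, ih, Pi.add_apply, Pi.add_apply, Pi.add_apply, star_cons,
      star_cons]
    abel

theorem star_add_right (f : List L → P) (g g' : List L → Q) :
    star B f (g + g') = star B f g + star B f g' := by
  ext l
  induction l generalizing f g g' with
  | nil => simp
  | cons a l ih =>
    rw [star_cons, contr_add, ih, ih, Pi.add_apply, Pi.add_apply, Pi.add_apply, star_cons,
      star_cons]
    abel

/-- The product as a biadditive map. -/
def starHom : (List L → P) →+ (List L → Q) →+ (List L → N) :=
  AddMonoidHom.mk' (fun f => AddMonoidHom.mk' (star B f) (star_add_right B f))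
    fun f f' => by ext1 g; exact star_add_left B f f' g

theorem starHom_apply (f : List L → P) (g : List L → Q) : starHom B f g = star B f g := rfl

theorem star_zsmul_left (z : ℤ) (f : List L → P) (g : List L → Q) :
    star B (z • f) g = z • star B f g := by
  simp only [← starHom_apply, map_zsmul]; rfl

theorem star_zsmul_right (z : ℤ) (f : List L → P) (g : List L → Q) :
    star B f (z • g) = z • star B f g := by
  simp only [← starHom_apply, map_zsmul]

theorem star_neg_left (f : List L → P) (g : List L → Q) : star B (-f) g = - star B f g := by
  simp only [← starHom_apply, map_neg]; rfl

theorem star_neg_right (f : List L → P) (g : List L → Q) : star B f (-g) = - star B f g := by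
  simp only [← starHom_apply, map_neg]

theorem star_zero_left (g : List L → Q) : star B 0 g = 0 := by
  simp only [← starHom_apply, map_zero]; rfl

theorem star_zero_right (f : List L → P) : star B f 0 = 0 := by
  simp only [← starHom_apply, map_zero]

theorem star_sum_right {ι : Type*} (s : Finset ι) (f : List L → P) (g : ι → List L → Q) :
    star B f (∑ i ∈ s, g i) = ∑ i ∈ s, star B f (g i) := by
  simp only [← starHom_apply, map_sum]

theorem star_smul_left (r : R) (f : List L → P) (g : List L → Q) :
    star B (r • f) g = r • star B f g := by
  ext l
  induction l generalizing f g with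
  | nil => simp
  | cons a l ih =>
    have h : contr a (r • f) = r • contr a f := rfl
    simp only [star_cons, Pi.smul_apply, h, sgn_smul, ih, smul_add]

theorem star_smul_right (r : R) (f : List L → P) (g : List L → Q) :
    star B f (r • g) = r • star B f g := by
  ext l
  induction l generalizing f g with
  | nil => simp
  | cons a l ih =>
    have h : contr a (r • g) = r • contr a g := rfl
    simp only [star_cons, Pi.smul_apply, h, ih, smul_add]

/-- The degree of a product is the sum of the degrees, so the grading involution is multiplicative.
This is what makes the recursion for the product associative. -/
theorem sgn_star (f : List L → P) (g : List L → Q) :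
    sgn (star B f g) = star B (sgn f) (sgn g) := by
  ext l
  induction l generalizing f g with
  | nil => simp [sgn]
  | cons a l ih =>
    have h : sgn (star B f g) (a :: l) = - sgn (contr a (star B f g)) l := by
      simp [sgn, contr, pow_succ]
    rw [h, contr_star, sgn_add, Pi.add_apply, ih, ih, star_cons, contr_sgn, contr_sgn,
      star_neg_left, star_neg_right]
    simp only [Pi.neg_apply]; abel

/-- Associativity of the product. -/
theorem star_assoc {P₁ P₂ P₃ P₁₂ P₂₃ : Type*} [AddCommGroup P₁] [Module R P₁] [AddCommGroup P₂]
    [Module R P₂] [AddCommGroup P₃] [Module R P₃] [AddCommGroup P₁₂] [Module R P₁₂]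
    [AddCommGroup P₂₃] [Module R P₂₃] (B₁ : P₁ →ₗ[R] P₂ →ₗ[R] P₁₂) (B₂ : P₁₂ →ₗ[R] P₃ →ₗ[R] N)
    (B₃ : P₂ →ₗ[R] P₃ →ₗ[R] P₂₃) (B₄ : P₁ →ₗ[R] P₂₃ →ₗ[R] N)
    (hB : ∀ x y z, B₂ (B₁ x y) z = B₄ x (B₃ y z))
    (f : List L → P₁) (g : List L → P₂) (h : List L → P₃) :
    star B₂ (star B₁ f g) h = star B₄ f (star B₃ g h) := by
  ext l
  induction l generalizing f g h with
  | nil => simp [hB]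
  | cons a l ih =>
    rw [star_cons, star_cons, contr_star, contr_star, star_add_left, star_add_right, Pi.add_apply,
      Pi.add_apply, sgn_star, ih, ih, ih, add_assoc]

/-- A function of lists of parity `p`. -/
def HasParity (p : ℕ) (f : List L → P) : Prop := sgn f = (-1 : ℤ) ^ p • f

theorem HasParity.contr {p : ℕ} {f : List L → P} (hf : HasParity p f) (a : L) :
    HasParity (p + 1) (contr a f) := by
  have := congrArg (Algebroid.contr a) hf
  rw [contr_sgn] at this
  rw [HasParity, ← neg_inj, this, pow_succ, mul_neg_one, neg_smul, neg_neg]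
  rfl

theorem hasParity_of_length {p : ℕ} {f : List L → P}
    (h : ∀ l, f l ≠ 0 → (-1 : ℤ) ^ l.length = (-1) ^ p) : HasParity p f := by
  ext l
  by_cases hl : f l = 0
  · simp [sgn, hl]
  · simp [sgn, h l hl]

/-- Graded commutativity. -/
theorem star_comm {p q : ℕ} (B : P →ₗ[R] Q →ₗ[R] N) (f : List L → P) (g : List L → Q)
    (hf : HasParity p f) (hg : HasParity q g) :
    star B f g = (-1 : ℤ) ^ (p * q) • star B.flip g f := by
  ext l
  induction l generalizing f g p q with
  | nil =>
    have h1 : f [] = (-1 : ℤ) ^ p • f [] := by simpa [sgn] using congrFun hf []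
    have h2 : g [] = (-1 : ℤ) ^ q • g [] := by simpa [sgn] using congrFun hg []
    rcases Nat.even_or_odd p with hp | hp
    · simp [(hp.mul_right q).neg_one_pow]
    rcases Nat.even_or_odd q with hq | hq
    · simp [(hq.mul_left p).neg_one_pow]
    -- An odd function equals its own negative at the empty list. Substituting this once gives the
    -- sign without dividing by 2, which need not be possible in `P`.
    · rw [hp.neg_one_pow] at h1
      rw [hq.neg_one_pow] at h2
      rw [(hp.mul hq).neg_one_pow]
      simp only [star_nil, Pi.smul_apply, LinearMap.flip_apply]
      rw [neg_one_smul]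
      conv_lhs => rw [h1]
      simp
  | cons a l ih =>
    rw [star_cons, ih _ _ (hf.contr a) hg, ih _ _ (show HasParity p (sgn f) by rw [hf, HasParity, sgn_zsmul, hf])
        (hg.contr a), hf, Pi.smul_apply, Pi.smul_apply, Pi.smul_apply, star_cons, hg,
      star_zsmul_left, star_zsmul_right]
    simp only [Pi.smul_apply, smul_add, smul_smul, ← pow_add]
    rw [add_comm]
    have e1 : (-1 : ℤ) ^ (p * (q + 1) + p) = (-1) ^ (p * q) := by
      rw [show p * (q + 1) + p = p * q + 2 * p by ring, pow_add, pow_mul]; simp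
    have e2 : (-1 : ℤ) ^ ((p + 1) * q) = (-1) ^ (p * q + q) := by ring_nf
    rw [e1, e2]

/-- `f l = 0` as soon as less than `p` entries of `l` lie outside `S`. -/
def VanishesTo (S : Set L) (p : ℕ) (f : List L → P) : Prop :=
  ∀ l : List L, (open scoped Classical in l.countP (fun a => decide (a ∉ S))) < p → f l = 0

section Vanishes

variable {S : Set L}

theorem VanishesTo.zero (f : List L → P) : VanishesTo S 0 f := fun _ h => absurd h (Nat.not_lt_zero _)

theorem VanishesTo.mono {p p' : ℕ} {f : List L → P} (h : VanishesTo S p f) (hp : p' ≤ p) :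
    VanishesTo S p' f := fun l hl => h l (hl.trans_le hp)

theorem VanishesTo.sgn {p : ℕ} {f : List L → P} (h : VanishesTo S p f) : VanishesTo S p (sgn f) :=
  fun l hl => by simp [Algebroid.sgn, h l hl]

theorem VanishesTo.contr_mem {p : ℕ} {f : List L → P} (h : VanishesTo S p f) {a : L} (ha : a ∈ S) :
    VanishesTo S p (contr a f) := fun l hl => h _ (by simpa [ha] using hl)

theorem VanishesTo.contr {p : ℕ} {f : List L → P} (h : VanishesTo S p f) (a : L) :
    VanishesTo S (p - 1) (contr a f) := fun l hl => h _ (by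
      refine lt_of_le_of_lt (b := l.countP _ + 1) ?_ (Nat.add_lt_of_lt_sub hl)
      rw [List.countP_cons]; split <;> omega)

/-- Each entry of the list is fed to exactly one factor. Contraction with an element of `S` keeps
the order of a factor, and any other contraction lowers it by at most one, so the recursion for the
product preserves the bound. -/
theorem VanishesTo.star {p q : ℕ} {f : List L → P} {g : List L → Q} (hf : VanishesTo S p f)
    (hg : VanishesTo S q g) : VanishesTo S (p + q) (star B f g) := by
  intro l
  induction l generalizing f g p q with
  | nil =>
    intro h
    rcases Nat.eq_zero_or_pos p with rfl | hp
    · simp [hg [] (by simpa using h)]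
    · simp [hf [] (by simpa using hp)]
  | cons a l ih =>
    intro h
    rw [star_cons]
    by_cases ha : a ∈ S
    · simp only [ha, not_true, decide_false, List.countP_cons] at h
      rw [ih (hf.contr_mem ha) hg (by simpa using h), ih hf.sgn (hg.contr_mem ha) (by simpa using h),
        add_zero]
    · simp only [ha, not_false_eq_true, decide_true, List.countP_cons, if_true] at h
      rw [ih (hf.contr a) hg (by omega), ih hf.sgn (hg.contr a) (by omega), add_zero]

end Vanishes

/-! ### Lie derivative and Koszul differential on functions of lists. -/

section Differential

variable [LieRing L] [LieRingModule L R]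

/-- The Lie derivative on functions of lists. -/
def lieL (a : L) : (List L → R) → List L → R
  | f, [] => ⁅a, f []⁆
  | f, b :: l => lieL a (contr b f) l - f (⁅a, b⁆ :: l)

theorem contr_lieL (a b : L) (f : List L → R) :
    contr b (lieL a f) = lieL a (contr b f) - contr ⁅a, b⁆ f := rfl

@[simp] theorem lieL_nil (a : L) (f : List L → R) : lieL a f [] = ⁅a, f []⁆ := rfl

theorem lieL_cons (a b : L) (l : List L) (f : List L → R) :
    lieL a f (b :: l) = lieL a (contr b f) l - contr ⁅a, b⁆ f l := rfl

theorem lieL_add (a : L) (f g : List L → R) : lieL a (f + g) = lieL a f + lieL a g := by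
  ext l
  induction l generalizing f g with
  | nil => simp [lieL]
  | cons b l ih =>
    simp only [lieL_cons, contr_add, ih, Pi.add_apply]; abel

theorem lieL_neg (a : L) (f : List L → R) : lieL a (-f) = - lieL a f :=
  (AddMonoidHom.mk' (lieL a) (lieL_add a)).map_neg f

theorem lieL_sgn (a : L) (f : List L → R) : lieL a (sgn f) = sgn (lieL a f) := by
  ext l
  induction l generalizing f with
  | nil => simp [sgn]
  | cons b l ih =>
    rw [lieL_cons, contr_sgn, lieL_neg, contr_sgn, sgn_cons, contr_lieL, Pi.neg_apply, ih,
      sub_eq_add_neg (lieL a (contr b f)), sgn_add, sgn_neg]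
    simp only [Pi.neg_apply, Pi.add_apply]; abel

/-- The Koszul differential on functions of lists, defined by Cartan's formula. -/
def dAux : List L → (List L → R) → R
  | [], _ => 0
  | a :: l, f => lieL a f l - dAux l (contr a f)

/-- The Koszul differential on functions of lists. -/
def dL (f : List L → R) : List L → R := fun l => dAux l f

@[simp] theorem dL_nil (f : List L → R) : dL f [] = 0 := rfl

theorem contr_dL (a : L) (f : List L → R) : contr a (dL f) = lieL a f - dL (contr a f) := rfl

theorem dL_cons (a : L) (l : List L) (f : List L → R) :
    dL f (a :: l) = lieL a f l - dL (contr a f) l := rfl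

theorem dL_add (f g : List L → R) : dL (f + g) = dL f + dL g := by
  ext l
  induction l generalizing f g with
  | nil => simp
  | cons b l ih =>
    simp only [dL_cons, Pi.add_apply, contr_add, ih, lieL_add]; abel

/-- The differential as an additive map. -/
def dLHom : (List L → R) →+ (List L → R) := AddMonoidHom.mk' dL dL_add

theorem dL_neg (f : List L → R) : dL (-f) = - dL f := dLHom.map_neg f
theorem dL_sum {ι : Type*} (s : Finset ι) (f : ι → List L → R) :
    dL (∑ i ∈ s, f i) = ∑ i ∈ s, dL (f i) := map_sum dLHom f s
theorem dL_zsmul (z : ℤ) (f : List L → R) : dL (z • f) = z • dL f := map_zsmul dLHom z f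

theorem dL_sgn (f : List L → R) : dL (sgn f) = - sgn (dL f) := by
  ext l
  induction l generalizing f with
  | nil => simp [sgn]
  | cons b l ih =>
    rw [dL_cons, contr_sgn, dL_neg, Pi.neg_apply, ih, lieL_sgn, Pi.neg_apply, Pi.neg_apply, sgn_cons,
      contr_dL, sub_eq_add_neg (lieL b f), sgn_add, sgn_neg]
    simp only [Pi.neg_apply, Pi.add_apply]; abel

variable [Module R L] [LieRinehartRing R L]

/-- The product of scalar functions of lists. -/
abbrev mulL (f g : List L → R) : List L → R := star (LinearMap.mul R R) f g

/-- At the empty list this is the Leibniz rule of the action on `R`. The inductive step uses only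
how a Lie derivative commutes with a contraction. -/
theorem lieL_mulL (a : L) (f g : List L → R) :
    lieL a (mulL f g) = mulL (lieL a f) g + mulL f (lieL a g) := by
  ext l
  induction l generalizing f g with
  | nil => simp [lieL, LieRinehartRing.leibniz_mul_right]; ring
  | cons b l ih =>
    simp only [mulL] at ih ⊢
    rw [lieL_cons, contr_star, contr_star, lieL_add, Pi.add_apply, Pi.add_apply, Pi.add_apply, ih,
      ih, Pi.add_apply, Pi.add_apply, star_cons, star_cons, contr_lieL, contr_lieL, lieL_sgn,
      sub_eq_add_neg (lieL a (contr b f)), sub_eq_add_neg (lieL a (contr b g)), star_add_left,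
      star_add_right, star_neg_left, star_neg_right]
    simp only [Pi.add_apply, Pi.neg_apply]; abel

/-- The Leibniz rule for the differential. -/
theorem dL_mulL (f g : List L → R) : dL (mulL f g) = mulL (dL f) g + mulL (sgn f) (dL g) := by
  ext l
  induction l generalizing f g with
  | nil => simp
  | cons b l ih =>
    have h := lieL_mulL b f g
    simp only [mulL] at ih h ⊢
    rw [dL_cons, h, contr_star, dL_add, Pi.add_apply, Pi.add_apply, Pi.add_apply, ih, ih,
      Pi.add_apply, Pi.add_apply, star_cons, star_cons, contr_dL, contr_dL, contr_sgn, dL_sgn,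
      sgn_sgn, sub_eq_add_neg (lieL b f), sub_eq_add_neg (lieL b g), star_add_left, star_add_right,
      star_neg_left, star_neg_right, star_neg_left, star_neg_left]
    simp only [Pi.add_apply, Pi.neg_apply]; abel

end Differential

end ListCalculus

/-! ### Comparison of the recursive product with the sum over all permutations. -/

section Shuffle

set_option linter.unusedSectionVars false

variable {R L P Q N : Type*} [CommRing R] [AddCommGroup P] [Module R P] [AddCommGroup Q]
  [Module R Q] [AddCommGroup N] [Module R N]

/-- Functions of lists that change by the sign of the permutation when an entry is moved. -/
def IsAlt (f : List L → P) : Prop :=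
  ∀ l₁ a l₂, f (l₁ ++ a :: l₂) = (-1 : ℤ) ^ l₁.length • f (a :: (l₁ ++ l₂))

theorem IsAlt.contr {f : List L → P} (hf : IsAlt f) (b : L) : IsAlt (contr b f) := by
  intro l₁ a l₂
  have h1 := hf (b :: l₁) a l₂
  have h2 : f (a :: b :: (l₁ ++ l₂)) = (-1 : ℤ) ^ 1 • f (b :: a :: (l₁ ++ l₂)) :=
    hf [a] b (l₁ ++ l₂)
  have h3 : f (b :: (l₁ ++ a :: l₂)) = (-1 : ℤ) ^ (l₁.length + 1) • f (a :: b :: (l₁ ++ l₂)) := h1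
  rw [contr_apply, contr_apply, h3, h2, pow_succ]
  simp

/-- Functions of lists supported on lists of length `p`. -/
def SuppLength (p : ℕ) (f : List L → P) : Prop := ∀ l, l.length ≠ p → f l = 0

theorem SuppLength.contr {p : ℕ} {f : List L → P} (hf : SuppLength p f) (b : L) :
    SuppLength (p - 1) (contr b f) := fun l hl => hf _ (by simp; omega)

theorem SuppLength.contr_zero {f : List L → P} (hf : SuppLength 0 f) (b : L) : Algebroid.contr b f = 0 :=
  funext fun _ => hf _ (by simp)

theorem SuppLength.sgn {p : ℕ} {f : List L → P} (hf : SuppLength p f) :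
    sgn f = (-1 : ℤ) ^ p • f := by
  ext l
  by_cases h : l.length = p
  · simp [Algebroid.sgn, h]
  · simp [Algebroid.sgn, hf l h]

theorem SuppLength.zsmul {p : ℕ} {f : List L → P} (hf : SuppLength p f) (z : ℤ) :
    SuppLength p (z • f) := fun l h => by simp [hf l h]

theorem SuppLength.star (B : P →ₗ[R] Q →ₗ[R] N) {p q : ℕ} {f : List L → P} {g : List L → Q}
    (hf : SuppLength p f) (hg : SuppLength q g) : SuppLength (p + q) (star B f g) := by
  intro l
  induction l generalizing f g p q with
  | nil =>
    intro h
    rw [star_nil]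
    rcases Nat.eq_zero_or_pos p with rfl | hp
    · rw [hg [] (by simpa using h), map_zero]
    · rw [hf [] (by simpa using hp.ne), map_zero, LinearMap.zero_apply]
  | cons a l ih =>
    intro h
    rw [List.length_cons] at h
    rw [star_cons, hf.sgn]
    have h1 : Algebroid.star B (Algebroid.contr a f) g l = 0 := by
      rcases Nat.eq_zero_or_pos p with rfl | hp
      · rw [hf.contr_zero, star_zero_left]; rfl
      · exact ih (hf.contr a) hg (by omega)
    have h2 : Algebroid.star B ((-1 : ℤ) ^ p • f) (Algebroid.contr a g) l = 0 := by
      rcases Nat.eq_zero_or_pos q with rfl | hq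
      · rw [hg.contr_zero, star_zero_right]; rfl
      · exact ih (hf.zsmul _) (hg.contr a) (by omega)
    rw [h1, h2, add_zero]

theorem SuppLength.hasParity {p : ℕ} {f : List L → P} (hf : SuppLength p f) : HasParity p f :=
  hf.sgn

theorem ofFn_insertNth {n : ℕ} (i : Fin (n + 1)) (a : L) (u : Fin n → L) :
    List.ofFn (i.insertNth a u : Fin (n + 1) → L) =
      (List.ofFn u).take i ++ a :: (List.ofFn u).drop i := by
  apply List.ext_getElem
  · simp; omega
  · intro j h1 h2
    rw [List.length_ofFn] at h1
    rw [List.getElem_ofFn]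
    rcases Fin.eq_self_or_eq_succAbove i ⟨j, h1⟩ with h | ⟨k, h⟩
    · rw [h, Fin.insertNth_apply_same]
      have : j = i := by rw [← h]
      subst this
      rw [List.getElem_append_right (by simp)]
      simp [Nat.min_eq_left (Nat.le_of_lt_succ h1)]
    · rw [h, Fin.insertNth_apply_succAbove]
      rcases lt_or_ge k.castSucc i with hk | hk
      · rw [Fin.succAbove_of_castSucc_lt _ _ hk] at h
        have : j = k := by simpa using congrArg Fin.val h
        subst this
        rw [List.getElem_append_left (by simp; exact hk)]
        simp
      · rw [Fin.succAbove_of_le_castSucc _ _ hk] at h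
        have : j = k + 1 := by simpa using congrArg Fin.val h
        subst this
        have hk' : (i : ℕ) ≤ k := hk
        rw [List.getElem_append_right (by simp; omega), List.getElem_cons]
        have e : min (i : ℕ) n = i := by omega
        rw [dif_neg (by simp; omega)]
        simp only [List.getElem_drop, List.getElem_ofFn, List.length_take, List.length_ofFn, e]
        congr 1
        ext
        simp; omega

variable (B : P →ₗ[R] Q →ₗ[R] N)

/-- The unnormalized product: the sum over all permutations. -/
def permSum (p : ℕ) (f : List L → P) (g : List L → Q) {n : ℕ} (v : Fin n → L) : N :=
  ∑ σ : Equiv.Perm (Fin n), (Equiv.Perm.sign σ : ℤ) •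
    B (f ((List.ofFn (v ∘ σ)).take p)) (g ((List.ofFn (v ∘ σ)).drop p))

/-- Permutations of `{0, …, n}` as pairs of the preimage of `0` and a permutation of the rest. -/
def permSuccEquiv (n : ℕ) : Fin (n + 1) × Equiv.Perm (Fin n) ≃ Equiv.Perm (Fin (n + 1)) :=
  Equiv.ofBijective (fun x => Equiv.Perm.decomposeFin.symm (0, x.2) * x.1.cycleRange) <| by
    rw [Fintype.bijective_iff_injective_and_card]
    constructor
    · rintro ⟨i, τ⟩ ⟨j, τ'⟩ h
      have hz : ∀ (i : Fin (n + 1)) (τ : Equiv.Perm (Fin n)),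
          (Equiv.Perm.decomposeFin.symm (0, τ) * i.cycleRange) i = 0 := by
        intro i τ
        simp [Equiv.Perm.mul_apply, Fin.cycleRange_self]
      have hij : i = j := by
        have h1 := (hz i τ).trans (hz j τ').symm
        simp only at h
        rw [h] at h1
        exact Equiv.injective _ h1
      subst hij
      simp only [mul_left_inj, EmbeddingLike.apply_eq_iff_eq, Prod.mk.injEq, true_and] at h
      rw [h]
    · simp [Fintype.card_perm, Nat.factorial_succ]

/-- Sort the permutations by the position i at which the first entry `a` lands. If i < p it is an
argument of `f`, and moving it to the front cancels the sign of the cycle. Otherwise it is an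
argument of `g`, and the signs (-1)^i and (-1)^(i-p) leave (-1)^p. The two cases occur for p and
n+1-p positions. -/
theorem permSum_cons {p : ℕ} {f : List L → P} {g : List L → Q} (hf : IsAlt f) (hg : IsAlt g)
    {n : ℕ} (hp : p ≤ n + 1) (a : L) (w : Fin n → L) :
    permSum B p f g (Fin.cons a w : Fin (n + 1) → L) =
      p • permSum B (p - 1) (contr a f) g w +
        (n + 1 - p) • (-1 : ℤ) ^ p • permSum B p f (contr a g) w := by
  have key : ∀ (i : Fin (n + 1)) (τ : Equiv.Perm (Fin n)),
      (Equiv.Perm.sign (permSuccEquiv n (i, τ)) : ℤ) •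
        B (f ((List.ofFn ((Fin.cons a w : Fin (n + 1) → L) ∘ permSuccEquiv n (i, τ))).take p))
          (g ((List.ofFn ((Fin.cons a w : Fin (n + 1) → L) ∘ permSuccEquiv n (i, τ))).drop p)) =
      if (i : ℕ) < p then (Equiv.Perm.sign τ : ℤ) •
        B (contr a f ((List.ofFn (w ∘ τ)).take (p - 1))) (g ((List.ofFn (w ∘ τ)).drop (p - 1)))
      else (-1 : ℤ) ^ p • (Equiv.Perm.sign τ : ℤ) •
        B (f ((List.ofFn (w ∘ τ)).take p)) (contr a g ((List.ofFn (w ∘ τ)).drop p)) := by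
    intro i τ
    have e1 : (Fin.cons a w : Fin (n + 1) → L) ∘ permSuccEquiv n (i, τ) =
        i.insertNth a (w ∘ τ) := by
      rw [← Fin.cons_comp_cycleRange]
      change (Fin.cons a w : Fin (n + 1) → L) ∘
        ⇑(Equiv.Perm.decomposeFin.symm (0, τ) * i.cycleRange) = _
      rw [Equiv.Perm.coe_mul, ← Function.comp_assoc]
      congr 1
      ext j
      refine Fin.cases ?_ (fun j => ?_) j <;> simp
    have e2 : (Equiv.Perm.sign (permSuccEquiv n (i, τ)) : ℤ) =
        (-1) ^ (i : ℕ) * (Equiv.Perm.sign τ : ℤ) := by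
      change ((Equiv.Perm.sign (Equiv.Perm.decomposeFin.symm (0, τ) * i.cycleRange) : ℤˣ) : ℤ) = _
      rw [Equiv.Perm.sign_mul, Fin.sign_cycleRange, Equiv.Perm.decomposeFin.symm_sign]
      simp [mul_comm]
    rw [e1, e2, ofFn_insertNth]
    set u := List.ofFn (w ∘ τ) with hu
    have hul : u.length = n := by simp [hu]
    have hi := i.2
    split_ifs with h
    · have t1 : (u.take i ++ a :: u.drop i).take p =
          u.take i ++ a :: ((u.drop i).take (p - 1 - i)) := by
        rw [List.take_append, List.take_of_length_le (by simp; omega)]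
        congr 1
        rw [List.length_take, hul, Nat.min_eq_left (by omega),
          show p - (i : ℕ) = (p - 1 - i) + 1 by omega, List.take_succ_cons]
      have t2 : (u.take i ++ a :: u.drop i).drop p = u.drop (p - 1) := by
        rw [List.drop_append, List.drop_eq_nil_of_le (by simp; omega), List.nil_append,
          List.length_take, hul, Nat.min_eq_left (by omega),
          show p - (i : ℕ) = (p - 1 - i) + 1 by omega, List.drop_succ_cons, List.drop_drop]
        congr 1; omega
      have t3 : u.take i ++ (u.drop i).take (p - 1 - i) = u.take (p - 1) := by
        rw [← List.take_add]; congr 1; omega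
      rw [t1, t2, hf, t3, List.length_take, hul, Nat.min_eq_left (by omega)]
      have e3 : ∀ (z : ℤ) x y, B (z • x) y = z • B x y := fun z x y => by rw [map_zsmul]; rfl
      rw [e3, smul_smul, mul_right_comm, ← mul_pow]
      simp [contr]
    · have t1 : (u.take i ++ a :: u.drop i).take p = u.take p := by
        rw [List.take_append, List.length_take, hul, Nat.min_eq_left (by omega),
          Nat.sub_eq_zero_of_le (by omega), List.take_zero, List.append_nil, List.take_take,
          Nat.min_eq_left (by omega)]
      have t2 : (u.take i ++ a :: u.drop i).drop p =
          (u.drop p).take (i - p) ++ a :: (u.drop p).drop (i - p) := by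
        rw [List.drop_append_of_le_length (by simp; omega), List.drop_take, List.drop_drop]
        congr 3; omega
      rw [t1, t2, hg, List.take_append_drop, List.length_take, List.length_drop, hul,
        Nat.min_eq_left (by omega), map_zsmul, smul_smul, smul_smul, mul_right_comm, ← pow_add]
      congr 2
      rw [show (i : ℕ) + (i - p) = p + 2 * (i - p) by omega, pow_add, pow_mul]
      simp
  rw [permSum, ← (permSuccEquiv n).sum_comp, Fintype.sum_prod_type]
  simp only [key]
  have hsplit : ∀ i : Fin (n + 1), (∑ τ : Equiv.Perm (Fin n), if (i : ℕ) < p then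
        (Equiv.Perm.sign τ : ℤ) •
        B (contr a f ((List.ofFn (w ∘ τ)).take (p - 1))) (g ((List.ofFn (w ∘ τ)).drop (p - 1)))
      else (-1 : ℤ) ^ p • (Equiv.Perm.sign τ : ℤ) •
        B (f ((List.ofFn (w ∘ τ)).take p)) (contr a g ((List.ofFn (w ∘ τ)).drop p))) =
      if (i : ℕ) < p then permSum B (p - 1) (contr a f) g w
      else (-1 : ℤ) ^ p • permSum B p f (contr a g) w := by
    intro i
    split_ifs
    · rfl
    · rw [permSum, Finset.smul_sum]
  rw [Finset.sum_congr rfl fun i _ => hsplit i, Finset.sum_ite, Finset.sum_const, Finset.sum_const]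
  have c1 : (Finset.univ.filter fun i : Fin (n + 1) => (i : ℕ) < p).card = p := by
    rw [Fin.card_filter_val_lt, Nat.min_eq_right hp]
  have c2 : (Finset.univ.filter fun i : Fin (n + 1) => ¬ (i : ℕ) < p).card = n + 1 - p := by
    have := Finset.card_filter_add_card_filter_not (s := (Finset.univ : Finset (Fin (n + 1))))
      (fun i : Fin (n + 1) => (i : ℕ) < p)
    rw [c1, Finset.card_univ, Fintype.card_fin] at this
    omega
  rw [c1, c2]

/-- By `permSum_cons` both sides obey the same recursion; the multiplicities p and q there build up
the factorials. -/
theorem permSum_eq_star {p q n : ℕ} (hn : n = p + q) {f : List L → P} {g : List L → Q}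
    (hf : IsAlt f) (hg : IsAlt g) (hfp : SuppLength p f) (hgq : SuppLength q g) (v : Fin n → L) :
    permSum B p f g v = (p.factorial * q.factorial) • star B f g (List.ofFn v) := by
  induction n generalizing p q f g with
  | zero =>
    obtain ⟨rfl, rfl⟩ : p = 0 ∧ q = 0 := by omega
    simp [permSum]
  | succ n ih =>
    have h1 : p • permSum B (p - 1) (contr (v 0) f) g (Fin.tail v) =
        (p.factorial * q.factorial) • star B (contr (v 0) f) g (List.ofFn (Fin.tail v)) := by
      rcases Nat.eq_zero_or_pos p with rfl | hp
      · rw [hfp.contr_zero, star_zero_left]; simp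
      · rw [ih (by omega) (hf.contr _) hg (hfp.contr _) hgq, smul_smul,
          ← Nat.mul_factorial_pred hp.ne', mul_assoc]
    have h2 : (n + 1 - p) • permSum B p f (contr (v 0) g) (Fin.tail v) =
        (p.factorial * q.factorial) • star B f (contr (v 0) g) (List.ofFn (Fin.tail v)) := by
      have hq : n + 1 - p = q := by omega
      rw [hq]
      rcases Nat.eq_zero_or_pos q with rfl | hp
      · rw [hgq.contr_zero, star_zero_right]; simp
      · rw [ih (by omega) hf (hg.contr _) hfp (hgq.contr _), smul_smul,
          ← Nat.mul_factorial_pred hp.ne']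
        congr 1; ring
    conv_lhs => rw [← Fin.cons_self_tail v]
    rw [permSum_cons B hf hg (by omega), h1, smul_comm (n + 1 - p), h2, List.ofFn_succ, star_cons,
      hfp.sgn, star_zsmul_left, Pi.smul_apply, smul_add, smul_comm ((-1 : ℤ) ^ p)]
    rfl

end Shuffle

/-! ### Forms as functions of lists; wedge product and differential under this embedding. -/

section FormToList

variable {R L P Q N : Type*} [CommRing R] [LieRing L] [Module R L] [AddCommGroup P] [Module R P]
  [AddCommGroup Q] [Module R Q] [AddCommGroup N] [Module R N]

/-- A `k`-form as a function of lists, supported on lists of length `k`. -/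
def single {k : ℕ} (α : Form R L P k) : List L → P :=
  fun l => if h : l.length = k then α (fun i => l.get (i.cast h.symm)) else 0

theorem single_suppLength {k : ℕ} (α : Form R L P k) : SuppLength k (single α) :=
  fun _ h => dif_neg h

theorem single_ofFn {k : ℕ} (α : Form R L P k) (v : Fin k → L) : single α (List.ofFn v) = α v := by
  rw [single, dif_pos (List.length_ofFn)]
  congr 1
  ext i
  simp

theorem single_ext {k : ℕ} {α β : Form R L P k} (h : single α = single β) : α = β := by
  ext v
  rw [← single_ofFn, h, single_ofFn]

theorem SuppLength.ext {k : ℕ} {f g : List L → P} (hf : SuppLength k f) (hg : SuppLength k g)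
    (h : ∀ v : Fin k → L, f (List.ofFn v) = g (List.ofFn v)) : f = g := by
  ext l
  by_cases hl : l.length = k
  · subst hl
    rw [← List.ofFn_get l]
    exact h _
  · rw [hf l hl, hg l hl]

theorem single_add {k : ℕ} (α β : Form R L P k) : single (α + β) = single α + single β := by
  ext l
  simp only [single, Pi.add_apply]
  split_ifs <;> simp

theorem single_zero {k : ℕ} : single (0 : Form R L P k) = 0 := by
  ext l
  simp only [single]
  split_ifs <;> simp

theorem single_smul {S : Type*} [Monoid S] [DistribMulAction S P] [SMulCommClass R S P] {k : ℕ}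
    (r : S) (α : Form R L P k) : single (r • α) = r • single α := by
  ext l
  simp only [single, Pi.smul_apply]
  split_ifs <;> simp

theorem single_comp {k : ℕ} (φ : P →ₗ[R] Q) (α : Form R L P k) :
    single (φ.compAlternatingMap α) = fun l => φ (single α l) := by
  ext l
  simp only [single]
  split_ifs <;> simp

theorem contr_single {k : ℕ} (α : Form R L P (k + 1)) (a : L) :
    contr a (single α) = single (α.curryLeft a) := by
  refine ((single_suppLength α).contr a).ext (single_suppLength _) fun v => ?_
  rw [single_ofFn, contr_apply, ← List.ofFn_cons, single_ofFn]
  rfl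

theorem single_isAlt {k : ℕ} (α : Form R L P k) : IsAlt (single α) := by
  intro l₁ a l₂
  by_cases hl : l₁.length + (l₂.length + 1) = k
  -- Here the length is right, so both lists come from vectors and the sign is that of inserting an
  -- argument in an alternating map. For any other length both sides are zero.
  · obtain ⟨r, rfl⟩ : ∃ r, k = r + 1 := ⟨k - 1, by omega⟩
    have hr : (l₁ ++ l₂).length = r := by simp; omega
    let u : Fin r → L := fun i => (l₁ ++ l₂).get (i.cast hr.symm)
    have hu : List.ofFn u = l₁ ++ l₂ := by
      subst hr
      exact List.ofFn_get _
    have e : l₁ ++ a :: l₂ =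
        List.ofFn ((⟨l₁.length, by omega⟩ : Fin (r + 1)).insertNth a u : Fin (r + 1) → L) := by
      rw [ofFn_insertNth, hu]
      simp
    have e' : a :: (l₁ ++ l₂) = List.ofFn (Matrix.vecCons a u) := by
      rw [← hu]
      exact (List.ofFn_cons _ _).symm
    rw [e, e', single_ofFn, single_ofFn, AlternatingMap.map_insertNth]
  · rw [single_suppLength α _ (by simpa using hl), single_suppLength α _ (by simpa [add_assoc] using hl),
      smul_zero]

/-- The wedge product of forms along a bilinear pairing of the coefficients. -/
def wedgeB (B : P →ₗ[R] Q →ₗ[R] N) {p q : ℕ} (α : Form R L P p) (β : Form R L Q q) :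
    Form R L N (p + q) :=
  ((TensorProduct.lift B).compAlternatingMap (α.domCoprod β)).domDomCongr finSumFinEquiv

/-- The sum over all permutations counts every (p,q)-shuffle p!q! times, because `α` and `β` are
already alternating. -/
theorem factorial_smul_wedgeB (B : P →ₗ[R] Q →ₗ[R] N) {p q : ℕ} (α : Form R L P p)
    (β : Form R L Q q) (v : Fin (p + q) → L) :
    (p.factorial * q.factorial) • wedgeB B α β v = permSum B p (single α) (single β) v := by
  have h := MultilinearMap.domCoprod_alternization_eq α β
  have h2 := congrArg (fun γ => TensorProduct.lift B (γ (v ∘ finSumFinEquiv))) h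
  simp only [Fintype.card_fin, AlternatingMap.smul_apply, map_nsmul] at h2
  change _ • TensorProduct.lift B (α.domCoprod β (v ∘ finSumFinEquiv)) = _
  rw [← h2, MultilinearMap.alternatization_apply, map_sum, permSum,
    ← (Equiv.permCongr finSumFinEquiv).sum_comp]
  refine Finset.sum_congr rfl fun σ _ => ?_
  rw [Equiv.Perm.sign_permCongr, Units.smul_def, map_zsmul]
  congr 1
  have e : List.ofFn (v ∘ (Equiv.permCongr finSumFinEquiv σ)) =
      List.ofFn (fun i => v (finSumFinEquiv (σ (Sum.inl i)))) ++
        List.ofFn (fun i => v (finSumFinEquiv (σ (Sum.inr i)))) := by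
    rw [← List.ofFn_fin_append]
    congr 1
    ext i
    refine Fin.addCases (fun i => ?_) (fun i => ?_) i <;> simp [Equiv.permCongr_apply]
  rw [e, List.take_left' (by simp), List.drop_left' (by simp), single_ofFn, single_ofFn]
  simp [MultilinearMap.domDomCongr_apply, MultilinearMap.domCoprod_apply]

/-- The factor p!q! common to `factorial_smul_wedgeB` and `permSum_eq_star` is cancelled; this is
the use of the real structure on `N`. -/
theorem single_wedgeB [Module ℝ N] (B : P →ₗ[R] Q →ₗ[R] N) {p q : ℕ} (α : Form R L P p)
    (β : Form R L Q q) : single (wedgeB B α β) = star B (single α) (single β) := by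
  have hs : SuppLength (p + q) (star B (single α) (single β)) :=
    (single_suppLength α).star B (single_suppLength β)
  refine (single_suppLength _).ext hs fun v => ?_
  have h := factorial_smul_wedgeB B α β v
  rw [permSum_eq_star B rfl (single_isAlt α) (single_isAlt β) (single_suppLength α)
    (single_suppLength β), ← Nat.cast_smul_eq_nsmul ℝ, ← Nat.cast_smul_eq_nsmul ℝ] at h
  rw [single_ofFn]
  exact smul_right_injective N (Nat.cast_ne_zero.2 (by positivity)) h

theorem wedge_eq_wedgeB [Algebra ℝ R] [Module ℝ P] [IsScalarTower ℝ R P] {p q : ℕ}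
    (α : Form R L R p) (β : Form R L P q) : wedge α β = wedgeB (LinearMap.lsmul R P) α β := by
  have : (TensorProduct.lid R P).toLinearMap = TensorProduct.lift (LinearMap.lsmul R P) := by
    ext; simp
  rw [wedgeB, ← this]
  rfl

section Differential

variable [LieRingModule L R]

/-- The closed form of the recursion, needed to recognise Koszul's formula. -/
theorem lieL_ofFn {n : ℕ} (x : L) (f : List L → R) (v : Fin n → L) :
    lieL x f (List.ofFn v) =
      ⁅x, f (List.ofFn v)⁆ - ∑ j, f (List.ofFn (Function.update v j ⁅x, v j⁆)) := by
  induction n generalizing f with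
  | zero => simp
  | succ n ih =>
    have h0 : ∀ y, List.ofFn (Function.update v 0 y) = y :: List.ofFn (Fin.tail v) := by
      intro y
      rw [← Fin.cons_self_tail v, Fin.update_cons_zero, List.ofFn_cons, Fin.tail_cons]
    have h1 : ∀ (j : Fin n) y, List.ofFn (Function.update v j.succ y) =
        v 0 :: List.ofFn (Function.update (Fin.tail v) j y) := by
      intro j y
      rw [← Fin.cons_self_tail v, ← Fin.cons_update, List.ofFn_cons, Fin.tail_cons, Fin.cons_zero]
    have h2 : List.ofFn v = v 0 :: List.ofFn (Fin.tail v) := List.ofFn_succ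
    rw [h2, lieL_cons, ih, Fin.sum_univ_succ, h0]
    simp only [h1, contr_apply]
    have h3 : ∀ j, Fin.tail v j = v j.succ := fun _ => rfl
    simp only [h3]
    abel

theorem suppLength_dL {k : ℕ} {f : List L → R} (hf : SuppLength k f) : SuppLength (k + 1) (dL f) := by
  have hl : ∀ {k : ℕ} {f : List L → R} (_ : SuppLength k f) (x : L) (l : List L),
      l.length ≠ k → lieL x f l = 0 := by
    intro k f hf x l h
    rw [← List.ofFn_get l, lieL_ofFn, hf _ (by simpa using h), lie_zero, zero_sub, neg_eq_zero]
    exact Finset.sum_eq_zero fun j _ => hf _ (by simpa using h)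
  intro l
  induction l generalizing k f with
  | nil => simp
  | cons a l ih =>
    intro h
    rw [List.length_cons] at h
    rw [dL_cons, hl hf _ _ (by omega), zero_sub, neg_eq_zero]
    rcases Nat.eq_zero_or_pos k with rfl | hk
    · rw [hf.contr_zero]
      exact congrFun (dLHom.map_zero) l
    · exact ih (hf.contr a) (by omega)

/-- In Koszul's formula the summand i = 0 is the Lie derivative along the first argument. The others
make up minus the formula for the contracted form, since every index shifts by one. This is Cartan's
formula. -/
theorem koszul_eq_dL {k : ℕ} (α : Form R L R k) (a : Fin (k + 1) → L) :
    koszul α a = dL (single α) (List.ofFn a) := by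
  induction k with
  | zero =>
    rw [List.ofFn_succ, dL_cons, (single_suppLength α).contr_zero]
    have h : dL (0 : List L → R) = 0 := dLHom.map_zero
    have h' : Finset.Ioi (0 : Fin (0 + 1)) = ∅ := by decide
    rw [h, lieL_ofFn, single_ofFn]
    simp only [koszul, Fin.sum_univ_succ, Finset.univ_eq_empty, Finset.sum_empty]
    rw [h']
    simp only [Finset.sum_empty, Fin.removeNth_zero]
    simp
    rfl
  | succ k ih =>
    have h0 : Finset.Ioi (0 : Fin (k + 1 + 1)) = Finset.univ.map (Fin.succEmb (k + 1)) := by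
      ext j; refine Fin.cases (by simp) (fun j => by simp) j
    have hs : ∀ m : Fin (k + 1), Finset.Ioi m.succ = (Finset.Ioi m).map (Fin.succEmb (k + 1)) := by
      intro m; ext j; refine Fin.cases (by simp) (fun j => by simp) j
    have hr : ∀ (m : Fin (k + 1)) (y : L) (w : Fin (k + 1) → L),
        α (m.succ.removeNth (Fin.cons y w : Fin (k + 1 + 1) → L)) =
          α.curryLeft y (m.removeNth w) := by
      intro m y w
      have e : m.succ.removeNth (Fin.cons y w : Fin (k + 1 + 1) → L) =
        Matrix.vecCons y (m.removeNth w) := Fin.cons_comp_succ_succAbove _ _ _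
      rw [e]
      rfl
    obtain ⟨y, v, rfl⟩ : ∃ y v, a = (Fin.cons y v : Fin (k + 1 + 1) → L) :=
      ⟨a 0, Fin.tail a, (Fin.cons_self_tail a).symm⟩
    rw [List.ofFn_cons, dL_cons, contr_single, ← ih, lieL_ofFn, koszul, Fin.sum_univ_succ, h0,
      Finset.sum_map]
    simp only [hs, Finset.sum_map, Fin.cons_zero, Fin.cons_succ,
      Fin.coe_succEmb, Fin.val_zero, pow_zero, one_smul, Fin.removeNth_zero, Fin.tail_cons,
      Fin.val_succ, ← Fin.cons_update, single_ofFn, hr]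
    rw [sub_eq_add_neg (⁅y, α v⁆ - _), koszul, ← Finset.sum_neg_distrib]
    congr 1
    refine Finset.sum_congr rfl fun m _ => ?_
    rw [pow_succ, mul_neg_one, neg_smul]

theorem single_dForm [LieRinehartRing R L] [Algebra ℝ R] {k : ℕ}
    (α : Form R L R k) : single (dForm α) = dL (single α) :=
  (single_suppLength _).ext (suppLength_dL (single_suppLength α)) fun v => by
    rw [single_ofFn, dForm_apply, koszul_eq_dL]

/-- Functions of lists that are additive in each entry. -/
def IsAddL (f : List L → P) : Prop :=
  ∀ l₁ a b l₂, f (l₁ ++ (a + b) :: l₂) = f (l₁ ++ a :: l₂) + f (l₁ ++ b :: l₂)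

theorem IsAddL.contr {f : List L → P} (hf : IsAddL f) (c : L) : IsAddL (contr c f) :=
  fun l₁ a b l₂ => hf (c :: l₁) a b l₂

theorem IsAddL.contr_add {f : List L → P} (hf : IsAddL f) (a b : L) :
    Algebroid.contr (a + b) f = Algebroid.contr a f + Algebroid.contr b f :=
  funext fun l => hf [] a b l

theorem IsAddL.contr_sub {f : List L → P} (hf : IsAddL f) (a b : L) :
    Algebroid.contr (a - b) f = Algebroid.contr a f - Algebroid.contr b f := by
  rw [eq_sub_iff_add_eq, ← hf.contr_add, sub_add_cancel]

theorem isAddL_single {k : ℕ} (α : Form R L P k) : IsAddL (single α) := by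
  intro l₁ a b l₂
  rw [single_isAlt α l₁ (a + b), single_isAlt α l₁ a, single_isAlt α l₁ b, ← smul_add]
  congr 1
  cases k with
  | zero =>
    have h := single_suppLength α
    rw [h _ (by simp), h _ (by simp), h _ (by simp), add_zero]
  | succ k =>
    simp only [← contr_apply, contr_single]
    rw [map_add, single_add]
    rfl

/-- The Jacobi identity is applied in each entry. Additivity is what splits a contraction with a
difference of brackets. -/
theorem lieL_lie {f : List L → R} (hf : IsAddL f) (a b : L) :
    lieL ⁅a, b⁆ f = lieL a (lieL b f) - lieL b (lieL a f) := by
  have hsub : ∀ (a : L) (f g : List L → R), lieL a (f - g) = lieL a f - lieL a g := fun a f g => by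
    rw [sub_eq_add_neg, lieL_add, lieL_neg, ← sub_eq_add_neg]
  ext l
  induction l generalizing f with
  | nil => simp
  | cons c l ih =>
    have hj : ⁅⁅a, b⁆, c⁆ = ⁅a, ⁅b, c⁆⁆ - ⁅b, ⁅a, c⁆⁆ := by rw [lie_lie]
    rw [lieL_cons, ih (hf.contr c), hj, hf.contr_sub, Pi.sub_apply, Pi.sub_apply, Pi.sub_apply,
      lieL_cons, lieL_cons]
    simp only [contr_lieL, hsub, Pi.sub_apply]
    abel

theorem lieL_dL {f : List L → R} (hf : IsAddL f) (a : L) : lieL a (dL f) = dL (lieL a f) := by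
  have hsub : ∀ (a : L) (f g : List L → R), lieL a (f - g) = lieL a f - lieL a g := fun a f g => by
    rw [sub_eq_add_neg, lieL_add, lieL_neg, ← sub_eq_add_neg]
  have hsub' : ∀ (f g : List L → R), dL (f - g) = dL f - dL g := map_sub dLHom
  ext l
  induction l generalizing f with
  | nil => simp
  | cons b l ih =>
    have h := congrFun (lieL_lie hf a b) l
    rw [lieL_cons, dL_cons, contr_dL, contr_dL, hsub, contr_lieL, hsub', Pi.sub_apply,
      Pi.sub_apply, Pi.sub_apply, ih (hf.contr b), h, Pi.sub_apply]
    abel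

/-- Cartan's formula applied twice gives ι_b d d = (L_b d - d L_b) + d d ι_b. The bracket is zero by
`lieL_dL`, and the last term is zero by induction. -/
theorem dL_dL {f : List L → R} (hf : IsAddL f) : dL (dL f) = 0 := by
  have hsub' : ∀ (f g : List L → R), dL (f - g) = dL f - dL g := map_sub dLHom
  ext l
  induction l generalizing f with
  | nil => simp
  | cons b l ih =>
    rw [dL_cons, contr_dL, hsub', lieL_dL hf, Pi.sub_apply, ih (hf.contr b)]
    simp

theorem dForm_dForm [LieRinehartRing R L] [Algebra ℝ R] {k : ℕ} (α : Form R L R k) :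
    dForm (dForm α) = 0 :=
  single_ext <| by rw [single_dForm, single_dForm, dL_dL (isAddL_single α), single_zero]

end Differential

end FormToList

/-! ### Products with degree-zero factors, and higher Koszul signs. -/

section StarMore

set_option linter.unusedSectionVars false

variable {R L P Q N N' : Type*} [CommRing R] [AddCommGroup P] [Module R P] [AddCommGroup Q]
  [Module R Q] [AddCommGroup N] [Module R N] [AddCommGroup N'] [Module R N']

theorem star_supp_zero_left (B : P →ₗ[R] Q →ₗ[R] N) {f : List L → P} (hf : SuppLength 0 f)
    (g : List L → Q) : star B f g = fun l => B (f []) (g l) := by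
  ext l
  induction l generalizing f g with
  | nil => rfl
  | cons a l ih =>
    rw [star_cons, hf.contr_zero, star_zero_left, hf.sgn, pow_zero, one_smul, ih hf]
    simp [contr]

theorem star_supp_zero_right (B : P →ₗ[R] Q →ₗ[R] N) (f : List L → P) {g : List L → Q}
    (hg : SuppLength 0 g) : star B f g = fun l => B (f l) (g []) := by
  ext l
  induction l generalizing f g with
  | nil => rfl
  | cons a l ih =>
    rw [star_cons, hg.contr_zero, star_zero_right, ih _ hg]
    simp [contr]

theorem comp_star {Q' : Type*} [AddCommGroup Q'] [Module R Q'] (B : P →ₗ[R] Q →ₗ[R] N) (B' : P →ₗ[R] N' →ₗ[R] Q')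
    (φ : N →ₗ[R] Q') (ψ : Q →ₗ[R] N') (h : ∀ x y, φ (B x y) = B' x (ψ y))
    (f : List L → P) (g : List L → Q) :
    (fun l => φ (star B f g l)) = star B' f (fun l => ψ (g l)) := by
  ext l
  induction l generalizing f g with
  | nil => exact h _ _
  | cons a l ih =>
    rw [star_cons, star_cons, map_add]
    exact congrArg₂ _ (ih _ _) (ih _ _)

/-- The sign `(-1)^{k deg}` on functions of lists. -/
def sgnPow (k : ℕ) (f : List L → P) : List L → P := fun l => (-1 : ℤ) ^ (k * l.length) • f l

theorem sgnPow_one (f : List L → P) : sgnPow 1 f = sgn f := by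
  ext l; simp [sgnPow, sgn]

theorem sgnPow_add (k : ℕ) (f g : List L → P) : sgnPow k (f + g) = sgnPow k f + sgnPow k g :=
  funext fun _ => smul_add _ _ _

theorem HasParity.sgnPow {p : ℕ} {f : List L → P} (hf : HasParity p f) (k : ℕ) :
    sgnPow k f = (-1 : ℤ) ^ (k * p) • f := by
  induction k with
  | zero => ext l; simp [Algebroid.sgnPow]
  | succ k ih =>
    have h : Algebroid.sgnPow (k + 1) f = Algebroid.sgnPow k (sgn f) := by
      ext l
      simp only [Algebroid.sgnPow, sgn, smul_smul, ← pow_add]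
      congr 2; ring
    have h' : ∀ (z : ℤ), Algebroid.sgnPow k (z • f) = z • Algebroid.sgnPow k f := fun z =>
      funext fun _ => smul_comm _ z _
    rw [h, hf, h', ih, smul_smul, ← pow_add]
    congr 2; ring

end StarMore

/-! ### Components of forms with values in a graded module. -/

section GradedForms

set_option linter.unusedSectionVars false

variable {R L : Type*} [CommRing R] [LieRing L] [Module R L] [Algebra ℝ R]
  {n : ℕ} {P : Fin n → Type*} [∀ i, AddCommGroup (P i)] [∀ i, Module R (P i)]

/-- The `P i`-component of a graded form as a function of lists. -/
def lst (i : Fin n) (η : GForm R L P) : List L → P i :=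
  fun l => η (l.length, i) l.get

theorem lst_add (i : Fin n) (η θ : GForm R L P) : lst i (η + θ) = lst i η + lst i θ := by
  ext l; simp [lst]

/-- `lst i` as an additive map. -/
def lstHom (i : Fin n) : GForm R L P →+ (List L → P i) := AddMonoidHom.mk' (lst i) (lst_add i)

theorem lst_zero (i : Fin n) : lst i (0 : GForm R L P) = 0 := by
  ext l; rfl
theorem lst_sub (i : Fin n) (η θ : GForm R L P) : lst i (η - θ) = lst i η - lst i θ :=
  map_sub (lstHom i) η θ
theorem lst_sum {ι : Type*} (i : Fin n) (s : Finset ι) (η : ι → GForm R L P) :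
    lst i (∑ j ∈ s, η j) = ∑ j ∈ s, lst i (η j) := map_sum (lstHom i) η s

theorem lst_smul (i : Fin n) (r : R) (η : GForm R L P) : lst i (r • η) = r • lst i η := by
  ext l
  simp only [lst, Pi.smul_apply, DirectSum.smul_apply]
  rfl

theorem lst_ofFn (i : Fin n) (η : GForm R L P) {s : ℕ} (v : Fin s → L) :
    lst i η (List.ofFn v) = η (s, i) v := by
  -- The degree depends on the length of the list, so the equality is transported through the sigma
  -- type of lengths and vectors.
  have h : ∀ x y : (Σ s, Fin s → L), x = y → η (x.1, i) x.2 = η (y.1, i) y.2 := by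
    rintro x y rfl; rfl
  exact h ⟨_, (List.ofFn v).get⟩ ⟨s, v⟩ (List.equivSigmaTuple.right_inv ⟨s, v⟩)

theorem lst_eq_single (i : Fin n) (η : GForm R L P) (l : List L) :
    lst i η l = single (η (l.length, i)) l := by
  rw [single, dif_pos rfl]
  rfl

theorem lst_ext {η θ : GForm R L P} (h : ∀ i, lst i η = lst i θ) : η = θ := by
  refine DFinsupp.ext fun ⟨s, i⟩ => ?_
  ext v
  rw [← lst_ofFn, h, lst_ofFn]

variable [∀ i, Module ℝ (P i)] [∀ i, IsScalarTower ℝ R (P i)]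

theorem lst_real_smul (i : Fin n) (r : ℝ) (η : GForm R L P) : lst i (r • η) = r • lst i η := by
  ext l
  simp only [lst, Pi.smul_apply, DirectSum.smul_apply]
  rfl

variable (R L P) in
/-- A form with values in one summand as a graded form. -/
abbrev lofG (s : ℕ) (i : Fin n) : Form R L (P i) s →ₗ[ℝ] GForm R L P :=
  DirectSum.lof ℝ (ℕ × Fin n) (fun t => Form R L (P t.2) t.1) (s, i)

theorem lst_lof (s : ℕ) (i : Fin n) (β : Form R L (P i) s) :
    lst i (lofG R L P s i β) = single β := by
  ext l
  by_cases h : l.length = s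
  · subst h
    rw [lst_eq_single, DirectSum.lof_apply]
  · rw [single_suppLength β l h, lst, DirectSum.lof_eq_of, DirectSum.of_eq_of_ne _ _ _ (by simp [h])]
    rfl

theorem lst_lof_ne (s : ℕ) {i j : Fin n} (h : j ≠ i) (β : Form R L (P i) s) :
    lst j (lofG R L P s i β) = 0 := by
  ext l
  rw [lst, DirectSum.lof_eq_of, DirectSum.of_eq_of_ne _ _ _ (by simp [h])]
  rfl

theorem gform_induction {motive : GForm R L P → Prop} (zero : motive 0)
    (lof : ∀ s i β, motive (lofG R L P s i β))
    (add : ∀ η θ, motive η → motive θ → motive (η + θ)) (η : GForm R L P) : motive η :=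
  DirectSum.induction_on η zero (fun s β => lof s.1 s.2 β) add

theorem gWedge_lof {p s : ℕ} (α : Form R L R p) (i : Fin n) (β : Form R L (P i) s) :
    gWedge α (lofG R L P s i β) = lofG R L P (p + s) i (wedge α β) := by
  rw [gWedge, DirectSum.toModule_lof]
  rfl

theorem lst_gWedge (i : Fin n) {p : ℕ} (α : Form R L R p) (η : GForm R L P) :
    lst i (gWedge α η) = star (LinearMap.lsmul R (P i)) (single α) (lst i η) := by
  induction η using gform_induction with
  | zero => rw [map_zero, lst_zero, star_zero_right]
  | lof s j β =>
    rw [gWedge_lof]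
    by_cases h : i = j
    · subst h
      rw [lst_lof, lst_lof, wedge_eq_wedgeB, single_wedgeB]
    · rw [lst_lof_ne _ h, lst_lof_ne _ h, star_zero_right]
  | add η θ h1 h2 => rw [map_add, lst_add, lst_add, h1, h2, star_add_right]

/-- A function as a `0`-form. -/
abbrev constForm (f : R) : Form R L R 0 := AlternatingMap.constOfIsEmpty R L (Fin 0) f

theorem single_const {P : Type*} [AddCommGroup P] [Module R P] (x : P) :
    single (AlternatingMap.constOfIsEmpty R L (Fin 0) x) [] = x := by
  simp [single]

theorem gWedge_const (f : R) (η : GForm R L P) : gWedge (constForm f) η = f • η :=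
  lst_ext fun i => by
    rw [lst_gWedge, star_supp_zero_left _ (single_suppLength _), single_const, lst_smul]
    rfl

/-- An element of `P i` as a graded form. -/
def elemForm (i : Fin n) (x : P i) : GForm R L P :=
  lofG R L P 0 i (AlternatingMap.constOfIsEmpty R L (Fin 0) x)

theorem lst_elemForm (i : Fin n) (x : P i) :
    lst i (elemForm (R := R) (L := L) i x) = single (AlternatingMap.constOfIsEmpty R L (Fin 0) x) :=
  lst_lof _ _ _

theorem elemForm_add (i : Fin n) (x y : P i) :
    elemForm (R := R) (L := L) i (x + y) = elemForm i x + elemForm i y := by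
  rw [elemForm, elemForm, elemForm, ← map_add]
  congr 1

theorem elemForm_smul (i : Fin n) (r : R) (x : P i) :
    elemForm (R := R) (L := L) i (r • x) = r • elemForm i x := by
  refine lst_ext fun j => ?_
  rw [lst_smul]
  by_cases h : j = i
  · subst h
    rw [lst_elemForm, lst_elemForm, ← single_smul]
    rfl
  · rw [elemForm, elemForm, lst_lof_ne _ h, lst_lof_ne _ h, smul_zero]

theorem elemForm_mem (i : Fin n) (x : P i) :
    elemForm i x ∈ homogeneous (R := R) (L := L) (P := P) (i : ℕ) := by
  intro s hs
  rw [elemForm, DirectSum.lof_eq_of, DirectSum.of_eq_of_ne]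
  rintro rfl
  simp at hs

theorem lst_of_mem_homogeneous {k : ℕ} {η : GForm R L P} (h : η ∈ homogeneous k) (i : Fin n)
    (l : List L) (hl : l.length + i ≠ k) : lst i η l = 0 := by
  rw [lst, h (l.length, i) hl]
  rfl

/-- The form degree of this component is k - i, which has the parity of k + i. -/
theorem hasParity_lst {k : ℕ} {η : GForm R L P} (h : η ∈ homogeneous k) (i : Fin n) :
    HasParity (k + i) (lst i η) := by
  refine hasParity_of_length fun l hl => ?_
  have : l.length + i = k := by
    by_contra h'
    exact hl (lst_of_mem_homogeneous h i l h')
  rw [← this, show l.length + (i : ℕ) + i = l.length + 2 * i by ring, pow_add, pow_mul]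
  simp

end GradedForms

/-! ### Form-linear operators and connections. -/

section Operators

set_option linter.unusedSectionVars false

variable {R L : Type*} [CommRing R] [LieRing L] [Module R L] [Algebra ℝ R]
  {n : ℕ} {P : Fin n → Type*} [∀ i, AddCommGroup (P i)] [∀ i, Module R (P i)]
  [∀ i, Module ℝ (P i)] [∀ i, IsScalarTower ℝ R (P i)]

/-- Operators of degree `k` that are linear over the forms (with the Koszul sign). -/
structure IsOp (k : ℕ) (T : Module.End ℝ (GForm R L P)) : Prop where
  degree : ∀ j : ℕ, ∀ η ∈ homogeneous (R := R) (L := L) (P := P) j, T η ∈ homogeneous (j + k)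
  linear : ∀ (p : ℕ) (α : Form R L R p) (η : GForm R L P),
    T (gWedge α η) = (-1 : ℝ) ^ (k * p) • gWedge α (T η)

variable (R L P) in
/-- The space of form-linear operators of degree `k`. -/
def opSub (k : ℕ) : Submodule ℝ (Module.End ℝ (GForm R L P)) where
  carrier := {T | IsOp k T}
  add_mem' {S T} hS hT :=
    { degree := fun j η h => add_mem (hS.degree j η h) (hT.degree j η h)
      linear := fun p α η => by
        simp only [LinearMap.add_apply, hS.linear, hT.linear, map_add, smul_add] }
  zero_mem' :=
    { degree := fun j η _ => zero_mem _
      linear := fun p α η => by simp }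
  smul_mem' c T hT :=
    { degree := fun j η h => Submodule.smul_mem _ _ (hT.degree j η h)
      linear := fun p α η => by
        simp only [LinearMap.smul_apply, hT.linear, map_smul]
        rw [smul_comm] }

theorem IsOp.mul {k k' : ℕ} {S T : Module.End ℝ (GForm R L P)} (hS : IsOp k S) (hT : IsOp k' T) :
    IsOp (k + k') (S * T) where
  degree j η h := by
    have := hS.degree _ _ (hT.degree j η h)
    rwa [add_assoc, add_comm k'] at this
  linear p α η := by
    rw [Module.End.mul_apply, hT.linear, map_smul, hS.linear, smul_smul, ← pow_add,
      Module.End.mul_apply]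
    congr 2; ring

theorem IsOp.one : IsOp 0 (1 : Module.End ℝ (GForm R L P)) where
  degree _ _ h := h
  linear p α η := by simp

theorem IsOp.pow {k : ℕ} {T : Module.End ℝ (GForm R L P)} (hT : IsOp k T) (m : ℕ) :
    IsOp (k * m) (T ^ m) := by
  induction m with
  | zero => exact IsOp.one
  | succ m ih => exact ih.mul hT

theorem IsOp.map_smul {k : ℕ} {T : Module.End ℝ (GForm R L P)} (hT : IsOp k T) (f : R)
    (η : GForm R L P) : T (f • η) = f • T η := by
  rw [← gWedge_const, hT.linear, gWedge_const]
  simp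

section Connection

variable [LieRingModule L R] [LieRinehartRing R L] [LieAlgebra ℝ L] [LieRinehartAlgebra ℝ R L]

theorem d_d {p : ℕ} (α : Form R L R p) : d (p + 1) (d p α) = 0 := dForm_dForm α

theorem gWedge_zero {p : ℕ} (η : GForm R L P) : gWedge (0 : Form R L R p) η = 0 :=
  lst_ext fun i => by rw [lst_gWedge, single_zero, star_zero_left, lst_zero]

/-- In D²(α ∧ η) the term with ddα vanishes and the two terms dα ∧ Dη cancel, so the curvature is
tensorial. -/
theorem IsConnection.sq_isOp {D : Module.End ℝ (GForm R L P)} (hD : IsConnection D) :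
    IsOp 2 (D * D) where
  degree j η h := hD.degree _ _ (hD.degree _ _ h)
  linear p α η := by
    rw [Module.End.mul_apply, hD.leibniz, map_add, hD.leibniz, d_d, gWedge_zero, map_smul,
      hD.leibniz, smul_add, smul_smul, ← mul_pow, Module.End.mul_apply, pow_mul]
    simp [pow_succ]
    rw [← add_assoc, ← add_smul, neg_add_cancel, zero_smul, zero_add]

/-- The graded commutator with a connection. -/
theorem IsConnection.comm_isOp {D : Module.End ℝ (GForm R L P)} (hD : IsConnection D) {k : ℕ}
    {T : Module.End ℝ (GForm R L P)} (hT : IsOp k T) :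
    IsOp (k + 1) (D * T - (-1 : ℝ) ^ k • (T * D)) where
  degree j η h := by
    refine sub_mem ?_ (Submodule.smul_mem _ _ ?_)
    · exact hD.degree _ _ (hT.degree _ _ h)
    · have := hT.degree _ _ (hD.degree _ _ h)
      rwa [add_right_comm] at this
  linear p α η := by
    simp only [LinearMap.sub_apply, LinearMap.smul_apply, Module.End.mul_apply, hD.leibniz,
      hT.linear, map_add, map_sub, LinearMap.map_smul, smul_add, smul_sub, smul_smul, ← pow_add]
    have e1 : (-1 : ℝ) ^ (k + k * (p + 1)) = (-1) ^ (k * p) := by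
      rw [show k + k * (p + 1) = k * p + 2 * k by ring, pow_add, pow_mul]; simp
    rw [e1, show k * p + p = (k + 1) * p by ring, show k + (p + k * p) = (k + 1) * p + k by ring]
    abel

theorem IsConnection.add {D w : Module.End ℝ (GForm R L P)} (hD : IsConnection D) (hw : IsOp 1 w) :
    IsConnection (D + w) where
  degree j η h := add_mem (hD.degree _ _ h) (hw.degree _ _ h)
  leibniz p α η := by
    simp only [LinearMap.add_apply, hD.leibniz, hw.linear, one_mul, map_add, smul_add]
    abel

theorem IsConnection.sub_isOp {D D' : Module.End ℝ (GForm R L P)} (hD : IsConnection D)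
    (hD' : IsConnection D') : IsOp 1 (D' - D) where
  degree j η h := sub_mem (hD'.degree _ _ h) (hD.degree _ _ h)
  linear p α η := by
    simp only [LinearMap.sub_apply, hD.leibniz, hD'.leibniz, one_mul, map_sub, smul_sub]
    abel

end Connection

end Operators

/-! ### Cut-off frames, matrices and graded traces. -/

section Frames

set_option linter.unusedSectionVars false

variable {R L : Type*} [CommRing R] {n : ℕ} {P : Fin n → Type*}
  [∀ i, AddCommGroup (P i)] [∀ i, Module R (P i)]

variable (R P) in
/-- A local frame, multiplied by a cut-off function `χ`: elements `e` and functionals `ε` with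
`ε (e) = χ δ` and `∑ ε(s) e = χ s`. -/
structure Frame where
  N : Fin n → ℕ
  e : ∀ i, Fin (N i) → P i
  ε : ∀ i, Fin (N i) → P i →ₗ[R] R
  χ : R
  dual : ∀ i j l, ε i j (e i l) = if j = l then χ else 0
  expand : ∀ i s, ∑ j, ε i j s • e i j = χ • s

namespace Frame

/-- The index set of a frame. -/
abbrev Idx (F : Frame R P) : Type := Σ i, Fin (F.N i)

variable [LieRing L] [Module R L] [Algebra ℝ R]
  [∀ i, Module ℝ (P i)] [∀ i, IsScalarTower ℝ R (P i)]

variable (L) in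
/-- The elements of a frame as graded forms. -/
abbrev elem (F : Frame R P) (a : F.Idx) : GForm R L P := elemForm a.1 (F.e a.1 a.2)

/-- The coordinates of a graded form. -/
def coord (F : Frame R P) (a : F.Idx) (η : GForm R L P) : List L → R :=
  fun l => F.ε a.1 a.2 (lst a.1 η l)

theorem coord_add (F : Frame R P) (a : F.Idx) (η θ : GForm R L P) :
    F.coord a (η + θ) = F.coord a η + F.coord a θ := by
  ext l; simp [coord, lst_add]

theorem coord_zero (F : Frame R P) (a : F.Idx) : F.coord a (0 : GForm R L P) = 0 := by
  ext l; simp [coord, lst_zero]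

theorem coord_smul (F : Frame R P) (a : F.Idx) (r : R) (η : GForm R L P) :
    F.coord a (r • η) = r • F.coord a η := by
  ext l; simp [coord, lst_smul]

theorem coord_real_smul (F : Frame R P) (a : F.Idx) (r : ℝ) (η : GForm R L P) :
    F.coord a (r • η) = r • F.coord a η := by
  -- The functionals of a frame are only assumed `R`-linear, so real scalars are treated as elements
  -- of `R`.
  have h : ∀ η : GForm R L P, r • η = algebraMap ℝ R r • η := fun η => lst_ext fun i => by
    rw [lst_smul, lst_real_smul]
    ext l
    simp
  rw [h, coord_smul]
  ext l
  simp [Algebra.smul_def]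

theorem coord_lof (F : Frame R P) {s : ℕ} {i : Fin n} (j : Fin (F.N i)) (β : Form R L (P i) s) :
    F.coord ⟨i, j⟩ (lofG R L P s i β) = single ((F.ε i j).compAlternatingMap β) := by
  rw [single_comp]
  ext l
  rw [coord, lst_lof]

theorem coord_lof_ne (F : Frame R P) {s : ℕ} {i : Fin n} {a : F.Idx} (h : a.1 ≠ i)
    (β : Form R L (P i) s) : F.coord a (lofG R L P s i β) = 0 := by
  ext l
  rw [coord, lst_lof_ne _ h]
  simp

theorem coord_elem (F : Frame R P) (a b : F.Idx) :
    F.coord a (F.elem L b) = single (constForm (if a = b then F.χ else 0)) := by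
  obtain ⟨i, j⟩ := a
  obtain ⟨i', j'⟩ := b
  by_cases h : i = i'
  · subst h
    rw [elem, elemForm, coord_lof]
    congr 1
    ext v
    simp only [LinearMap.compAlternatingMap_apply, AlternatingMap.constOfIsEmpty_apply]
    rw [Function.const_apply, F.dual]
    by_cases hj : j = j' <;> simp [hj]
  · rw [elem, elemForm, coord_lof_ne _ (by exact h), if_neg (by simp [h])]
    ext l
    simp [single]

theorem expand_lof (F : Frame R P) {s : ℕ} (i : Fin n) (β : Form R L (P i) s) :
    F.χ • lofG R L P s i β =
      ∑ j, gWedge ((F.ε i j).compAlternatingMap β) (F.elem L ⟨i, j⟩) := by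
  refine lst_ext fun i' => ?_
  rw [lst_sum, lst_smul]
  by_cases h : i' = i
  · subst h
    ext l
    rw [lst_lof, Finset.sum_apply, Pi.smul_apply, ← F.expand]
    refine Finset.sum_congr rfl fun j _ => ?_
    rw [lst_gWedge, lst_elemForm, star_supp_zero_right _ _ (single_suppLength _), single_const,
      single_comp]
    rfl
  · rw [lst_lof_ne _ h, smul_zero]
    refine (Finset.sum_eq_zero fun j _ => ?_).symm
    rw [lst_gWedge, elem, elemForm, lst_lof_ne _ h, star_zero_right]

/-- The expansion of a form-linear operator in a frame. -/
theorem op_expand (F : Frame R P) {k : ℕ} {T : Module.End ℝ (GForm R L P)} (hT : IsOp k T)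
    (i : Fin n) (η : GForm R L P) :
    F.χ • lst i (T η) = ∑ a : F.Idx,
      star (LinearMap.lsmul R (P i)) (sgnPow k (F.coord a η)) (lst i (T (F.elem L a))) := by
  induction η using gform_induction with
  | zero =>
    have h0 : sgnPow k (0 : List L → R) = 0 := by ext l; simp [sgnPow]
    simp [lst_zero, coord_zero, h0, star_zero_left]
  | lof s i' β =>
    rw [← lst_smul, ← hT.map_smul, F.expand_lof, map_sum, lst_sum, Fintype.sum_sigma,
      Finset.sum_eq_single i']
    · refine Finset.sum_congr rfl fun j _ => ?_
      rw [hT.linear, lst_real_smul, lst_gWedge, coord_lof,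
        (single_suppLength _).hasParity.sgnPow, star_zsmul_left]
      ext l
      rw [Pi.smul_apply, Pi.smul_apply, ← Int.cast_smul_eq_zsmul ℝ]
      simp
    · intro i'' _ h
      refine Finset.sum_eq_zero fun j _ => ?_
      have h0 : sgnPow k (0 : List L → R) = 0 := by ext l; simp [sgnPow]
      rw [coord_lof_ne _ (by exact h), h0, star_zero_left]
    · simp
  | add η θ h1 h2 =>
    rw [map_add, lst_add, smul_add, h1, h2, ← Finset.sum_add_distrib]
    refine Finset.sum_congr rfl fun a _ => ?_
    rw [coord_add, sgnPow_add, star_add_left]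

/-- The matrix of an operator. -/
def mat (F : Frame R P) (T : Module.End ℝ (GForm R L P)) (a b : F.Idx) : List L → R :=
  F.coord b (T (F.elem L a))

/-- The graded trace of an operator, multiplied by the cut-off function. -/
def tr (F : Frame R P) (T : Module.End ℝ (GForm R L P)) : List L → R :=
  ∑ a : F.Idx, (-1 : ℤ) ^ (a.1 : ℕ) • F.mat T a a

theorem tr_add (F : Frame R P) (S T : Module.End ℝ (GForm R L P)) :
    F.tr (S + T) = F.tr S + F.tr T := by
  simp only [tr, mat, LinearMap.add_apply, coord_add, smul_add, Finset.sum_add_distrib]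

theorem coord_sub (F : Frame R P) (a : F.Idx) (η θ : GForm R L P) :
    F.coord a (η - θ) = F.coord a η - F.coord a θ := by
  ext l; simp [coord, lst_sub]

theorem tr_sub (F : Frame R P) (S T : Module.End ℝ (GForm R L P)) :
    F.tr (S - T) = F.tr S - F.tr T := by
  simp only [tr, mat, LinearMap.sub_apply, coord_sub, smul_sub, Finset.sum_sub_distrib]

theorem tr_smul (F : Frame R P) (r : ℝ) (T : Module.End ℝ (GForm R L P)) :
    F.tr (r • T) = r • F.tr T := by
  simp only [tr, mat, LinearMap.smul_apply, coord_real_smul, Finset.smul_sum]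
  exact Finset.sum_congr rfl fun a _ => smul_comm _ _ _

theorem coord_star (F : Frame R P) (b : F.Idx) (f : List L → R) (η : GForm R L P) :
    (fun l => F.ε b.1 b.2 (star (LinearMap.lsmul R (P b.1)) f (lst b.1 η) l)) =
      mulL f (F.coord b η) :=
  comp_star _ _ (F.ε b.1 b.2) (F.ε b.1 b.2) (by simp) _ _

/-- Only the outer operator `T` has to be form-linear: it is moved past the coefficients of `S`,
whence the sign, and the cut-off comes from expanding in the frame. Hence `S` may also be a
connection. -/
theorem mat_mul (F : Frame R P) {k : ℕ} {T : Module.End ℝ (GForm R L P)} (hT : IsOp k T)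
    (S : Module.End ℝ (GForm R L P)) (a b : F.Idx) :
    F.χ • F.mat (T * S) a b = ∑ c : F.Idx, mulL (sgnPow k (F.mat S a c)) (F.mat T c b) := by
  have h := F.op_expand hT b.1 (S (F.elem L a))
  have h2 : F.χ • F.mat (T * S) a b =
      fun l => F.ε b.1 b.2 ((F.χ • lst b.1 (T (S (F.elem L a)))) l) := by
    ext l
    simp [mat, coord]
  rw [h2, h]
  ext l
  rw [Finset.sum_apply, map_sum, Finset.sum_apply]
  refine Finset.sum_congr rfl fun c _ => ?_
  exact congrFun (F.coord_star b _ _) l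

/-- Matrices with entries of the parity of an operator of degree `k`. -/
def MatParity (F : Frame R P) (k : ℕ) (X : F.Idx → F.Idx → List L → R) : Prop :=
  ∀ a b, HasParity (k + a.1 + b.1) (X a b)

theorem matParity_mat (F : Frame R P) {k : ℕ} {T : Module.End ℝ (GForm R L P)}
    (hT : ∀ j : ℕ, ∀ η ∈ homogeneous (R := R) (L := L) (P := P) j, T η ∈ homogeneous (j + k)) :
    F.MatParity k (F.mat T) := by
  intro a b
  have h := hasParity_lst (hT _ _ (elemForm_mem a.1 (F.e a.1 a.2))) b.1
  have h2 : F.mat T a b = fun l => F.ε b.1 b.2 (lst b.1 (T (F.elem L a)) l) := rfl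
  rw [HasParity, h2, sgn_comp, h, show (a.1 : ℕ) + k + b.1 = k + a.1 + b.1 by ring]
  ext l
  simp

theorem neg_one_pow_eq_of_mod {a b : ℕ} (h : a % 2 = b % 2) : (-1 : ℤ) ^ a = (-1) ^ b := by
  rw [neg_one_pow_eq_pow_mod_two, h, ← neg_one_pow_eq_pow_mod_two]

/-- The supertrace identity for matrices: exchange the two summations and use graded commutativity
of the entries. Only parities enter, so it also serves for the matrix of a connection. -/
theorem trace_comm (F : Frame R P) {k k' : ℕ} {X Y : F.Idx → F.Idx → List L → R}
    (hX : F.MatParity k X) (hY : F.MatParity k' Y) :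
    ∑ a, (-1 : ℤ) ^ (a.1 : ℕ) • ∑ b, mulL (sgnPow k' (X a b)) (Y b a) =
      (-1 : ℤ) ^ (k * k') • ∑ a, (-1 : ℤ) ^ (a.1 : ℕ) • ∑ b, mulL (sgnPow k (Y a b)) (X b a) := by
  simp only [Finset.smul_sum]
  rw [Finset.sum_comm]
  refine Finset.sum_congr rfl fun b _ => Finset.sum_congr rfl fun a _ => ?_
  have hflip : (LinearMap.mul R R).flip = LinearMap.mul R R := by
    ext; simp
  rw [(hX a b).sgnPow, (hY b a).sgnPow]
  simp only [mulL]
  rw [star_zsmul_left, star_zsmul_left, star_comm _ _ _ (hX a b) (hY b a), hflip]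
  simp only [smul_smul, ← pow_add]
  congr 1
  apply neg_one_pow_eq_of_mod
  obtain ⟨x, hx⟩ : ∃ x : ℕ, (a.1 : ℕ) = x := ⟨_, rfl⟩
  obtain ⟨y, hy⟩ : ∃ y : ℕ, (b.1 : ℕ) = y := ⟨_, rfl⟩
  rw [hx, hy]
  -- The two exponents of -1 are polynomials in the four degrees, so their equality modulo 2 is a
  -- finite check over `ZMod 2`.
  rw [← Nat.ModEq, ← ZMod.natCast_eq_natCast_iff]
  push_cast
  generalize (k : ZMod 2) = k
  generalize (k' : ZMod 2) = k'
  generalize (x : ZMod 2) = x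
  generalize (y : ZMod 2) = y
  revert k k' x y
  decide

/-- The graded trace vanishes on graded commutators. -/
theorem tr_mul_comm (F : Frame R P) {k k' : ℕ} {S T : Module.End ℝ (GForm R L P)} (hT : IsOp k T)
    (hS : IsOp k' S) : F.χ • F.tr (T * S) = (-1 : ℤ) ^ (k * k') • F.χ • F.tr (S * T) := by
  have h : ∀ {k k' : ℕ} {S T : Module.End ℝ (GForm R L P)} (_ : IsOp k T) (_ : IsOp k' S),
      F.χ • F.tr (T * S) =
        ∑ a, (-1 : ℤ) ^ (a.1 : ℕ) • ∑ b, mulL (sgnPow k (F.mat S a b)) (F.mat T b a) := by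
    intro k k' S T hT hS
    rw [tr, Finset.smul_sum]
    refine Finset.sum_congr rfl fun a _ => ?_
    rw [smul_comm, F.mat_mul hT]
  rw [h hT hS, h hS hT, F.trace_comm (F.matParity_mat hS.degree) (F.matParity_mat hT.degree),
    mul_comm k']

/-- The traces with respect to two frames agree up to the cut-off functions. -/
theorem tr_independent (F F' : Frame R P) {k : ℕ} {T : Module.End ℝ (GForm R L P)} (hT : IsOp k T) :
    F'.χ • F.tr T = F.χ • F'.tr T := by
  have key : ∀ i : Fin n, F'.χ • ∑ j, F.mat T ⟨i, j⟩ ⟨i, j⟩ = F.χ • ∑ j, F'.mat T ⟨i, j⟩ ⟨i, j⟩ := by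
    intro i
    ext l
    -- The usual change of basis: expand T e_j in the second frame, then sum over j first, which
    -- reassembles the elements of the second frame.
    have h1 : ∀ j, F'.χ * F.mat T ⟨i, j⟩ ⟨i, j⟩ l =
        ∑ j', F.ε i j (F'.e i j') * F'.ε i j' (lst i (T (F.elem L ⟨i, j⟩)) l) := by
      intro j
      change F'.χ * F.ε i j (lst i (T (F.elem L ⟨i, j⟩)) l) = _
      rw [← smul_eq_mul, ← LinearMap.map_smul, ← F'.expand, map_sum]
      refine Finset.sum_congr rfl fun j' _ => ?_
      rw [LinearMap.map_smul, smul_eq_mul, mul_comm]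
    have h2 : ∀ j', ∑ j, F.ε i j (F'.e i j') * F'.ε i j' (lst i (T (F.elem L ⟨i, j⟩)) l) =
        F.χ * F'.mat T ⟨i, j'⟩ ⟨i, j'⟩ l := by
      intro j'
      change _ = F.χ * F'.ε i j' (lst i (T (F'.elem L ⟨i, j'⟩)) l)
      rw [← smul_eq_mul F.χ, ← LinearMap.map_smul, ← Pi.smul_apply, ← lst_smul, ← hT.map_smul]
      have : F.χ • F'.elem L ⟨i, j'⟩ = ∑ j, F.ε i j (F'.e i j') • F.elem L ⟨i, j⟩ := by
        have hs : ∀ (s : Finset (Fin (F.N i))) (x : Fin (F.N i) → P i),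
            elemForm (R := R) (L := L) i (∑ j ∈ s, x j) = ∑ j ∈ s, elemForm i (x j) := fun s x =>
          map_sum (AddMonoidHom.mk' (elemForm (R := R) (L := L) i) (elemForm_add i)) x s
        simp only [elem, ← elemForm_smul, ← hs, F.expand]
      rw [this, map_sum, lst_sum, Finset.sum_apply, map_sum]
      refine Finset.sum_congr rfl fun j _ => ?_
      rw [hT.map_smul, lst_smul, Pi.smul_apply, LinearMap.map_smul, smul_eq_mul]
    simp only [Pi.smul_apply, Finset.sum_apply, Finset.mul_sum, smul_eq_mul]
    simp only [h1]
    rw [Finset.sum_comm]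
    exact Finset.sum_congr rfl fun j' _ => h2 j'
  simp only [tr, Fintype.sum_sigma, ← Finset.smul_sum]
  rw [Finset.smul_sum, Finset.smul_sum]
  refine Finset.sum_congr rfl fun i _ => ?_
  rw [smul_comm, key, smul_comm]

section Connection

variable [LieRingModule L R] [LieRinehartRing R L] [LieAlgebra ℝ L] [LieRinehartAlgebra ℝ R L]

/-- The expansion of a connection in a frame. -/
theorem connection_expand (F : Frame R P) {D : Module.End ℝ (GForm R L P)} (hD : IsConnection D)
    (i : Fin n) (η : GForm R L P) :
    star (LinearMap.lsmul R (P i)) (dL (single (constForm F.χ))) (lst i η) + F.χ • lst i (D η) =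
      ∑ a : F.Idx, (star (LinearMap.lsmul R (P i)) (dL (F.coord a η)) (lst i (F.elem L a)) +
        star (LinearMap.lsmul R (P i)) (sgn (F.coord a η)) (lst i (D (F.elem L a)))) := by
  have d0 : dL (0 : List L → R) = 0 := dLHom.map_zero
  -- The Leibniz rule identifies the left side with D(χη), and χη is a combination of frame elements
  -- with form coefficients.
  have hl : star (LinearMap.lsmul R (P i)) (dL (single (constForm F.χ))) (lst i η) +
      F.χ • lst i (D η) = lst i (D (F.χ • η)) := by
    rw [← gWedge_const, hD.leibniz, lst_add, lst_gWedge, ← single_dForm, pow_zero, one_smul,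
      gWedge_const, lst_smul]
    rfl
  rw [hl]
  induction η using gform_induction with
  | zero => simp [lst_zero, coord_zero, sgn_zero, star_zero_left, d0]
  | lof s i' β =>
    rw [F.expand_lof, map_sum, lst_sum, Fintype.sum_sigma, Finset.sum_eq_single i']
    · refine Finset.sum_congr rfl fun j _ => ?_
      rw [hD.leibniz, lst_add, lst_real_smul, lst_gWedge, lst_gWedge, coord_lof,
        (single_suppLength _).sgn, star_zsmul_left, ← single_dForm]
      congr 1
      ext l
      rw [Pi.smul_apply, Pi.smul_apply, ← Int.cast_smul_eq_zsmul ℝ]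
      simp
    · intro i'' _ h
      refine Finset.sum_eq_zero fun j _ => ?_
      rw [coord_lof_ne _ (by exact h), sgn_zero, star_zero_left, d0, star_zero_left, add_zero]
    · simp
  | add η θ h1 h2 =>
    rw [smul_add, map_add, lst_add, h1 (by
      rw [← gWedge_const, hD.leibniz, lst_add, lst_gWedge, ← single_dForm, pow_zero, one_smul,
        gWedge_const, lst_smul]
      rfl), h2 (by
      rw [← gWedge_const, hD.leibniz, lst_add, lst_gWedge, ← single_dForm, pow_zero, one_smul,
        gWedge_const, lst_smul]
      rfl), ← Finset.sum_add_distrib]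
    refine Finset.sum_congr rfl fun a _ => ?_
    rw [coord_add, sgn_add, dL_add, star_add_left, star_add_left]
    abel

/-- The graded trace of the graded commutator with a connection is the differential of the
graded trace. -/
theorem tr_comm (F : Frame R P) {D : Module.End ℝ (GForm R L P)} (hD : IsConnection D) {k : ℕ}
    {T : Module.End ℝ (GForm R L P)} (hT : IsOp k T) :
    F.χ • F.tr (D * T - (-1 : ℝ) ^ k • (T * D)) +
      mulL (dL (single (constForm F.χ))) (F.tr T) = F.χ • dL (F.tr T) := by
  -- `D` is not form-linear, so the product formula for matrices fails for D T. Expanding D(T e_a)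
  -- by the Leibniz rule adds the derivatives of the entries of `T`, and the term with dχ accounts
  -- for the cut-off.
  have hDT : F.χ • F.tr (D * T) + mulL (dL (single (constForm F.χ))) (F.tr T) =
      F.χ • dL (F.tr T) +
        ∑ a, (-1 : ℤ) ^ (a.1 : ℕ) • ∑ b, mulL (sgnPow 1 (F.mat T a b)) (F.mat D b a) := by
    simp only [mulL, tr]
    rw [star_sum_right, dL_sum, Finset.smul_sum, Finset.smul_sum, ← Finset.sum_add_distrib,
      ← Finset.sum_add_distrib]
    refine Finset.sum_congr rfl fun a _ => ?_
    rw [star_zsmul_right, dL_zsmul, smul_comm, smul_comm F.χ, ← smul_add, ← smul_add]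
    congr 1
    have h := F.connection_expand hD a.1 (T (F.elem L a))
    have h2 := congrArg (fun f : List L → P a.1 => fun l => F.ε a.1 a.2 (f l)) h
    have h3 : F.χ • F.mat (D * T) a a +
        mulL (dL (single (constForm F.χ))) (F.mat T a a) = fun l => F.ε a.1 a.2
        ((star (LinearMap.lsmul R (P a.1)) (dL (single (constForm F.χ))) (lst a.1 (T (F.elem L a))) +
          F.χ • lst a.1 (D (T (F.elem L a)))) l) := by
      rw [mat, mat, ← F.coord_star]
      ext l
      simp only [Pi.add_apply, Pi.smul_apply, map_add, map_smul]
      rw [add_comm]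
      rfl
    simp only [mulL] at h3
    rw [h3, h2]
    have h4 : (fun l => F.ε a.1 a.2 ((∑ b : F.Idx,
        (star (LinearMap.lsmul R (P a.1)) (dL (F.coord b (T (F.elem L a)))) (lst a.1 (F.elem L b)) +
        star (LinearMap.lsmul R (P a.1)) (sgn (F.coord b (T (F.elem L a))))
          (lst a.1 (D (F.elem L b))))) l)) =
        ∑ b : F.Idx, (mulL (dL (F.mat T a b)) (F.coord a (F.elem L b)) +
          mulL (sgn (F.mat T a b)) (F.mat D b a)) := by
      ext l
      rw [Finset.sum_apply, map_sum, Finset.sum_apply]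
      refine Finset.sum_congr rfl fun b _ => ?_
      rw [Pi.add_apply, map_add]
      exact congrArg₂ _ (congrFun (F.coord_star a _ _) l) (congrFun (F.coord_star a _ _) l)
    rw [h4, Finset.sum_add_distrib]
    congr 1
    -- The coordinates of a frame element are χ times a Kronecker delta, so only the diagonal entry
    -- is differentiated.
    · rw [Finset.sum_eq_single a]
      · rw [coord_elem, if_pos rfl]
        ext l
        simp only [mulL]
        rw [star_supp_zero_right _ _ (single_suppLength _), single_const]
        simp [mul_comm]
      · intro b _ hb
        rw [coord_elem, if_neg hb.symm]
        simp only [mulL]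
        rw [star_supp_zero_right _ _ (single_suppLength _), single_const]
        ext l
        simp
      · simp
    · simp only [sgnPow_one]
  have hTD : F.χ • F.tr (T * D) =
      ∑ a, (-1 : ℤ) ^ (a.1 : ℕ) • ∑ b, mulL (sgnPow k (F.mat D a b)) (F.mat T b a) := by
    rw [tr, Finset.smul_sum]
    refine Finset.sum_congr rfl fun a _ => ?_
    rw [smul_comm, F.mat_mul hT]
  rw [F.trace_comm (F.matParity_mat hT.degree) (F.matParity_mat hD.degree), ← hTD, mul_one] at hDT
  have e : ∀ f : List L → R, (-1 : ℝ) ^ k • f = (-1 : ℤ) ^ k • f := by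
    intro f
    rcases Nat.even_or_odd k with h | h <;> simp [h.neg_one_pow]
  rw [tr_sub, tr_smul, e, smul_sub, smul_comm F.χ, sub_add_eq_add_sub, hDT, add_sub_cancel_right]

end Connection

end Frame

end Frames

/-! ### Transgression as an identity of polynomials over a noncommutative algebra. -/

section Transgression

open Polynomial

variable {A : Type*} [Ring A] [Algebra ℝ A]

/-- Polynomials with coefficients in a subspace. -/
def PolyIn (S : Submodule ℝ A) (p : A[X]) : Prop := ∀ i, p.coeff i ∈ S

theorem PolyIn.add {S : Submodule ℝ A} {p q : A[X]} (hp : PolyIn S p) (hq : PolyIn S q) :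
    PolyIn S (p + q) := fun i => by rw [coeff_add]; exact add_mem (hp i) (hq i)

theorem PolyIn.sum {ι : Type*} {S : Submodule ℝ A} (s : Finset ι) {p : ι → A[X]}
    (hp : ∀ i ∈ s, PolyIn S (p i)) : PolyIn S (∑ i ∈ s, p i) := fun j => by
  rw [finsetSum_coeff]; exact sum_mem fun i hi => hp i hi j

theorem PolyIn.C {S : Submodule ℝ A} {a : A} (ha : a ∈ S) : PolyIn S (C a) := fun i => by
  rw [coeff_C]; split_ifs; exacts [ha, zero_mem _]

theorem PolyIn.mul_X {S : Submodule ℝ A} {p : A[X]} (hp : PolyIn S p) : PolyIn S (p * X) := fun i => by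
  cases i with
  | zero => simp
  | succ i => rw [coeff_mul_X]; exact hp i

variable {O : ℕ → Submodule ℝ A} (hmul : ∀ a b S T, S ∈ O a → T ∈ O b → S * T ∈ O (a + b))

include hmul in
theorem PolyIn.mul {a b : ℕ} {p q : A[X]} (hp : PolyIn (O a) p) (hq : PolyIn (O b) q) :
    PolyIn (O (a + b)) (p * q) := fun i => by
  rw [coeff_mul]
  exact sum_mem fun x _ => hmul _ _ _ _ (hp _) (hq _)

include hmul in
theorem PolyIn.pow (hone : (1 : A) ∈ O 0) {a : ℕ} {p : A[X]} (hp : PolyIn (O a) p) (m : ℕ) :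
    PolyIn (O (a * m)) (p ^ m) := by
  induction m with
  | zero => rw [pow_zero, ← C_1]; exact PolyIn.C hone
  | succ m ih => rw [pow_succ]; exact PolyIn.mul hmul ih hp

theorem PolyIn.comm {Z : Submodule ℝ A} {a b N : ℕ} (hN : a + b = N)
    (hZ : ∀ a b S T, S ∈ O a → T ∈ O b → a + b = N → S * T - (-1 : ℝ) ^ (a * b) • (T * S) ∈ Z)
    {p q : A[X]} (hp : PolyIn (O a) p) (hq : PolyIn (O b) q) :
    PolyIn Z (p * q - (-1 : ℝ) ^ (a * b) • (q * p)) := fun i => by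
  rw [coeff_sub, coeff_smul, coeff_mul, coeff_mul, ← Finset.Nat.sum_antidiagonal_swap (n := i)
    (f := fun x => q.coeff x.1 * p.coeff x.2), Finset.smul_sum, ← Finset.sum_sub_distrib]
  exact sum_mem fun x _ => hZ _ _ _ _ (hp _) (hq _) hN

theorem derivative_pow_eq_sum (p : A[X]) (m : ℕ) :
    derivative (p ^ m) = ∑ j ∈ Finset.range m, p ^ j * (derivative p * p ^ (m - 1 - j)) := by
  induction m with
  | zero => simp
  | succ m ih =>
    rw [pow_succ, derivative_mul, ih, Finset.sum_range_succ, Finset.sum_mul]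
    congr 1
    · refine Finset.sum_congr rfl fun j hj => ?_
      have hj := Finset.mem_range.1 hj
      rw [mul_assoc, mul_assoc, ← pow_succ]
      congr 3; omega
    · simp

include hmul in
/-- The transgression: if graded commutators, and graded commutators with `D`, lie in `Z`, then so
does `(D + w)^{2m} - D^{2m}`. -/
theorem transgression (hone : (1 : A) ∈ O 0) {Z : Submodule ℝ A} {D w : A} (hw : w ∈ O 1)
    (hD2 : D * D ∈ O 2) (hDw : D * w + w * D ∈ O 2) (m : ℕ)
    (hZ1 : ∀ a b S T, S ∈ O a → T ∈ O b → a + b = 2 * m + 2 →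
      S * T - (-1 : ℝ) ^ (a * b) • (T * S) ∈ Z)
    (hZ2 : ∀ T ∈ O (2 * m + 1), D * T + T * D ∈ Z) :
    (D + w) ^ (2 * m + 2) - D ^ (2 * m + 2) ∈ Z := by
  -- The affine path from D to D + w, with a central parameter. `D` itself lies in no `O k`, but all
  -- coefficients of its curvature lie in `O 2`.
  set Dt : A[X] := C D + C w * X with hDt
  have hX : ∀ p : A[X], X * p = p * X := fun p => X_mul
  have hR : PolyIn (O 2) (Dt * Dt) := by
    have e : Dt * Dt = C (D * D) + C (D * w + w * D) * X + C (w * w) * X * X := by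
      simp only [hDt, mul_add, add_mul, C_mul, C_add, mul_assoc, hX]
      abel
    rw [e]
    exact ((PolyIn.C hD2).add (PolyIn.C hDw).mul_X).add (PolyIn.C (hmul 1 1 _ _ hw hw)).mul_X.mul_X
  have hDt' : derivative Dt = C w := by simp [hDt]
  have hdR : derivative (Dt * Dt) = C w * Dt + Dt * C w := by rw [derivative_mul, hDt']
  have hdR2 : PolyIn (O 2) (derivative (Dt * Dt)) := fun i => by
    rw [coeff_derivative, ← Nat.cast_succ, ← nsmul_eq_mul']
    exact nsmul_mem (hR _) _
  have hder : PolyIn Z (derivative ((Dt * Dt) ^ (m + 1))) := by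
    rw [derivative_pow_eq_sum]
    refine PolyIn.sum _ fun j hj => ?_
    have hj := Finset.mem_range.1 hj
    have h1 := PolyIn.pow hmul hone hR j
    have h2 := PolyIn.mul hmul hdR2 (PolyIn.pow hmul hone hR (m + 1 - 1 - j))
    have h3 := PolyIn.comm (N := 2 * m + 2) (by omega) hZ1 h1 h2
    have hsgn : (-1 : ℝ) ^ (2 * j * (2 + 2 * (m + 1 - 1 - j))) = 1 := by
      rw [mul_assoc, pow_mul]; simp
    rw [hsgn, one_smul] at h3
    -- Up to a commutator each summand of the derivative is R' R^m, with R the curvature of the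
    -- path. Since R commutes with the path and R' is its anticommutator with w, this is the
    -- anticommutator of the path with θ = w R^m.
    have h4 : derivative (Dt * Dt) * (Dt * Dt) ^ (m + 1 - 1 - j) * (Dt * Dt) ^ j =
        Dt * (C w * (Dt * Dt) ^ m) + C w * (Dt * Dt) ^ m * Dt := by
      have hc : Dt * (Dt * Dt) ^ m = (Dt * Dt) ^ m * Dt :=
        ((Commute.refl Dt).mul_right (Commute.refl Dt)).pow_right m
      rw [mul_assoc, ← pow_add, show m + 1 - 1 - j + j = m by omega, hdR, add_mul, mul_assoc, hc,
        mul_assoc, mul_assoc, add_comm]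
    set θ : A[X] := C w * (Dt * Dt) ^ m with hθ
    have hθO : PolyIn (O (2 * m + 1)) θ := by
      have := PolyIn.mul hmul (PolyIn.C hw) (PolyIn.pow hmul hone hR m)
      rwa [add_comm] at this
    have h5 : Dt * θ + θ * Dt = (C D * θ + θ * C D) + (C w * θ + θ * C w) * X := by
      rw [hDt, add_mul, mul_add, add_mul, mul_assoc, hX]
      simp only [mul_assoc]
      abel
    have h6 : PolyIn Z (C D * θ + θ * C D) := fun i => by
      rw [coeff_add, coeff_C_mul, coeff_mul_C]
      exact hZ2 _ (hθO i)
    have h7 : PolyIn Z (C w * θ + θ * C w) := by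
      have := PolyIn.comm (N := 2 * m + 2) (by omega) hZ1 (PolyIn.C hw) hθO
      have hs : (-1 : ℝ) ^ (1 * (2 * m + 1)) = -1 := by
        rw [one_mul]; exact Odd.neg_one_pow ⟨m, rfl⟩
      rwa [hs, neg_one_smul, sub_neg_eq_add] at this
    have h8 := h3.add (h6.add h7.mul_X)
    rw [← h5, ← h4, sub_add_cancel] at h8
    exact h8
  -- Integration of the derivative: the coefficient of degree k + 1 is recovered on dividing by k +
  -- 1.
  have hcoeff : ∀ k, ((Dt * Dt) ^ (m + 1)).coeff (k + 1) ∈ Z := by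
    intro k
    have h := hder k
    rw [coeff_derivative, ← Nat.cast_succ, ← nsmul_eq_mul', ← Nat.cast_smul_eq_nsmul ℝ] at h
    exact (Submodule.smul_mem_iff _ (Nat.cast_ne_zero.2 k.succ_ne_zero)).1 h
  -- Evaluation at the end of the path is multiplicative because 1 is central. Its value is the sum
  -- of all coefficients, so the difference of the end points is the sum of the coefficients of
  -- positive degree.
  let ev : A[X] →+* A := eval₂RingHom' (RingHom.id A) 1 fun a => Commute.one_right a
  have hev : ∀ p : A[X], ev p = ∑ i ∈ Finset.range (p.natDegree + 1), p.coeff i := by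
    intro p
    change p.eval₂ (RingHom.id A) 1 = _
    rw [← eval, eval_eq_sum_range]
    simp
  have hevD : ev Dt = D + w := by
    change eval₂ (RingHom.id A) 1 Dt = _
    rw [hDt, eval₂_add, eval₂_C, eval₂_mul_X, eval₂_C]
    simp
  have h1 : ev ((Dt * Dt) ^ (m + 1)) = (D + w) ^ (2 * m + 2) := by
    rw [map_pow, map_mul, hevD, ← pow_two, ← pow_mul]; rfl
  have h0 : ((Dt * Dt) ^ (m + 1)).coeff 0 = D ^ (2 * m + 2) := by
    have : constantCoeff ((Dt * Dt) ^ (m + 1)) = D ^ (2 * m + 2) := by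
      rw [map_pow, map_mul, ← pow_two, ← pow_mul]
      simp [hDt, mul_add]
    exact this
  rw [← h1, ← h0, hev, Finset.sum_range_succ', add_sub_cancel_right]
  exact sum_mem fun k _ => hcoeff k

end Transgression

/-! ### Existence of smooth cut-off dual frames. -/

section LocalFrames

set_option linter.unusedSectionVars false

variable {EM : Type*} [NormedAddCommGroup EM] [NormedSpace ℝ EM] [FiniteDimensional ℝ EM]
  {M : Type*} [TopologicalSpace M] [ChartedSpace EM M] [IsManifold 𝓘(ℝ, EM) ∞ M] [T2Space M]
  {F : Type*} [NormedAddCommGroup F] [NormedSpace ℝ F] [FiniteDimensional ℝ F] {V : M → Type*}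
  [TopologicalSpace (Bundle.TotalSpace F V)] [∀ x, AddCommGroup (V x)] [∀ x, Module ℝ (V x)]
  [∀ x, TopologicalSpace (V x)] [FiberBundle F V] [VectorBundle ℝ F V]
  [ContMDiffVectorBundle ∞ F V 𝓘(ℝ, EM)]

variable (EM) in
/-- A cut-off function at a point, supported in a given neighbourhood. -/
theorem exists_cutoff {x₀ : M} {u : Set M} (hu : u ∈ 𝓝 x₀) :
    ∃ χ : Fun EM M, (∀ᶠ y in 𝓝 x₀, χ y = 1) ∧ tsupport χ ⊆ u := by
  obtain ⟨f, -, hf⟩ := (SmoothBumpFunction.nhds_basis_tsupport (I := 𝓘(ℝ, EM)) x₀).mem_iff.1 hu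
  exact ⟨⟨f, f.contMDiff⟩, f.eventuallyEq_one, hf⟩

theorem finrank_fiber (F : Type*) [NormedAddCommGroup F] [NormedSpace ℝ F] {V : M → Type*}
    [TopologicalSpace (Bundle.TotalSpace F V)] [∀ x, AddCommGroup (V x)] [∀ x, Module ℝ (V x)]
    [∀ x, TopologicalSpace (V x)] [FiberBundle F V] [VectorBundle ℝ F V] (x : M) : Module.finrank ℝ (V x) = Module.finrank ℝ F :=
  ((trivializationAt F V x).linearEquivAt ℝ x
    (FiberBundle.mem_baseSet_trivializationAt' x)).finrank_eq

theorem finiteDimensional_fiber (F : Type*) [NormedAddCommGroup F] [NormedSpace ℝ F]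
    [FiniteDimensional ℝ F] {V : M → Type*}
    [TopologicalSpace (Bundle.TotalSpace F V)] [∀ x, AddCommGroup (V x)] [∀ x, Module ℝ (V x)]
    [∀ x, TopologicalSpace (V x)] [FiberBundle F V] [VectorBundle ℝ F V] (x : M) : FiniteDimensional ℝ (V x) :=
  Module.Finite.equiv ((trivializationAt F V x).linearEquivAt ℝ x
    (FiberBundle.mem_baseSet_trivializationAt' x)).symm

variable (EM F) in
/-- Every vector is the value of a smooth section. -/
theorem exists_section_eq (x₀ : M) (v : V x₀) : ∃ σ : Sec EM F V, σ x₀ = v := by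
  obtain ⟨u, hu, hs⟩ := FiberBundle.exists_contMDiffOn_extend (k := ∞) 𝓘(ℝ, EM) F v
  obtain ⟨χ, hχ, hsupp⟩ := exists_cutoff EM (interior_mem_nhds.2 hu)
  refine ⟨⟨_, ContMDiffOn.smul_section_of_tsupport χ.contMDiff.contMDiffOn isOpen_interior hsupp
    (hs.mono interior_subset)⟩, ?_⟩
  change χ x₀ • FiberBundle.extend F v x₀ = v
  rw [hχ.self_of_nhds, one_smul, FiberBundle.extend_apply_self]

theorem contMDiffAt_det {ι : Type*} [Fintype ι] [DecidableEq ι] {A : M → Matrix ι ι ℝ} {x : M}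
    (h : ∀ i j, ContMDiffAt 𝓘(ℝ, EM) 𝓘(ℝ, ℝ) ∞ (fun y => A y i j) x) :
    ContMDiffAt 𝓘(ℝ, EM) 𝓘(ℝ, ℝ) ∞ (fun y => (A y).det) x := by
  simp only [Matrix.det_apply']
  refine contMDiffAt_finsetSum fun σ _ => ?_
  exact contMDiffAt_const.mul (contMDiffAt_finsetProd fun i _ => h _ _)

/-- Sections that are independent at a point and of the right number have, up to a cut-off
function, a dual frame. -/
theorem exists_dual_frame {ι : Type*} [Fintype ι] [DecidableEq ι] (s : ι → Sec EM F V) (x₀ : M)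
    (hli : LinearIndependent ℝ fun i => s i x₀) (hcard : Fintype.card ι = Module.finrank ℝ F) :
    ∃ (ε : ι → Sec EM F V →ₗ[Fun EM M] Fun EM M) (χ : Fun EM M), (∀ᶠ y in 𝓝 x₀, χ y = 1) ∧
      (∀ j l, ε j (s l) = if j = l then χ else 0) ∧ (∀ a, ∑ j, ε j a • s j = χ • a) ∧
      ∀ j a a' y, a y = a' y → ε j a y = ε j a' y := by
  have : ContMDiffVectorBundle 1 F V 𝓘(ℝ, EM) := ContMDiffVectorBundle.of_le (n := ∞) (by simp)
  let t := trivializationAt F V x₀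
  let b : Module.Basis ι ℝ F := (Module.finBasis ℝ F).reindex
    (Fintype.equivOfCardEq (by rw [Fintype.card_fin, hcard]))
  have hx₀ : x₀ ∈ t.baseSet := FiberBundle.mem_baseSet_trivializationAt' x₀
  let co : ∀ y, V y →ₗ[ℝ] (ι → ℝ) := fun y =>
    LinearMap.pi fun k => t.localFrameCoeff 𝓘(ℝ, EM) b k y
  have co_smooth : ∀ (a : Sec EM F V) k, ∀ y ∈ t.baseSet,
      ContMDiffAt 𝓘(ℝ, EM) 𝓘(ℝ, ℝ) ∞ (fun y => co y (a y) k) y := fun a k y hy =>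
    contMDiffAt_localFrameCoeff b hy a.contMDiff.contMDiffAt k
  have co_inj : ∀ (a a' : Sec EM F V), ∀ y ∈ t.baseSet, co y (a y) = co y (a' y) → a y = a' y := by
    intro a a' y hy h
    rw [Bundle.Trivialization.eq_sum_localFrameCoeff_smul (I := 𝓘(ℝ, EM)) (e := t) (b := b)
      (s := fun y => a y) hy, Bundle.Trivialization.eq_sum_localFrameCoeff_smul (I := 𝓘(ℝ, EM))
      (e := t) (b := b) (s := fun y => a' y) hy]
    exact Finset.sum_congr rfl fun k _ => congrArg (· • _) (congrFun h k)
  let A : M → Matrix ι ι ℝ := fun y => Matrix.of fun k j => co y (s j y) k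
  have A_smooth : ∀ y ∈ t.baseSet, ∀ k j,
      ContMDiffAt 𝓘(ℝ, EM) 𝓘(ℝ, ℝ) ∞ (fun y => A y k j) y := fun y hy k j => co_smooth (s j) k y hy
  have hdet : (A x₀).det ≠ 0 := by
    have : FiniteDimensional ℝ (V x₀) := finiteDimensional_fiber F x₀
    have hspan := hli.span_eq_top_of_card_eq_finrank' (by rw [hcard, finrank_fiber F])
    have h := (t.basisAt b hx₀).isUnit_det (Module.Basis.mk hli hspan.ge)
    rw [Module.Basis.det_apply] at h
    convert h.ne_zero using 2
    ext k j
    rw [Module.Basis.toMatrix_apply, Module.Basis.mk_apply]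
    exact t.localFrameCoeff_apply_of_mem_baseSet b hx₀ (s j) k
  have hu : ∀ᶠ y in 𝓝 x₀, y ∈ t.baseSet ∧ (A y).det ≠ 0 :=
    (show ∀ᶠ y in 𝓝 x₀, y ∈ t.baseSet from t.open_baseSet.mem_nhds hx₀).and
      ((contMDiffAt_det (A_smooth x₀ hx₀)).continuousAt.eventually_ne hdet)
  obtain ⟨χ, hχ, hsupp⟩ := exists_cutoff EM hu
  -- The dual functionals are given by Cramer's rule. This makes smoothness visible where the
  -- determinant is nonzero, and the cut-off is supported there.
  let f : ι → ∀ y, V y →ₗ[ℝ] ℝ := fun j y =>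
    (χ y * ((A y).det)⁻¹) • (LinearMap.proj j ∘ₗ Matrix.cramer (A y) ∘ₗ co y)
  have hf : ∀ j (a : Sec EM F V), ContMDiff 𝓘(ℝ, EM) 𝓘(ℝ, ℝ) ∞ fun y => f j y (a y) := by
    intro j a
    refine contMDiff_of_tsupport fun y hy => ?_
    have hy' := hsupp ((closure_mono (fun z hz => by
      simp only [Function.mem_support] at hz ⊢
      intro h0
      simp [f, h0] at hz) : tsupport (fun y => f j y (a y)) ⊆ tsupport χ) hy)
    have hA := contMDiffAt_det (A_smooth y hy'.1)
    have e : (fun y => f j y (a y)) =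
        fun y => χ y * ((A y).det)⁻¹ * ((A y).updateCol j (co y (a y))).det := by
      ext y
      simp [f, Matrix.cramer_apply]
    rw [e]
    refine (χ.contMDiff.contMDiffAt.mul ?_).mul (contMDiffAt_det fun k l => ?_)
    · exact (contDiffAt_inv ℝ hy'.2).contMDiffAt.comp y hA
    · by_cases hl : l = j
      · subst hl
        simpa using co_smooth a k y hy'.1
      · simpa [Matrix.updateCol_ne hl] using A_smooth y hy'.1 k l
  let fε : ι → Sec EM F V → Fun EM M := fun j a => ⟨fun y => f j y (a y), hf j a⟩
  have hχ0 : ∀ y, χ y ≠ 0 → y ∈ t.baseSet ∧ (A y).det ≠ 0 := fun y hy =>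
    hsupp (subset_tsupport _ hy)
  refine ⟨fun j => { toFun := fε j
                     map_add' := fun a a' => by ext y; exact map_add (f j y) _ _
                     map_smul' := fun g a => by ext y; exact map_smul (f j y) (g y) _ },
    χ, hχ, fun j l => ?_, fun a => ?_, fun j a a' y h => congrArg (f j y) h⟩
  · ext y
    change f j y (s l y) = _
    have hc : co y (s l y) = (A y).mulVec (Pi.single l 1) := by
      ext k
      simp [A]
    have h1 : f j y (s l y) = χ y * ((A y).det)⁻¹ * Matrix.cramer (A y) (co y (s l y)) j := rfl
    rw [h1, hc, Matrix.cramer_eq_adjugate_mulVec, Matrix.mulVec_mulVec, Matrix.adjugate_mul,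
      Matrix.smul_mulVec, Matrix.one_mulVec]
    by_cases h0 : χ y = 0
    · split_ifs <;> simp [h0]
    · have := (hχ0 y h0).2
      by_cases hjl : j = l
      · subst hjl
        simp
        field_simp
      · simp [hjl]
  · ext y
    by_cases h0 : χ y = 0
    · rw [fun_smul_apply, h0, zero_smul]
      have : ∀ (s' : Finset ι), (∑ j ∈ s', (fε j a • s j)) y =
          0 := by
        intro s'
        induction s' using Finset.induction_on with
        | empty => rfl
        | insert j s' hj ih =>
          rw [Finset.sum_insert hj, ContMDiffSection.coe_add, Pi.add_apply, ih, add_zero,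
            fun_smul_apply]
          change f j y (a y) • _ = _
          simp [f, h0]
      exact this _
    · refine co_inj _ _ y (hχ0 y h0).1 ?_
      have hsum : ∀ (s' : Finset ι),
          co y ((∑ j ∈ s', (fε j a • s j)) y) =
          ∑ j ∈ s', f j y (a y) • co y (s j y) := by
        intro s'
        induction s' using Finset.induction_on with
        | empty => exact map_zero _
        | insert j s' hj ih =>
          rw [Finset.sum_insert hj, ContMDiffSection.coe_add, Pi.add_apply, map_add, ih,
            fun_smul_apply, map_smul, Finset.sum_insert hj]
          rfl
      refine (hsum _).trans ?_
      rw [fun_smul_apply, map_smul]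
      have h2 : ∑ j, f j y (a y) • co y (s j y) =
          (χ y * ((A y).det)⁻¹) • (A y).mulVec (Matrix.cramer (A y) (co y (a y))) := by
        ext k
        simp only [Finset.sum_apply, Pi.smul_apply, smul_eq_mul, Matrix.mulVec, dotProduct,
          Finset.mul_sum]
        refine Finset.sum_congr rfl fun j _ => ?_
        simp [f, A]
        ring
      rw [h2, Matrix.cramer_eq_adjugate_mulVec, Matrix.mulVec_mulVec, Matrix.mul_adjugate,
        Matrix.smul_mulVec, Matrix.one_mulVec, smul_smul, mul_assoc,
        inv_mul_cancel₀ (hχ0 y h0).2, mul_one]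

end LocalFrames

/-! ### The global graded trace of an operator. -/

section TraceForm

set_option linter.unusedSectionVars false

section Algebra

variable {R L : Type*} [CommRing R] [LieRing L] [Module R L] [Algebra ℝ R]
  {n : ℕ} {P : Fin n → Type*} [∀ i, AddCommGroup (P i)] [∀ i, Module R (P i)]
  [∀ i, Module ℝ (P i)] [∀ i, IsScalarTower ℝ R (P i)]

theorem lst_eq_single_of_mem {j : ℕ} {η : GForm R L P} (i : Fin n)
    (h : η ∈ homogeneous (j + i)) : lst i η = single (η (j, i)) := by
  ext l
  by_cases hl : l.length = j
  · subst hl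
    exact lst_eq_single i η l
  · rw [lst_of_mem_homogeneous h i l (by omega), single_suppLength _ l hl]

theorem single_sum {Q : Type*} [AddCommGroup Q] [Module R Q] {k : ℕ} {ι : Type*} (s : Finset ι)
    (α : ι → Form R L Q k) : single (∑ j ∈ s, α j) = ∑ j ∈ s, single (α j) :=
  map_sum (AddMonoidHom.mk' (single (R := R) (L := L) (P := Q) (k := k)) single_add) α s

theorem Frame.exists_tr_form (F : Frame R P) {k : ℕ} {T : Module.End ℝ (GForm R L P)}
    (hT : IsOp k T) : ∃ τ : Form R L R k, F.tr T = single τ := by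
  refine ⟨∑ a : F.Idx, (-1 : ℤ) ^ (a.1 : ℕ) •
    (F.ε a.1 a.2).compAlternatingMap ((T (F.elem L a)) (k, a.1)), ?_⟩
  rw [single_sum, Frame.tr]
  refine Finset.sum_congr rfl fun a _ => ?_
  rw [single_smul, single_comp]
  congr 1
  have h := hT.degree _ _ (elemForm_mem (R := R) (L := L) a.1 (F.e a.1 a.2))
  rw [add_comm] at h
  rw [← lst_eq_single_of_mem a.1 h]
  rfl

theorem IsOp.commutator {k k' : ℕ} {S T : Module.End ℝ (GForm R L P)} (hS : IsOp k S)
    (hT : IsOp k' T) : IsOp (k + k') (S * T - (-1 : ℝ) ^ (k * k') • (T * S)) where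
  degree j η h := sub_mem ((hS.mul hT).degree j η h)
    (Submodule.smul_mem _ _ ((add_comm k' k ▸ hT.mul hS : IsOp (k + k') (T * S)).degree j η h))
  linear p α η := by
    have h : IsOp (k + k') (T * S) := add_comm k' k ▸ hT.mul hS
    rw [LinearMap.sub_apply, LinearMap.smul_apply, (hS.mul hT).linear, h.linear,
      LinearMap.sub_apply, LinearMap.smul_apply, map_sub, LinearMap.map_smul, smul_sub, smul_comm]

theorem sub_neg_one_smul {W : Type*} [AddCommGroup W] [Module ℝ W] (v w : W) :
    v - (-1 : ℝ) • w = v + w := by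
  rw [neg_smul, one_smul, sub_neg_eq_add]

theorem pow_sub_pow_mem [LieRingModule L R] [LieRinehartRing R L] [LieAlgebra ℝ L]
    [LieRinehartAlgebra ℝ R L] {D D' : Module.End ℝ (GForm R L P)} (hD : IsConnection D)
    (hD' : IsConnection D') {Z : Submodule ℝ (Module.End ℝ (GForm R L P))} (m : ℕ)
    (hZ₁ : ∀ (a b : ℕ) (S T : Module.End ℝ (GForm R L P)), IsOp a S → IsOp b T →
      a + b = 2 * m + 2 → S * T - (-1 : ℝ) ^ (a * b) • (T * S) ∈ Z)
    (hZ₂ : ∀ T : Module.End ℝ (GForm R L P), IsOp (2 * m + 1) T →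
      D * T - (-1 : ℝ) ^ (2 * m + 1) • (T * D) ∈ Z) :
    D' ^ (2 * m + 2) - D ^ (2 * m + 2) ∈ Z := by
  have hw := hD.sub_isOp hD'
  have key := transgression (O := opSub R L P) (fun a b S T hS hT => IsOp.mul hS hT) IsOp.one
    (Z := Z) (D := D) (w := D' - D) hw hD.sq_isOp
    (by
      have := hD.comm_isOp hw
      rw [pow_one] at this
      exact (sub_neg_one_smul (D * (D' - D)) ((D' - D) * D)) ▸ this) m hZ₁
    (fun T hT => by
      have := hZ₂ T hT
      rw [Odd.neg_one_pow ⟨m, rfl⟩] at this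
      exact (sub_neg_one_smul (D * T) (T * D)) ▸ this)
  have e : D + (D' - D) = D' := add_sub_cancel D D'
  rwa [e] at key

/-- `γ` is the graded trace of the operator `T`. -/
def IsTrace (T : Module.End ℝ (GForm R L P)) {k : ℕ} (γ : Form R L R k) : Prop :=
  ∀ F : Frame R P, F.tr T = F.χ • single γ

theorem IsTrace.add {S T : Module.End ℝ (GForm R L P)} {k : ℕ} {β γ : Form R L R k}
    (hS : IsTrace S β) (hT : IsTrace T γ) : IsTrace (S + T) (β + γ) := fun F => by
  rw [F.tr_add, hS, hT, single_add, smul_add]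

theorem IsTrace.smul (r : ℝ) {T : Module.End ℝ (GForm R L P)} {k : ℕ} {γ : Form R L R k}
    (hT : IsTrace T γ) : IsTrace (r • T) (r • γ) := fun F => by
  rw [F.tr_smul, hT, single_smul, smul_comm]

end Algebra

variable {EM : Type*} [NormedAddCommGroup EM] [NormedSpace ℝ EM] [FiniteDimensional ℝ EM]
  {M : Type*} [TopologicalSpace M] [ChartedSpace EM M] [IsManifold 𝓘(ℝ, EM) ∞ M] [T2Space M]

/-- Locally given functions that agree glue. -/
theorem exists_glue {χ t : M → Fun EM M} (hχ : ∀ x, ∀ᶠ y in 𝓝 x, χ x y = 1)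
    (h : ∀ x y, χ y * t x = χ x * t y) : ∃ u : Fun EM M, ∀ x, t x = χ x * u := by
  have key : ∀ x z, t x z = χ x z * t z z := by
    intro x z
    have := DFunLike.congr_fun (h x z) z
    change χ z z * t x z = χ x z * t z z at this
    rwa [(hχ z).self_of_nhds, one_mul] at this
  -- At y the local function with index y is used, because its own cut-off is 1 there. Near a fixed
  -- x this agrees with `t x`, which gives smoothness.
  refine ⟨⟨fun y => t y y, fun x => ?_⟩, fun x => ?_⟩
  · refine (t x).contMDiff.contMDiffAt.congr_of_eventuallyEq ?_
    filter_upwards [hχ x] with y hy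
    rw [key x, hy, one_mul]
  · ext z
    exact key x z

theorem fun_eq_of_smul_eq {χ : M → Fun EM M} (hχ : ∀ x, ∀ᶠ y in 𝓝 x, χ x y = 1) {f g : Fun EM M}
    (h : ∀ x, χ x • f = χ x • g) : f = g := by
  ext x
  have := DFunLike.congr_fun (h x) x
  change χ x x * f x = χ x x * g x at this
  simpa [(hχ x).self_of_nhds] using this

theorem lists_eq_of_smul_eq {L : Type*} {χ : M → Fun EM M} (hχ : ∀ x, ∀ᶠ y in 𝓝 x, χ x y = 1)
    {f g : List L → Fun EM M} (h : ∀ x, χ x • f = χ x • g) : f = g := by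
  ext1 l
  exact fun_eq_of_smul_eq hχ fun x => congrFun (h x) l

/-- Locally given forms that agree glue. -/
theorem exists_glue_form {L : Type*} [LieRing L] [Module (Fun EM M) L] {k : ℕ} {χ : M → Fun EM M}
    {τ : M → Form (Fun EM M) L (Fun EM M) k} (hχ : ∀ x, ∀ᶠ y in 𝓝 x, χ x y = 1)
    (h : ∀ x y, χ y • τ x = χ x • τ y) :
    ∃ γ : Form (Fun EM M) L (Fun EM M) k, ∀ x, τ x = χ x • γ := by
  choose u hu using fun a : Fin k → L => exists_glue hχ (t := fun x => τ x a)
    fun x y => DFunLike.congr_fun (h x y) a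
  -- The gluing is done separately for each tuple of arguments. Multilinearity and alternation are
  -- inherited, because they may be checked after multiplication by each cut-off.
  refine ⟨{ toFun := u, map_update_add' := ?_, map_update_smul' := ?_, map_eq_zero_of_eq' := ?_ },
    fun x => by ext1 a; exact hu a x⟩
  · intro _ a i y z
    refine fun_eq_of_smul_eq hχ fun x => ?_
    simp only [smul_eq_mul, mul_add, ← hu, AlternatingMap.map_update_add]
  · intro _ a i c y
    refine fun_eq_of_smul_eq hχ fun x => ?_
    rw [smul_comm]
    simp only [smul_eq_mul, ← hu]
    rw [AlternatingMap.map_update_smul, smul_eq_mul]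
  · intro a i j haij hij
    refine fun_eq_of_smul_eq hχ fun x => ?_
    simp only [smul_eq_mul, ← hu, mul_zero]
    exact (τ x).map_eq_zero_of_eq _ haij hij

variable {n : ℕ} {FE : Fin n → Type*} [∀ i, NormedAddCommGroup (FE i)] [∀ i, NormedSpace ℝ (FE i)]
  [∀ i, FiniteDimensional ℝ (FE i)]
  {E : Fin n → M → Type*} [∀ i, TopologicalSpace (Bundle.TotalSpace (FE i) (E i))]
  [∀ i x, AddCommGroup (E i x)] [∀ i x, Module ℝ (E i x)] [∀ i x, TopologicalSpace (E i x)]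
  [∀ i, FiberBundle (FE i) (E i)] [∀ i, VectorBundle ℝ (FE i) (E i)]
  [∀ i, ContMDiffVectorBundle ∞ (FE i) (E i) 𝓘(ℝ, EM)]

variable (EM FE E) in
theorem exists_frame (x₀ : M) :
    ∃ F : Frame (Fun EM M) (fun i => Sec EM (FE i) (E i)), (∀ᶠ y in 𝓝 x₀, F.χ y = 1) ∧
      ∀ i, LinearIndependent ℝ fun j => F.e i j x₀ := by
  have hfd : ∀ i, FiniteDimensional ℝ (E i x₀) := fun i => finiteDimensional_fiber (FE i) x₀
  choose e he using fun i (j : Fin (Module.finrank ℝ (E i x₀))) =>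
    exists_section_eq EM (FE i) x₀ (Module.finBasis ℝ (E i x₀) j)
  have hli : ∀ i, LinearIndependent ℝ fun j => e i j x₀ := fun i => by
    simp only [he]
    exact (Module.finBasis ℝ (E i x₀)).linearIndependent
  choose ε χ hχ hdual hexp _ using fun i => exists_dual_frame (e i) x₀ (hli i)
    (by rw [Fintype.card_fin, finrank_fiber (FE i)])
  -- Each summand has its own cut-off. A frame needs a common one, so each functional is multiplied
  -- by the cut-offs of the other summands.
  refine ⟨⟨_, e, fun i j => (∏ k ∈ Finset.univ.erase i, χ k) • ε i j, ∏ k, χ k, ?_, ?_⟩, ?_, hli⟩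
  · intro i j l
    rw [LinearMap.smul_apply, hdual]
    split_ifs
    · rw [smul_eq_mul, Finset.prod_erase_mul _ _ (Finset.mem_univ i)]
    · rw [smul_zero]
  · intro i s
    simp only [LinearMap.smul_apply, smul_assoc]
    rw [← Finset.smul_sum, hexp, smul_smul, Finset.prod_erase_mul _ _ (Finset.mem_univ i)]
  · filter_upwards [Filter.eventually_all.2 hχ] with y hy
    have : (∏ k, χ k : Fun EM M) y = ∏ k, χ k y := by
      exact map_prod (ContMDiffMap.evalRingHom y) _ _
    rw [this]
    exact Finset.prod_eq_one fun k _ => hy k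

variable {L : Type*} [LieRing L] [Module (Fun EM M) L]

/-- The second hypothesis carries one more factor χ than `IsTrace`, because the trace identities for
commutators hold only after multiplication by χ. Since χ² is still 1 near the chosen point, nothing
is lost. -/
theorem isTrace_unique {k : ℕ}
    {T : Module.End ℝ (GForm (Fun EM M) L fun i => Sec EM (FE i) (E i))}
    {β γ : Form (Fun EM M) L (Fun EM M) k} (hβ : IsTrace T β)
    (hγ : ∀ F : Frame (Fun EM M) (fun i => Sec EM (FE i) (E i)),
      F.χ • F.tr T = F.χ • F.χ • single γ) : β = γ := by
  choose F hF _ using exists_frame EM FE E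
  refine single_ext (lists_eq_of_smul_eq (χ := fun x => (F x).χ * (F x).χ) (fun x => ?_)
    fun x => ?_)
  · filter_upwards [hF x] with y hy
    rw [ContMDiffMap.coe_mul, Pi.mul_apply, hy, one_mul]
  · rw [mul_smul, mul_smul, ← hβ, hγ]

/-- The traces in different frames agree up to the cut-offs, which is exactly the compatibility
needed for gluing; the same comparison then gives the formula in every frame. -/
theorem exists_isTrace {k : ℕ}
    {T : Module.End ℝ (GForm (Fun EM M) L fun i => Sec EM (FE i) (E i))} (hT : IsOp k T) :
    ∃ γ : Form (Fun EM M) L (Fun EM M) k, IsTrace T γ := by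
  choose F hF _ using exists_frame EM FE E
  choose τ hτ using fun F : Frame (Fun EM M) (fun i => Sec EM (FE i) (E i)) => F.exists_tr_form hT
  obtain ⟨γ, hγ⟩ := exists_glue_form hF (τ := fun x => τ (F x)) fun x y => single_ext (by
    rw [single_smul, single_smul, ← hτ, ← hτ, Frame.tr_independent _ _ hT])
  refine ⟨γ, fun F' => lists_eq_of_smul_eq hF fun x => ?_⟩
  rw [← Frame.tr_independent (F x) F' hT, hτ, hγ, single_smul, smul_comm]

theorem isTrace_commutator {k k' : ℕ}
    {S T : Module.End ℝ (GForm (Fun EM M) L fun i => Sec EM (FE i) (E i))}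
    (hS : IsOp k S) (hT : IsOp k' T) :
    IsTrace (S * T - (-1 : ℝ) ^ (k * k') • (T * S)) (0 : Form (Fun EM M) L (Fun EM M) (k + k')) := by
  obtain ⟨γ, hγ⟩ := exists_isTrace (hS.commutator hT)
  rwa [isTrace_unique (γ := 0) hγ] at hγ
  intro F
  have e : ∀ f : List L → Fun EM M, (-1 : ℝ) ^ (k * k') • f = (-1 : ℤ) ^ (k * k') • f := by
    intro f
    rcases Nat.even_or_odd (k * k') with h | h <;> simp [h.neg_one_pow]
  rw [single_zero, smul_zero, smul_zero, F.tr_sub, F.tr_smul, e, smul_sub, F.tr_mul_comm hS hT,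
    smul_comm F.χ, sub_self]

section Connection

variable [LieRingModule L (Fun EM M)] [LieRinehartRing (Fun EM M) L] [LieAlgebra ℝ L]
  [LieRinehartAlgebra ℝ (Fun EM M) L]

/-- In a frame the trace of `T` is χγ. The Leibniz term dχ ∧ γ in d(χγ) cancels the correction in
`Frame.tr_comm`, which leaves χ²dγ. -/
theorem isTrace_comm_connection {k : ℕ}
    {D T : Module.End ℝ (GForm (Fun EM M) L fun i => Sec EM (FE i) (E i))}
    (hD : IsConnection D) (hT : IsOp k T) {γ : Form (Fun EM M) L (Fun EM M) k} (hγ : IsTrace T γ) :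
    IsTrace (D * T - (-1 : ℝ) ^ k • (T * D)) (dForm γ) := by
  obtain ⟨β, hβ⟩ := exists_isTrace (hD.comm_isOp hT)
  rwa [isTrace_unique (γ := dForm γ) hβ] at hβ
  intro F
  have h := F.tr_comm hD hT
  have e : F.χ • single γ = mulL (single (constForm F.χ)) (single γ) := by
    rw [mulL, star_supp_zero_left _ (single_suppLength _), single_const]
    rfl
  have e2 : mulL (sgn (single (constForm F.χ))) (dL (single γ)) = F.χ • dL (single γ) := by
    rw [(single_suppLength _).sgn, mulL, pow_zero, one_smul,
      star_supp_zero_left _ (single_suppLength _), single_const]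
    rfl
  rw [hγ, mulL, star_smul_right, e, dL_mulL, smul_add, e2] at h
  rw [single_dForm]
  exact add_right_cancel (h.trans (add_comm _ _))

/-- The cohomology class of the graded trace of an even power of a connection does not depend on
the connection. -/
theorem exists_isTrace_pow_sub (m : ℕ)
    {D D' : Module.End ℝ (GForm (Fun EM M) L fun i => Sec EM (FE i) (E i))}
    (hD : IsConnection D) (hD' : IsConnection D') :
    ∃ γ : Form (Fun EM M) L (Fun EM M) (2 * m + 1),
      IsTrace (D' ^ (2 * m + 2) - D ^ (2 * m + 2)) (dForm γ) := by
  -- The target of the transgression consists of the operators with exact trace. Its degree is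
  -- fixed, hence the restriction to commutators of total degree 2m + 2.
  let Z : Submodule ℝ (Module.End ℝ (GForm (Fun EM M) L fun i => Sec EM (FE i) (E i))) :=
    { carrier := {T | ∃ γ : Form (Fun EM M) L (Fun EM M) (2 * m + 1), IsTrace T (dForm γ)}
      add_mem' := by
        rintro S T ⟨β, hβ⟩ ⟨γ, hγ⟩
        refine ⟨β + γ, ?_⟩
        rw [show dForm (β + γ) = dForm β + dForm γ from map_add (d _) β γ]
        exact hβ.add hγ
      zero_mem' := ⟨0, fun F => by
        rw [show dForm (0 : Form (Fun EM M) L (Fun EM M) (2 * m + 1)) = 0 from map_zero (d _),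
          single_zero, smul_zero, ← zero_smul ℝ (0 : Module.End ℝ _), F.tr_smul, zero_smul]⟩
      smul_mem' := by
        rintro r T ⟨γ, hγ⟩
        refine ⟨r • γ, ?_⟩
        rw [show dForm (r • γ) = r • dForm γ from map_smul (d _) r γ]
        exact hγ.smul r }
  refine pow_sub_pow_mem hD hD' (Z := Z) m (fun a b S T hS hT hab => ⟨0, ?_⟩) fun T hT => ?_
  · rw [show dForm (0 : Form (Fun EM M) L (Fun EM M) (2 * m + 1)) = 0 from map_zero (d _)]
    have := isTrace_commutator hS hT
    rw [hab] at this
    exact this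
  · obtain ⟨γ, hγ⟩ := exists_isTrace hT
    exact ⟨γ, isTrace_comm_connection hD hT hγ⟩

end Connection

end TraceForm

/-! ### Comparison with the fibrewise trace of the curvature. -/

section CurvatureTrace

set_option linter.unusedSectionVars false

theorem IsConnection.pow_isOp {R L : Type*} [CommRing R] [LieRing L] [Module R L] [Algebra ℝ R]
    {n : ℕ} {P : Fin n → Type*} [∀ i, AddCommGroup (P i)] [∀ i, Module R (P i)]
    [∀ i, Module ℝ (P i)] [∀ i, IsScalarTower ℝ R (P i)]
    [LieRingModule L R] [LieRinehartRing R L] [LieAlgebra ℝ L] [LieRinehartAlgebra ℝ R L]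
    {D : Module.End ℝ (GForm R L P)} (hD : IsConnection D) (m : ℕ) : IsOp (2 * m) (D ^ (2 * m)) := by
  rw [pow_mul, pow_two]
  exact hD.sq_isOp.pow m

variable {EM : Type*} [NormedAddCommGroup EM] [NormedSpace ℝ EM] [FiniteDimensional ℝ EM]
  {M : Type*} [TopologicalSpace M] [ChartedSpace EM M] [IsManifold 𝓘(ℝ, EM) ∞ M] [T2Space M]

theorem sec_sum_apply {F : Type*} [NormedAddCommGroup F] [NormedSpace ℝ F] {V : M → Type*}
    [TopologicalSpace (Bundle.TotalSpace F V)] [∀ x, AddCommGroup (V x)] [∀ x, Module ℝ (V x)]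
    [∀ x, TopologicalSpace (V x)] [FiberBundle F V] [VectorBundle ℝ F V] {ι : Type*}
    (s : Finset ι) (a : ι → Sec EM F V) (x : M) : (∑ j ∈ s, a j) x = ∑ j ∈ s, a j x := by
  induction s using Finset.cons_induction with
  | empty => rfl
  | cons j s hj ih => rw [Finset.sum_cons, Finset.sum_cons, ContMDiffSection.coe_add, Pi.add_apply, ih]

theorem fun_sum_apply {ι : Type*} (s : Finset ι) (f : ι → Fun EM M) (x : M) :
    (∑ j ∈ s, f j) x = ∑ j ∈ s, f j x :=
  map_sum (ContMDiffMap.evalRingHom x : Fun EM M →+* ℝ) f s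

variable {F : Type*} [NormedAddCommGroup F] [NormedSpace ℝ F] [FiniteDimensional ℝ F] {V : M → Type*}
  [TopologicalSpace (Bundle.TotalSpace F V)] [∀ x, AddCommGroup (V x)] [∀ x, Module ℝ (V x)]
  [∀ x, TopologicalSpace (V x)] [FiberBundle F V] [VectorBundle ℝ F V] [LieAlgebroid EM F V]
  {n : ℕ} {FE : Fin n → Type*} [∀ i, NormedAddCommGroup (FE i)] [∀ i, NormedSpace ℝ (FE i)]
  [∀ i, FiniteDimensional ℝ (FE i)]
  {E : Fin n → M → Type*} [∀ i, TopologicalSpace (Bundle.TotalSpace (FE i) (E i))]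
  [∀ i x, AddCommGroup (E i x)] [∀ i x, Module ℝ (E i x)] [∀ i x, TopologicalSpace (E i x)]
  [∀ i, FiberBundle (FE i) (E i)] [∀ i, VectorBundle ℝ (FE i) (E i)]
  [∀ i, ContMDiffVectorBundle ∞ (FE i) (E i) 𝓘(ℝ, EM)]

/-- At a point where χ = 1 the frame is a basis of each fibre and its functionals are the
coordinates. The trace of `K` in this basis is then the diagonal sum defining `Frame.tr`. -/
theorem isTrace_curvPow {D : Module.End ℝ (BundleForm EM F V FE E)} (hD : IsConnection D) {m : ℕ}
    {τ : Form (Fun EM M) (Sec EM F V) (Fun EM M) (2 * m)} (hτ : IsGradedTraceCurvPow D m τ) :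
    IsTrace (D ^ (2 * m)) τ := by
  obtain ⟨γ, hγ⟩ := exists_isTrace (hD.pow_isOp m)
  obtain ⟨K, hK, hτ⟩ := hτ
  convert hγ
  ext a x
  obtain ⟨Φ, hχ, hli⟩ := exists_frame EM FE E x
  have hrepr : ∀ i (v : Sec EM (FE i) (E i)), ∑ j, Φ.ε i j v x • Φ.e i j x = v x := by
    intro i v
    have h := congrArg (fun v : Sec EM (FE i) (E i) => v x) (Φ.expand i v)
    simp only [sec_sum_apply, fun_smul_apply, hχ.self_of_nhds, one_smul] at h
    exact h
  let b : ∀ i, Module.Basis (Fin (Φ.N i)) ℝ (E i x) := fun i => Module.Basis.mk (hli i) (by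
    intro v _
    obtain ⟨σ, hσ⟩ := exists_section_eq EM (FE i) x v
    rw [← hσ, ← hrepr i σ]
    exact Submodule.sum_mem _ fun j _ => Submodule.smul_mem _ _ (Submodule.subset_span ⟨j, rfl⟩))
  have hb : ∀ i (v : Sec EM (FE i) (E i)) j, (b i).repr (v x) j = Φ.ε i j v x := by
    intro i v j
    have : v x = ∑ j, Φ.ε i j v x • b i j := by
      rw [← hrepr i v]
      exact Finset.sum_congr rfl fun j _ => by rw [Module.Basis.mk_apply]
    rw [this, Module.Basis.repr_sum_self]
  have h := DFunLike.congr_fun (congrFun (hγ Φ) (List.ofFn a)) x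
  have h1 : (Φ.χ • single γ) (List.ofFn a) x = γ a x := by
    rw [Pi.smul_apply, single_ofFn, smul_eq_mul, ContMDiffMap.coe_mul, Pi.mul_apply,
      hχ.self_of_nhds, one_mul]
  rw [← h1, ← h, hτ, Frame.tr, Finset.sum_apply, fun_sum_apply, Fintype.sum_sigma]
  refine Finset.sum_congr rfl fun i _ => ?_
  rw [LinearMap.trace_eq_matrix_trace ℝ (b i), Matrix.trace, Finset.mul_sum]
  refine Finset.sum_congr rfl fun j _ => ?_
  rw [Matrix.diag_apply, LinearMap.toMatrix_apply, Module.Basis.mk_apply, hK, hb]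
  have h2 : Φ.mat (D ^ (2 * m)) ⟨i, j⟩ ⟨i, j⟩ (List.ofFn a) =
      Φ.ε i j (((D ^ (2 * m)) (zeroForm i (Φ.e i j))) (2 * m, i) a) := by
    rw [← lst_ofFn]
    rfl
  rw [Pi.smul_apply, h2]
  rcases Nat.even_or_odd (i : ℕ) with hi | hi
  · simp [hi.neg_one_pow]
  · simp [hi.neg_one_pow]

end CurvatureTrace

/-! ### Frames adapted to a subalgebroid, and a projection onto it. -/

section Subalgebroid

set_option linter.unusedSectionVars false

variable {EM : Type*} [NormedAddCommGroup EM] [NormedSpace ℝ EM] [FiniteDimensional ℝ EM]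
  {M : Type*} [TopologicalSpace M] [ChartedSpace EM M] [IsManifold 𝓘(ℝ, EM) ∞ M] [T2Space M]
  {F : Type*} [NormedAddCommGroup F] [NormedSpace ℝ F] [FiniteDimensional ℝ F] {V : M → Type*}
  [TopologicalSpace (Bundle.TotalSpace F V)] [∀ x, AddCommGroup (V x)] [∀ x, Module ℝ (V x)]
  [∀ x, TopologicalSpace (V x)] [FiberBundle F V] [VectorBundle ℝ F V]
  [ContMDiffVectorBundle ∞ F V 𝓘(ℝ, EM)] [LieAlgebroid EM F V]

/-- A local frame adapted to a subalgebroid, with cut-off. -/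
theorem LieSubalgebroid.exists_adapted_frame (B : LieSubalgebroid EM F V) {q : ℕ}
    (hq : B.HasCodim q) (x₀ : M) :
    ∃ (r : ℕ) (s : Fin r ⊕ Fin q → Sec EM F V) (ε : Fin r ⊕ Fin q → Sec EM F V →ₗ[Fun EM M] Fun EM M)
      (χ : Fun EM M), (∀ᶠ y in 𝓝 x₀, χ y = 1) ∧ (∀ i, s (Sum.inl i) ∈ B.sections) ∧
      (∀ a ∈ B.sections, ∀ j, ε (Sum.inr j) a = 0) ∧ ∀ a, ∑ j, ε j a • s j = χ • a := by
  have hfd : FiniteDimensional ℝ (V x₀) := finiteDimensional_fiber F x₀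
  obtain ⟨r, s', hs'⟩ := B.subbundle x₀
  obtain ⟨φ, hφ, hφs⟩ := exists_cutoff EM hs'
  -- The given sections lie in `B` only near the point. Cut off, they lie in `B` everywhere.
  let s : Fin r → Sec EM F V := fun i => φ • s' i
  have hsB : ∀ i, s i ∈ B.sections := by
    intro i y
    change φ y • s' i y ∈ _
    by_cases h : φ y = 0
    · rw [h, zero_smul]
      exact zero_mem _
    · refine Submodule.smul_mem _ _ ?_
      rw [← (hφs (subset_tsupport _ h)).2]
      exact Submodule.subset_span ⟨i, rfl⟩
  have hs : ∀ᶠ y in 𝓝 x₀, LinearIndependent ℝ (fun i => s i y) ∧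
      Submodule.span ℝ (Set.range fun i => s i y) = B.fiber y := by
    filter_upwards [hs', hφ] with y h1 h2
    have : (fun i => s i y) = fun i => s' i y := by
      ext i
      change φ y • s' i y = _
      rw [h2, one_smul]
    rwa [this]
  obtain ⟨hli, hspan⟩ := hs.self_of_nhds
  obtain ⟨W, hW⟩ := Submodule.exists_isCompl (B.fiber x₀)
  have hr : Module.finrank ℝ (B.fiber x₀) = r := by
    rw [← hspan, finrank_span_eq_card hli, Fintype.card_fin]
  have hWq : Module.finrank ℝ W = q := by
    have h1 := Submodule.finrank_add_eq_of_isCompl hW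
    have h2 := hq x₀
    omega
  let b : Module.Basis (Fin q) ℝ W := Module.finBasisOfFinrankEq ℝ W hWq
  choose t ht using fun j => exists_section_eq EM F x₀ (b j : V x₀)
  have hb : LinearIndependent ℝ fun j => t j x₀ := by
    simp only [ht]
    exact b.linearIndependent.map' W.subtype (Submodule.ker_subtype W)
  have hdisj : Disjoint (Submodule.span ℝ (Set.range fun i => s i x₀))
      (Submodule.span ℝ (Set.range fun j => t j x₀)) := by
    rw [hspan]
    refine hW.disjoint.mono_right (Submodule.span_le.2 ?_)
    rintro _ ⟨j, rfl⟩
    simp only [ht]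
    exact (b j).2
  obtain ⟨ε, χ₀, hχ₀, hdual, hexp, hloc⟩ := exists_dual_frame (Sum.elim s t) x₀ (by
    have e : (fun j => Sum.elim s t j x₀) = Sum.elim (fun i => s i x₀) fun j => t j x₀ :=
      funext fun j => by cases j <;> rfl
    rw [e]
    exact hli.sum_type hb hdisj) (by
    rw [Fintype.card_sum, Fintype.card_fin, Fintype.card_fin, ← finrank_fiber F (V := V) x₀,
      ← hq x₀, hr])
  -- A second cut-off, supported where the `s i` span `B`: only there do the transverse functionals
  -- have to vanish on `B`.
  obtain ⟨χ₁, hχ₁, hχ₁s⟩ := exists_cutoff EM hs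
  refine ⟨r, Sum.elim s t, fun j => χ₁ • ε j, χ₁ * χ₀, ?_, hsB, ?_, ?_⟩
  · filter_upwards [hχ₀, hχ₁] with y h1 h2
    rw [ContMDiffMap.coe_mul, Pi.mul_apply, h1, h2, one_mul]
  · intro a ha j
    ext y
    change χ₁ y * ε (Sum.inr j) a y = 0
    by_cases h : χ₁ y = 0
    · rw [h, zero_mul]
    · have hay := ha y
      rw [← (hχ₁s (subset_tsupport _ h)).2, Submodule.mem_span_range_iff_exists_fun] at hay
      obtain ⟨c, hc⟩ := hay
      -- At y the section is a combination of the `s i`. The functional depends on the value at y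
      -- alone, so constant coefficients may be used.
      rw [hloc _ a (∑ i, c i • s i) y (by rw [sec_sum_apply, ← hc]; rfl)]
      have : ε (Sum.inr j) (∑ i, c i • s i) = 0 := by
        rw [map_sum]
        refine Finset.sum_eq_zero fun i _ => ?_
        have h := hdual (Sum.inr j) (Sum.inl i)
        rw [if_neg (by simp)] at h
        rw [LinearMap.map_smul_of_tower]
        exact (congrArg (c i • ·) h).trans (smul_zero _)
      rw [this]
      exact mul_zero _
  · intro a
    simp only [LinearMap.smul_apply, smul_assoc]
    rw [← Finset.smul_sum, hexp, smul_smul]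

variable [SigmaCompactSpace M]

/-- A subalgebroid is a direct summand as a vector bundle. -/
theorem LieSubalgebroid.exists_projection (B : LieSubalgebroid EM F V) {q : ℕ}
    (hq : B.HasCodim q) :
    ∃ pr : Sec EM F V →ₗ[Fun EM M] B.sections, ∀ a : B.sections, pr a = a := by
  choose r s ε χ hχ hs hε hexp using B.exists_adapted_frame hq
  let p₀ : M → Sec EM F V →ₗ[Fun EM M] Sec EM F V := fun x =>
    ∑ i, (ε x (Sum.inl i)).smulRight (s x (Sum.inl i))
  have hp : ∀ x a, p₀ x a = ∑ i, ε x (Sum.inl i) a • s x (Sum.inl i) := fun x a => by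
    simp [p₀, LinearMap.sum_apply]
  have hpB : ∀ x a, p₀ x a ∈ B.sections := fun x a y => by
    rw [hp, sec_sum_apply]
    exact Submodule.sum_mem _ fun i _ => Submodule.smul_mem _ _ (hs x i y)
  have hpid : ∀ x, ∀ a ∈ B.sections, p₀ x a = χ x • a := fun x a ha => by
    rw [← hexp, Fintype.sum_sum_type, hp]
    simp [hε x a ha]
  -- Each local map `p₀ x` has values in `B` and is multiplication by `χ x` on sections of `B`. A
  -- partition of unity supported where these cut-offs are 1 makes the sum the identity on `B`.
  obtain ⟨ρ, hρ⟩ := SmoothPartitionOfUnity.exists_isSubordinate 𝓘(ℝ, EM) (isClosed_univ (X := M))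
    (fun x => interior {y | χ x y = 1}) (fun x => isOpen_interior) fun x _ =>
      Set.mem_iUnion.2 ⟨x, mem_interior_iff_mem_nhds.2 (hχ x)⟩
  have hfin : ∀ (a : Sec EM F V) y, (Function.support fun x => ρ x y • p₀ x a y).Finite :=
    fun a y => (ρ.locallyFinite.point_finite y).subset fun x hx h => hx (by
      simp only [h, zero_smul])
  have hsm : ∀ a, ContMDiff 𝓘(ℝ, EM) (𝓘(ℝ, EM).prod 𝓘(ℝ, F)) ∞
      fun y => (⟨y, ∑ᶠ x, ρ x y • p₀ x a y⟩ : Bundle.TotalSpace F V) := fun a =>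
    ContMDiff.finsum_section_of_locallyFinite (ρ.locallyFinite.subset fun x y hy h => hy (by
      simp only [h, zero_smul])) fun x => (ρ x).contMDiff.smul_section (p₀ x a).contMDiff
  refine ⟨{ toFun := fun a => ⟨⟨_, hsm a⟩, fun y => ?_⟩, map_add' := ?_, map_smul' := ?_ }, ?_⟩
  · exact finsum_induction (· ∈ B.fiber y) (zero_mem _) (fun _ _ => add_mem) fun x =>
      Submodule.smul_mem _ _ (hpB x a y)
  · intro a a'
    refine Subtype.ext (ContMDiffSection.ext fun y => ?_)
    change ∑ᶠ x, ρ x y • p₀ x (a + a') y = ∑ᶠ x, ρ x y • p₀ x a y + ∑ᶠ x, ρ x y • p₀ x a' y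
    rw [← finsum_add_distrib (hfin a y) (hfin a' y)]
    simp only [map_add, ContMDiffSection.coe_add, Pi.add_apply, smul_add]
  · intro f a
    refine Subtype.ext (ContMDiffSection.ext fun y => ?_)
    change ∑ᶠ x, ρ x y • p₀ x (f • a) y = f y • ∑ᶠ x, ρ x y • p₀ x a y
    rw [smul_finsum]
    refine finsum_congr fun x => ?_
    rw [map_smul, fun_smul_apply, smul_comm]
  · intro a
    refine Subtype.ext (ContMDiffSection.ext fun y => ?_)
    change ∑ᶠ x, ρ x y • p₀ x a y = (a : Sec EM F V) y
    rw [← one_smul ℝ ((a : Sec EM F V) y), ← ρ.sum_eq_one (Set.mem_univ y), finsum_smul]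
    refine finsum_congr fun x => ?_
    rw [hpid x a a.2, fun_smul_apply, smul_smul]
    by_cases h : ρ x y = 0
    · rw [h, zero_mul]
    · have : χ x y = 1 := interior_subset (s := {y | χ x y = 1}) (hρ x (subset_tsupport _ h))
      rw [this, mul_one]

end Subalgebroid

/-! ### Pullback of forms, and operators prescribed on sections. -/

section Pullback

set_option linter.unusedSectionVars false

section Lists

variable {R : Type*} [CommRing R] {L L' P Q N : Type*}
  [AddCommGroup P] [Module R P] [AddCommGroup Q] [Module R Q] [AddCommGroup N] [Module R N]

theorem star_map (B : P →ₗ[R] Q →ₗ[R] N) (φ : L' → L) (f : List L → P) (g : List L → Q) :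
    star B (fun l : List L' => f (l.map φ)) (fun l => g (l.map φ)) =
      fun l => star B f g (l.map φ) := by
  ext l
  induction l generalizing f g with
  | nil => rfl
  | cons a l ih =>
    rw [star_cons, List.map_cons, star_cons, ← ih, ← ih]
    congr 2
    ext l
    simp [sgn]

end Lists

variable {R L L' : Type*} [CommRing R] [LieRing L] [Module R L] [LieRing L'] [Module R L']

theorem single_compLinearMap {P : Type*} [AddCommGroup P] [Module R P] {k : ℕ} (φ : L' →ₗ[R] L)
    (α : Form R L P k) :
    single (α.compLinearMap φ) = fun l => single α (l.map φ) := by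
  refine (single_suppLength _).ext (fun l hl => single_suppLength α _ (by simpa using hl)) fun v => ?_
  rw [single_ofFn, List.map_ofFn, single_ofFn]
  rfl

variable [Algebra ℝ R] {n : ℕ} {P : Fin n → Type*} [∀ i, AddCommGroup (P i)] [∀ i, Module R (P i)]
  [∀ i, Module ℝ (P i)] [∀ i, IsScalarTower ℝ R (P i)]

/-- The pullback of forms along a linear map. -/
def pullForm {Q : Type*} [AddCommGroup Q] [Module R Q] [Module ℝ Q] [IsScalarTower ℝ R Q]
    (φ : L' →ₗ[R] L) (k : ℕ) : Form R L Q k →ₗ[ℝ] Form R L' Q k where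
  toFun β := β.compLinearMap φ
  map_add' _ _ := rfl
  map_smul' _ _ := rfl

/-- The pullback of graded forms along a linear map. -/
def pull (φ : L' →ₗ[R] L) : GForm R L P →ₗ[ℝ] GForm R L' P :=
  DirectSum.toModule ℝ _ _ fun s => (lofG R L' P s.1 s.2).comp (pullForm φ s.1)

theorem pull_lof (φ : L' →ₗ[R] L) (s : ℕ) (i : Fin n) (β : Form R L (P i) s) :
    pull φ (lofG R L P s i β) = lofG R L' P s i (β.compLinearMap φ) := by
  rw [pull, DirectSum.toModule_lof]
  rfl

theorem lst_pull (φ : L' →ₗ[R] L) (i : Fin n) (η : GForm R L P) :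
    lst i (pull φ η) = fun l => lst i η (l.map φ) := by
  induction η using gform_induction with
  | zero => rw [map_zero, lst_zero, lst_zero]; rfl
  | lof s j β =>
    rw [pull_lof]
    by_cases h : i = j
    · subst h
      rw [lst_lof, lst_lof, single_compLinearMap]
    · rw [lst_lof_ne _ h, lst_lof_ne _ h]; rfl
  | add η θ h1 h2 => rw [map_add, lst_add, lst_add, h1, h2]; rfl

theorem pull_gWedge (φ : L' →ₗ[R] L) {p : ℕ} (α : Form R L R p) (η : GForm R L P) :
    pull φ (gWedge α η) = gWedge (α.compLinearMap φ) (pull φ η) :=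
  lst_ext fun i => by
    rw [lst_pull, lst_gWedge, lst_gWedge, lst_pull, single_compLinearMap, star_map]

theorem pull_elemForm (φ : L' →ₗ[R] L) (i : Fin n) (x : P i) :
    pull φ (elemForm i x : GForm R L P) = elemForm i x := pull_lof _ _ _ _

theorem pull_smul (φ : L' →ₗ[R] L) (r : R) (η : GForm R L P) : pull φ (r • η) = r • pull φ η :=
  lst_ext fun i => by
    rw [lst_pull, lst_smul, lst_smul, lst_pull]; rfl

theorem pull_mem (φ : L' →ₗ[R] L) {k : ℕ} {η : GForm R L P} (h : η ∈ homogeneous k) :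
    pull φ η ∈ homogeneous k := by
  intro s hs
  ext v
  rw [← lst_ofFn, lst_pull]
  exact lst_of_mem_homogeneous h _ _ (by simpa using hs)

section Operator

theorem lof_mem (s : ℕ) (i : Fin n) (β : Form R L (P i) s) :
    lofG R L P s i β ∈ homogeneous (s + i) := by
  intro t ht
  rw [DirectSum.lof_eq_of, DirectSum.of_eq_of_ne]
  rintro rfl
  exact ht rfl

theorem map_mem_homogeneous {j k : ℕ} {T : Module.End ℝ (GForm R L P)}
    (hT : ∀ s i (β : Form R L (P i) s), T (lofG R L P s i β) ∈ homogeneous (s + i + k))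
    {η : GForm R L P} (hη : η ∈ homogeneous j) : T η ∈ homogeneous (j + k) := by
  classical
  rw [← DirectSum.sum_support_of η, map_sum]
  refine Submodule.sum_mem _ fun s _ => ?_
  by_cases hs : s.1 + (s.2 : ℕ) = j
  · rw [← hs]
    exact hT s.1 s.2 (η s)
  · rw [hη s hs, map_zero, map_zero]
    exact zero_mem _

variable {Q : Type*} [AddCommGroup Q] [Module R Q]

/-- The components of a linear map with values in graded forms, as forms with values in linear
maps. -/
def coeffForm (θ : Q →ₗ[R] GForm R L P) (i : Fin n) (t : ℕ) : Form R L (Q →ₗ[R] P i) t where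
  toFun v :=
    { toFun := fun x => θ x (t, i) v
      map_add' := fun x y => by rw [map_add]; rfl
      map_smul' := fun r x => by rw [LinearMap.map_smul]; rfl }
  map_update_add' v j a b := LinearMap.ext fun x => (θ x (t, i)).map_update_add v j a b
  map_update_smul' v j r a := LinearMap.ext fun x => (θ x (t, i)).map_update_smul v j r a
  map_eq_zero_of_eq' v _ _ h hab := LinearMap.ext fun x => (θ x (t, i)).map_eq_zero_of_eq v h hab

theorem single_coeffForm (θ : Q →ₗ[R] GForm R L P) (i : Fin n) (t : ℕ) (l : List L) (x : Q) :
    single (coeffForm θ i t) l x = single (θ x (t, i)) l := by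
  simp only [single]
  split_ifs <;> rfl

/-- The evaluation pairing. -/
abbrev evalPair (Q N : Type*) [AddCommGroup Q] [Module R Q] [AddCommGroup N] [Module R N] :
    Q →ₗ[R] (Q →ₗ[R] N) →ₗ[R] N := LinearMap.id.flip

/-- The product of a form with values in `Q` and the form defined by `θ`, where `θ` raises the
degree by `d`. -/
def opLof (d : ℕ) (θ : Q →ₗ[R] GForm R L P) {s : ℕ} (β : Form R L Q s) : GForm R L P :=
  -- The component in the i-th summand has form degree d - i. For i > d this would be negative, and
  -- the guard prevents the truncated subtraction from producing a spurious term.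
  ∑ i : Fin n, if (i : ℕ) ≤ d then
    lofG R L P (s + (d - i)) i (wedgeB (evalPair Q (P i)) β (coeffForm θ i (d - i))) else 0

theorem lst_opLof (d : ℕ) (θ : Q →ₗ[R] GForm R L P) {s : ℕ} (β : Form R L Q s) (i : Fin n) :
    lst i (opLof d θ β) = star (evalPair Q (P i)) (single β)
      (if (i : ℕ) ≤ d then single (coeffForm θ i (d - i)) else 0) := by
  rw [opLof, lst_sum, Finset.sum_eq_single i]
  · split_ifs
    · rw [lst_lof, single_wedgeB]
    · rw [lst_zero, star_zero_right]
  · intro j _ hj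
    split_ifs
    · rw [lst_lof_ne _ hj.symm]
    · rw [lst_zero]
  · simp

theorem opLof_mem (d : ℕ) (θ : Q →ₗ[R] GForm R L P) {s : ℕ} (β : Form R L Q s) :
    opLof d θ β ∈ homogeneous (s + d) := by
  refine Submodule.sum_mem _ fun i _ => ?_
  split_ifs with h
  · have := lof_mem (s + (d - i)) i (wedgeB (evalPair Q (P i)) β (coeffForm θ i (d - i)))
    rwa [show s + (d - i) + i = s + d by omega] at this
  · exact zero_mem _

theorem opLof_add (d : ℕ) (θ : Q →ₗ[R] GForm R L P) {s : ℕ} (β γ : Form R L Q s) :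
    opLof d θ (β + γ) = opLof d θ β + opLof d θ γ :=
  lst_ext fun i => by rw [lst_add, lst_opLof, lst_opLof, lst_opLof, single_add, star_add_left]

theorem opLof_smul (d : ℕ) (θ : Q →ₗ[R] GForm R L P) {s : ℕ} (r : R) (β : Form R L Q s) :
    opLof d θ (r • β) = r • opLof d θ β :=
  lst_ext fun i => by rw [lst_smul, lst_opLof, lst_opLof, single_smul, star_smul_left]

/-- `opLof` as a linear map, with the sign of an operator of degree `k`. -/
def opLofHom [Module ℝ Q] [IsScalarTower ℝ R Q] (k d : ℕ) (θ : Q →ₗ[R] GForm R L P) (s : ℕ) :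
    Form R L Q s →ₗ[ℝ] GForm R L P where
  toFun β := (-1 : ℝ) ^ (k * s) • opLof d θ β
  map_add' β γ := by rw [opLof_add, smul_add]
  map_smul' r β := by
    have h1 : r • β = algebraMap ℝ R r • β := by ext v; simp
    have h2 : ∀ η : GForm R L P, algebraMap ℝ R r • η = r • η := fun η => lst_ext fun i => by
      rw [lst_smul, lst_real_smul]
      ext l
      simp
    rw [h1, opLof_smul, h2, smul_comm, RingHom.id_apply]

/-- The operator determined by linear maps from `P i` to graded forms. -/
def opOf (k : ℕ) (θ : ∀ i, P i →ₗ[R] GForm R L P) : Module.End ℝ (GForm R L P) :=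
  DirectSum.toModule ℝ _ _ fun s => opLofHom k (s.2 + k) (θ s.2) s.1

theorem opOf_lof (k : ℕ) (θ : ∀ i, P i →ₗ[R] GForm R L P) (s : ℕ) (i : Fin n)
    (β : Form R L (P i) s) :
    opOf k θ (lofG R L P s i β) = (-1 : ℝ) ^ (k * s) • opLof (i + k) (θ i) β := by
  rw [opOf, DirectSum.toModule_lof]
  rfl

theorem opOf_isOp (k : ℕ) (θ : ∀ i, P i →ₗ[R] GForm R L P) : IsOp k (opOf k θ) where
  degree j η hη := by
    refine map_mem_homogeneous (fun s i β => ?_) hη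
    rw [opOf_lof, add_assoc]
    exact Submodule.smul_mem _ _ (opLof_mem _ _ _)
  linear p α η := by
    induction η using gform_induction with
    | zero => simp
    | lof s i β =>
      refine lst_ext fun i' => ?_
      -- Form-linearity is associativity of the product; the Koszul signs are the powers built into
      -- `opLofHom`.
      rw [gWedge_lof, opOf_lof, opOf_lof, lst_real_smul, lst_real_smul, lst_gWedge, lst_real_smul,
        lst_opLof, lst_opLof, wedge_eq_wedgeB, single_wedgeB,
        star_assoc _ _ (evalPair (P i) (P i')) (LinearMap.lsmul R (P i')) (fun x y z => by simp)]
      have h : ∀ (e : ℕ) (f : List L → P i'), (-1 : ℝ) ^ e • f = (-1 : ℤ) ^ e • f := by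
        intro e f
        rcases Nat.even_or_odd e with h | h <;> simp [h.neg_one_pow]
      rw [h, h, h, star_zsmul_right, smul_smul, ← pow_add, mul_add]
    | add η θ h1 h2 => rw [map_add, map_add, h1, h2, map_add, map_add, smul_add]

theorem opOf_elemForm {k : ℕ} {θ : ∀ i, P i →ₗ[R] GForm R L P}
    (hθ : ∀ (i : Fin n) x, θ i x ∈ homogeneous ((i : ℕ) + k)) (i : Fin n) (x : P i) :
    opOf k θ (elemForm i x) = θ i x := by
  refine lst_ext fun i' => ?_
  rw [elemForm, opOf_lof, lst_real_smul, lst_opLof, star_supp_zero_left _ (single_suppLength _),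
    single_const, mul_zero, pow_zero, one_smul]
  ext l
  split_ifs with h
  · change single (coeffForm (θ i) i' _) l x = _
    rw [single_coeffForm, ← lst_eq_single_of_mem i']
    rw [Nat.sub_add_cancel h]
    exact hθ i x
  · rw [lst_of_mem_homogeneous (hθ i x) i' l (by omega)]
    rfl

end Operator

section Subalgebra

variable [LieRingModule L R] (S : LieRinehartSubalgebra R L)

/-- The inclusion of a subalgebra. -/
def inclL : S →ₗ[R] L where
  toFun := (↑)
  map_add' _ _ := rfl
  map_smul' _ _ := rfl

theorem lieL_map (a : S) (f : List L → R) :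
    lieL a (fun l : List S => f (l.map (inclL S))) = fun l => lieL (a : L) f (l.map (inclL S)) := by
  ext l
  induction l generalizing f with
  | nil => rfl
  | cons b l ih =>
    rw [lieL_cons, List.map_cons, lieL_cons, ← ih]
    rfl

theorem dL_map (f : List L → R) :
    dL (fun l : List S => f (l.map (inclL S))) = fun l => dL f (l.map (inclL S)) := by
  ext l
  induction l generalizing f with
  | nil => rfl
  | cons b l ih =>
    rw [dL_cons, List.map_cons, dL_cons, ← ih, lieL_map]
    rfl

variable [LieRinehartRing R L]

/-- The differential involves only brackets and the action on `R`, both of which a subalgebra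
inherits. -/
theorem dForm_compLinearMap {k : ℕ} (α : Form R L R k) :
    (dForm α).compLinearMap (inclL S) = dForm (α.compLinearMap (inclL S)) :=
  single_ext (by
    rw [single_compLinearMap, single_dForm, single_dForm, single_compLinearMap, dL_map])

end Subalgebra

end Pullback

/-! ### Extension of a connection from a subalgebroid, and the order of its curvature. -/

section Extension

set_option linter.unusedSectionVars false

variable {R L : Type*} [CommRing R] [LieRing L] [Module R L]
  [Algebra ℝ R] {n : ℕ} {P : Fin n → Type*} [∀ i, AddCommGroup (P i)] [∀ i, Module R (P i)]
  [∀ i, Module ℝ (P i)] [∀ i, IsScalarTower ℝ R (P i)]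

variable (R P) in
/-- There are enough frames: an element is zero if its products with the cut-off functions of all
frames are zero. -/
def HasFrames : Prop := ∀ (i : Fin n) (x : P i), (∀ F : Frame R P, F.χ • x = 0) → x = 0

theorem HasFrames.gform_eq_zero (hF : HasFrames R P) {η : GForm R L P}
    (h : ∀ F : Frame R P, F.χ • η = 0) : η = 0 := by
  refine lst_ext fun i => ?_
  rw [lst_zero]
  ext1 l
  refine hF i _ fun F => ?_
  rw [← Pi.smul_apply, ← lst_smul, h, lst_zero]
  rfl

/-- Expanding in a frame writes T η as a sum of products of coordinates of η, of order q, with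
values of `T` on sections, of order p. The cut-off is removed because there are enough frames. -/
theorem vanishesTo_op (hF : HasFrames R P) {A : Set L} {p q k : ℕ} {T : Module.End ℝ (GForm R L P)}
    (hT : IsOp k T)
    (hTp : ∀ i x j, VanishesTo A p (lst j (T (elemForm i x))))
    {η : GForm R L P} (hη : ∀ i, VanishesTo A q (lst i η)) (i : Fin n) :
    VanishesTo A (q + p) (lst i (T η)) := by
  intro l hl
  refine hF i _ fun F => ?_
  rw [← Pi.smul_apply, F.op_expand hT, Finset.sum_apply]
  refine Finset.sum_eq_zero fun a _ => ?_
  refine VanishesTo.star _ (p := q) (q := p) ?_ (hTp _ _ i) l hl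
  intro l hl
  simp [sgnPow, Frame.coord, hη a.1 l hl]

theorem vanishesTo_pow (hF : HasFrames R P) {A : Set L} {k : ℕ} {T : Module.End ℝ (GForm R L P)}
    (hT : IsOp k T) (hT1 : ∀ i x j, VanishesTo A 1 (lst j (T (elemForm i x)))) (m : ℕ)
    (η : GForm R L P) (i : Fin n) : VanishesTo A m (lst i ((T ^ m) η)) := by
  induction m generalizing i with
  | zero => exact VanishesTo.zero _
  | succ m ih =>
    rw [pow_succ', Module.End.mul_apply]
    exact vanishesTo_op hF hT hT1 ih i

theorem Frame.vanishesTo_tr (F : Frame R P) {A : Set L} {p : ℕ} {T : Module.End ℝ (GForm R L P)}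
    (hT : ∀ i x j, VanishesTo A p (lst j (T (elemForm i x)))) : VanishesTo A p (F.tr T) := by
  intro l hl
  rw [Frame.tr, Finset.sum_apply]
  refine Finset.sum_eq_zero fun a _ => ?_
  rw [Pi.smul_apply, Frame.mat, Frame.coord, hT _ _ _ l hl, map_zero, smul_zero]

theorem gform_smul_sub (r : R) (η θ : GForm R L P) : r • (η - θ) = r • η - r • θ :=
  lst_ext fun i => by
    rw [lst_smul, lst_sub, lst_sub, lst_smul, lst_smul, smul_sub]

variable [LieRingModule L R] [LieRinehartRing R L] [LieAlgebra ℝ L] [LieRinehartAlgebra ℝ R L]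

theorem IsConnection.map_smul {D : Module.End ℝ (GForm R L P)} (hD : IsConnection D) (r : R)
    (η : GForm R L P) : D (r • η) = gWedge (dForm (constForm r)) η + r • D η := by
  rw [← gWedge_const, hD.leibniz, pow_zero, one_smul, gWedge_const]
  rfl

variable (S : LieRinehartSubalgebra R L)

theorem d_compLinearMap {k : ℕ} (α : Form R L R k) :
    (d k α).compLinearMap (inclL S) = d k (α.compLinearMap (inclL S)) := dForm_compLinearMap S α

theorem pull_inclL_gWedge_dForm (r : R) (i : Fin n) (x : P i) :
    pull (inclL S) (gWedge (dForm (constForm r)) (elemForm i x : GForm R L P)) =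
      gWedge (dForm (constForm r)) (elemForm i x) := by
  rw [pull_gWedge, pull_elemForm, dForm_compLinearMap]
  rfl

/-- The difference of a connection on a subalgebra and the restriction of a connection, extended
along a projection. -/
def diffMap (pr : L →ₗ[R] S) {D : Module.End ℝ (GForm R L P)} (hD : IsConnection D)
    {D₁ : Module.End ℝ (GForm R S P)} (hD₁ : IsConnection D₁) (i : Fin n) :
    P i →ₗ[R] GForm R L P where
  toFun x := pull pr (D₁ (elemForm i x) - pull (inclL S) (D (elemForm i x)))
  map_add' x y := by
    simp only [elemForm_add, map_add, map_sub]
    exact add_sub_add_comm _ _ _ _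
  map_smul' r x := by
    -- Both connections contribute the same term dr ∧ x on the subalgebra, so the difference is
    -- `R`-linear.
    rw [elemForm_smul, elemForm_smul, hD.map_smul, hD₁.map_smul, map_add, pull_inclL_gWedge_dForm,
      add_sub_add_left_eq_sub, pull_smul, ← gform_smul_sub, pull_smul, RingHom.id_apply]

variable {S}

/-- A connection on a subalgebra extends. -/
theorem exists_extension (hF : HasFrames R P) {pr : L →ₗ[R] S} (hpr : ∀ a : S, pr a = a)
    {D : Module.End ℝ (GForm R L P)} (hD : IsConnection D)
    {D₁ : Module.End ℝ (GForm R S P)} (hD₁ : IsConnection D₁) :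
    ∃ D' : Module.End ℝ (GForm R L P), IsConnection D' ∧
      ∀ η, pull (inclL S) (D' η) = D₁ (pull (inclL S) η) := by
  have hθ : ∀ (i : Fin n) x, diffMap S pr hD hD₁ i x ∈ homogeneous ((i : ℕ) + 1) := fun i x =>
    pull_mem _ (sub_mem (hD₁.degree _ _ (elemForm_mem i x))
      (pull_mem _ (hD.degree _ _ (elemForm_mem i x))))
  have hD' := hD.add (opOf_isOp 1 (diffMap S pr hD hD₁))
  refine ⟨_, hD', fun η => ?_⟩
  set D' := D + opOf 1 (diffMap S pr hD hD₁) with hdef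
  have h₁ : ∀ η : GForm R S P, pull (inclL S) (pull pr η) = η := fun η => lst_ext fun i => by
    rw [lst_pull, lst_pull]
    ext1 l
    change lst i η ((l.map _).map _) = _
    have : (pr ∘ inclL S) = id := funext hpr
    rw [List.map_map, this, List.map_id]
  have h₂ : ∀ (i : Fin n) (x : P i), pull (inclL S) (D' (elemForm i x)) = D₁ (elemForm i x) := by
    intro i x
    rw [hdef, LinearMap.add_apply, opOf_elemForm hθ, map_add]
    change _ + pull (inclL S) (pull pr _) = _
    rw [h₁, add_sub_cancel]
  -- The failure of the restriction identity is `R`-linear in η. Hence η may be multiplied by a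
  -- cut-off and expanded in frame elements, where the identity holds by construction.
  have h₃ : ∀ (r : R) (η : GForm R L P),
      pull (inclL S) (D' (r • η)) - D₁ (pull (inclL S) (r • η)) =
      r • (pull (inclL S) (D' η) - D₁ (pull (inclL S) η)) := by
    intro r η
    rw [hD'.map_smul, map_add, pull_smul, pull_smul, hD₁.map_smul, pull_gWedge,
      dForm_compLinearMap, gform_smul_sub]
    exact add_sub_add_left_eq_sub _ _ _
  induction η using gform_induction with
  | zero => simp
  | lof s i β =>
    refine sub_eq_zero.1 (hF.gform_eq_zero fun F => ?_)
    rw [← h₃, F.expand_lof, map_sum, map_sum, map_sum, map_sum, ← Finset.sum_sub_distrib]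
    refine Finset.sum_eq_zero fun j _ => ?_
    rw [hD'.leibniz, pull_gWedge, pull_elemForm, hD₁.leibniz, map_add, LinearMap.map_smul,
      pull_gWedge, pull_gWedge, pull_elemForm, h₂, d_compLinearMap, sub_self]
  | add η ζ h h' => rw [map_add, map_add, h, h', map_add, map_add]

/-- If the restriction of a connection to a subalgebra is flat, then the curvature vanishes on the
subalgebra. -/
theorem vanishesTo_curvature {D : Module.End ℝ (GForm R L P)} {D₁ : Module.End ℝ (GForm R S P)}
    (hD₁ : D₁ ∘ₗ D₁ = 0) (h : ∀ η, pull (inclL S) (D η) = D₁ (pull (inclL S) η))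
    (η : GForm R L P) (i : Fin n) : VanishesTo (S : Set L) 1 (lst i ((D * D) η)) := by
  intro l hl
  have hl' : ∀ a ∈ l, a ∈ S := by
    simpa [List.countP_eq_zero] using Nat.lt_one_iff.1 hl
  have h0 : pull (inclL S) ((D * D) η) = 0 := by
    rw [Module.End.mul_apply, h, h, ← LinearMap.comp_apply, hD₁, LinearMap.zero_apply]
  -- Order 1 concerns only lists with all entries in the subalgebra. Such a list comes from a list
  -- over `S`, where the value is that of D₁² = 0.
  obtain ⟨l, rfl⟩ : ∃ l' : List S, l'.map (inclL S) = l :=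
    ⟨l.attach.map fun a => ⟨a.1, hl' a.1 a.2⟩, by
      rw [List.map_map]
      exact List.attach_map_subtype_val l⟩
  have := congrFun (lst_pull (inclL S) i ((D * D) η)) l
  rw [← this, h0, lst_zero]
  rfl

end Extension

/-! ### The half-degree filtration of cohomology. -/

section Filtration

set_option linter.unusedSectionVars false

variable {R L : Type*} [CommRing R] [LieRing L] [Module R L] [Algebra ℝ R]
  [LieRingModule L R] [LieRinehartRing R L] [LieAlgebra ℝ L] [LieRinehartAlgebra ℝ R L]

theorem single_wedge {p q : ℕ} (α : Form R L R p) (β : Form R L R q) :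
    single (wedge α β) = mulL (single α) (single β) := by
  rw [wedge_eq_wedgeB, single_wedgeB]
  congr 1

theorem single_sub {k : ℕ} (α β : Form R L R k) : single (α - β) = single α - single β :=
  map_sub (AddMonoidHom.mk' (single (R := R) (L := L) (P := R) (k := k)) single_add) α β

theorem mem_cocycles_iff {k : ℕ} {α : Form R L R k} :
    α ∈ cocycles R L k ↔ dL (single α) = 0 := by
  rw [cocycles, LinearMap.mem_ker, ← single_dForm]
  refine ⟨fun h => ?_, fun h => single_ext (h.trans single_zero.symm)⟩
  rw [show dForm α = 0 from h, single_zero]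

theorem mem_coboundaries_of_single {j k : ℕ} (hj : j + 1 = k) {α : Form R L R k}
    {γ : Form R L R j} (h : single α = dL (single γ)) : α ∈ coboundaries R L k := by
  subst hj
  exact ⟨γ, single_ext (by rw [h, ← single_dForm]; rfl)⟩

theorem exists_of_mem_coboundaries {k : ℕ} {α : Form R L R k} (h : α ∈ coboundaries R L k) :
    α = 0 ∨ ∃ (j : ℕ) (γ : Form R L R j), j + 1 = k ∧ single α = dL (single γ) := by
  cases k with
  | zero => exact Or.inl ((Submodule.mem_bot ℝ).1 h)
  | succ k =>
    obtain ⟨γ, rfl⟩ := h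
    exact Or.inr ⟨k, γ, rfl, single_dForm γ⟩

theorem wedge_mem_cocycles {p q : ℕ} {α : Form R L R p} {β : Form R L R q}
    (hα : α ∈ cocycles R L p) (hβ : β ∈ cocycles R L q) : wedge α β ∈ cocycles R L (p + q) := by
  rw [mem_cocycles_iff] at *
  rw [single_wedge, dL_mulL, hα, hβ, mulL, mulL, star_zero_left, star_zero_right, add_zero]

theorem wedge_mem_coboundaries_left {p q : ℕ} {α : Form R L R p} {β : Form R L R q}
    (hα : α ∈ coboundaries R L p) (hβ : β ∈ cocycles R L q) :
    wedge α β ∈ coboundaries R L (p + q) := by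
  obtain rfl | ⟨j, γ, rfl, h⟩ := exists_of_mem_coboundaries hα
  · have : wedge (0 : Form R L R p) β = 0 := single_ext (by
      rw [single_wedge, single_zero, mulL, star_zero_left, single_zero])
    rw [this]
    exact zero_mem _
  · refine mem_coboundaries_of_single (γ := wedge γ β) (by omega) ?_
    rw [single_wedge, single_wedge, dL_mulL, h, mem_cocycles_iff.1 hβ, mulL, mulL, star_zero_right,
      add_zero]

theorem wedge_mem_coboundaries_right {p q : ℕ} {α : Form R L R p} {β : Form R L R q}
    (hα : α ∈ cocycles R L p) (hβ : β ∈ coboundaries R L q) :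
    wedge α β ∈ coboundaries R L (p + q) := by
  obtain rfl | ⟨j, γ, rfl, h⟩ := exists_of_mem_coboundaries hβ
  · rw [map_zero]
    exact zero_mem _
  · refine mem_coboundaries_of_single (γ := (-1 : ℤ) ^ p • wedge α γ) (by omega) ?_
    rw [single_smul, single_wedge, single_wedge, dL_zsmul, dL_mulL, h, mem_cocycles_iff.1 hα,
      (single_suppLength α).sgn, mulL, mulL, mulL, star_zero_left, zero_add, star_zsmul_left,
      smul_smul, ← mul_pow]
    simp

variable (S : LieRinehartSubalgebra R L)

/-- The classes of degree `k` represented by closed forms that vanish if less than half of the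
arguments are outside of the subalgebra. -/
def halfFiltration (k : ℕ) : Submodule ℝ (Cohomology R L k) where
  carrier := {c | ∃ (α : Form R L R k) (hα : α ∈ cocycles R L k),
    -- This bound is ⌈k/2⌉. Rounding up keeps it subadditive, as products require, and puts it above
    -- q as soon as k > 2q.
    VanishesTo (S : Set L) ((k + 1) / 2) (single α) ∧ cohClass α hα = c}
  add_mem' := by
    rintro _ _ ⟨α, hα, hα', rfl⟩ ⟨β, hβ, hβ', rfl⟩
    refine ⟨α + β, add_mem hα hβ, fun l hl => ?_, rfl⟩
    rw [single_add, Pi.add_apply, hα' l hl, hβ' l hl, add_zero]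
  zero_mem' := ⟨0, zero_mem _, fun l _ => by rw [single_zero]; rfl, rfl⟩
  smul_mem' := by
    rintro r _ ⟨α, hα, hα', rfl⟩
    refine ⟨r • α, Submodule.smul_mem _ r hα, fun l hl => ?_, rfl⟩
    rw [single_smul, Pi.smul_apply, hα' l hl, smul_zero]

theorem cohClass_eq_iff {k : ℕ} {α β : Form R L R k} (hα : α ∈ cocycles R L k)
    (hβ : β ∈ cocycles R L k) : cohClass α hα = cohClass β hβ ↔ α - β ∈ coboundaries R L k := by
  rw [← Submodule.Quotient.eq]
  exact Subtype.ext_iff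

/-- Orders add under products and ⌈p/2⌉ + ⌈q/2⌉ ≥ ⌈(p+q)/2⌉. The given representatives may be
replaced by those of high order, because exact forms are an ideal in the closed ones. -/
theorem halfFiltration_isSubalgebra : IsSubalgebra (halfFiltration S) where
  one_mem := ⟨_, one_mem_cocycles R L, VanishesTo.zero _, rfl⟩
  mul_mem := by
    rintro p q α β hα hβ hαβ ⟨α', hα', hvα, eα⟩ ⟨β', hβ', hvβ, eβ⟩
    refine ⟨wedge α' β', wedge_mem_cocycles hα' hβ', ?_, ?_⟩
    · rw [single_wedge]
      exact (hvα.star (LinearMap.mul R R) hvβ).mono (by omega)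
    · rw [cohClass_eq_iff] at *
      have e : wedge α' β' - wedge α β = wedge (α' - α) β' + wedge α (β' - β) := single_ext (by
        simp only [single_sub, single_add, single_wedge, mulL]
        simp only [sub_eq_add_neg, star_add_left, star_add_right, star_neg_left, star_neg_right]
        abel)
      rw [e]
      exact add_mem (wedge_mem_coboundaries_left eα hβ') (wedge_mem_coboundaries_right hα eβ)

end Filtration

/-! ### The vanishing argument. -/

section Vanishing

set_option linter.unusedSectionVars false

variable {EM : Type*} [NormedAddCommGroup EM] [NormedSpace ℝ EM] [FiniteDimensional ℝ EM]
  {M : Type*} [TopologicalSpace M] [ChartedSpace EM M] [IsManifold 𝓘(ℝ, EM) ∞ M] [T2Space M]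
  {F : Type*} [NormedAddCommGroup F] [NormedSpace ℝ F] [FiniteDimensional ℝ F] {V : M → Type*}
  [TopologicalSpace (Bundle.TotalSpace F V)] [∀ x, AddCommGroup (V x)] [∀ x, Module ℝ (V x)]
  [∀ x, TopologicalSpace (V x)] [FiberBundle F V] [VectorBundle ℝ F V]
  [ContMDiffVectorBundle ∞ F V 𝓘(ℝ, EM)] [LieAlgebroid EM F V]

/-- Distinct indices can select each of the q transverse entries at most once, and all other entries
lie in `A`. -/
theorem countP_ofFn_le {ι L : Type*} {l q : ℕ} {A : Set L} {s : ι ⊕ Fin q → L}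
    (hs : ∀ i, s (Sum.inl i) ∈ A) {J : Fin l → ι ⊕ Fin q} (hJ : Function.Injective J) :
    (open scoped Classical in (List.ofFn fun i => s (J i)).countP fun a => decide (a ∉ A)) ≤ q := by
  classical
  rw [List.ofFn_eq_map, List.countP_map, List.countP_eq_length_filter,
    ← List.toFinset_card_of_nodup ((List.nodup_finRange l).filter _),
    ← Finset.card_image_of_injective _ hJ]
  refine (Finset.card_le_card (t := Finset.univ.map Function.Embedding.inr) ?_).trans (by simp)
  intro j hj
  simp only [Finset.mem_image, List.mem_toFinset, List.mem_filter, Function.comp_apply,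
    decide_eq_true_eq] at hj
  obtain ⟨i, ⟨_, hi⟩, rfl⟩ := hj
  rcases h : J i with k | k
  · exact absurd (hs k) (h ▸ hi)
  · simp

/-- A form of degree `l` that vanishes if at most `q` arguments are outside of a subalgebroid of
codimension `q` is zero. -/
theorem form_eq_zero (B : LieSubalgebroid EM F V) {q : ℕ} (hq : B.HasCodim q) {l p : ℕ}
    (hp : q < p) {α : Form (Fun EM M) (Sec EM F V) (Fun EM M) l}
    (hα : VanishesTo (B.sections : Set (Sec EM F V)) p (single α)) : α = 0 := by
  choose r s ε χ hχ hs _ hexp using B.exists_adapted_frame hq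
  ext1 a
  refine fun_eq_of_smul_eq (χ := fun x => χ x ^ l) (fun x => ?_) fun x => ?_
  · filter_upwards [hχ x] with y hy
    rw [ContMDiffMap.coe_pow, Pi.pow_apply, hy, one_pow]
  -- One cut-off is absorbed by each of the l arguments, and each product is then expanded in the
  -- adapted frame. Repeated frame entries vanish by alternation, distinct ones by the order of `α`.
  · have h1 : χ x ^ l • α a = α fun i => χ x • a i := by
      rw [AlternatingMap.map_smul_univ]
      simp
    rw [h1]
    simp only [← hexp]
    have h2 := α.toMultilinearMap.map_sum fun i j => ε x j (a i) • s x j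
    refine h2.trans ((Finset.sum_eq_zero fun J _ => ?_).trans (smul_zero _).symm)
    change α (fun i => ε x (J i) (a i) • s x (J i)) = 0
    rw [AlternatingMap.map_smul_univ]
    by_cases hJ : Function.Injective J
    · rw [← single_ofFn, hα _ ((countP_ofFn_le (hs x) hJ).trans_lt hp), smul_zero]
    · rw [Function.not_injective_iff] at hJ
      obtain ⟨i, j, hij, hne⟩ := hJ
      rw [α.map_eq_zero_of_eq _ (by rw [hij]) hne, smul_zero]

variable {n : ℕ} {FE : Fin n → Type*} [∀ i, NormedAddCommGroup (FE i)] [∀ i, NormedSpace ℝ (FE i)]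
  [∀ i, FiniteDimensional ℝ (FE i)]
  {E : Fin n → M → Type*} [∀ i, TopologicalSpace (Bundle.TotalSpace (FE i) (E i))]
  [∀ i x, AddCommGroup (E i x)] [∀ i x, Module ℝ (E i x)] [∀ i x, TopologicalSpace (E i x)]
  [∀ i, FiberBundle (FE i) (E i)] [∀ i, VectorBundle ℝ (FE i) (E i)]
  [∀ i, ContMDiffVectorBundle ∞ (FE i) (E i) 𝓘(ℝ, EM)]

variable (EM FE E) in
theorem hasFrames_sec : HasFrames (Fun EM M) fun i => Sec EM (FE i) (E i) := by
  intro i e h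
  ext x
  obtain ⟨Φ, hΦ, _⟩ := exists_frame EM FE E x
  have := congrArg (fun e : Sec EM (FE i) (E i) => e x) (h Φ)
  simpa [hΦ.self_of_nhds] using this

theorem vanishesTo_trace {L : Type*} [LieRing L] [Module (Fun EM M) L] {A : Set L} {k p : ℕ}
    {T : Module.End ℝ (GForm (Fun EM M) L fun i => Sec EM (FE i) (E i))}
    (hT : ∀ i x j, VanishesTo A p (lst j (T (elemForm i x))))
    {γ : Form (Fun EM M) L (Fun EM M) k} (hγ : IsTrace T γ) : VanishesTo A p (single γ) := by
  intro l hl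
  choose Φ hΦ _ using exists_frame EM FE E
  refine fun_eq_of_smul_eq hΦ fun x => ?_
  rw [← Pi.smul_apply, ← hγ, (Φ x).vanishesTo_tr hT l hl, smul_zero]

variable [SigmaCompactSpace M]

/-- The character is given with a connection `D`. The connection that extends `D₁` has curvature of
order 1, so its trace form has order m = ⌈2m/2⌉ and lies in the same class. -/
theorem character_mem_halfFiltration (B : LieSubalgebroid EM F V) {q : ℕ} (hq : B.HasCodim q)
    {D₁ : Module.End ℝ (GForm (Fun EM M) B.sections fun i => Sec EM (FE i) (E i))}
    (hD₁ : IsRepresentation D₁) {m : ℕ} (hm : 1 ≤ m)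
    {c : Cohomology (Fun EM M) (Sec EM F V) (2 * m)}
    (hc : IsPontryaginCharacter EM F V FE E m c) : c ∈ halfFiltration B.sections (2 * m) := by
  obtain ⟨D, τ, hτ, hD, hDτ, rfl⟩ := hc
  obtain ⟨pr, hpr⟩ := B.exists_projection hq
  obtain ⟨D', hD', hres⟩ := exists_extension (hasFrames_sec EM FE E) hpr hD hD₁.toIsConnection
  have hτT := isTrace_curvPow hD hDτ
  obtain ⟨γ', hγ'⟩ := exists_isTrace (hD'.pow_isOp m)
  have hv : VanishesTo (B.sections : Set (Sec EM F V)) m (single γ') := by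
    refine vanishesTo_trace (fun i x j => ?_) hγ'
    rw [pow_mul, pow_two]
    exact vanishesTo_pow (hasFrames_sec EM FE E) hD'.sq_isOp
      (fun i x j => vanishesTo_curvature hD₁.flat hres _ j) m _ j
  have hex : γ' - τ ∈ coboundaries _ _ (2 * m) := by
    -- The transgression form has degree 2m - 1, so m ≥ 1 is needed here.
    obtain ⟨m, rfl⟩ : ∃ k, m = k + 1 := ⟨m - 1, by omega⟩
    obtain ⟨β, hβ⟩ := exists_isTrace_pow_sub m hD hD'
    refine ⟨β, isTrace_unique hβ fun Φ => ?_⟩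
    rw [Φ.tr_sub, single_sub, smul_sub Φ.χ (single γ'), ← hγ', ← hτT]
    rfl
  have hcl : γ' ∈ cocycles _ _ (2 * m) := by
    rw [← sub_add_cancel γ' τ]
    refine add_mem ?_ hτ
    rw [mem_cocycles_iff]
    obtain h | ⟨j, β, _, h⟩ := exists_of_mem_coboundaries hex
    · rw [h, single_zero]
      exact dLHom.map_zero
    · rw [h, ← single_dForm, ← single_dForm, dForm_dForm, single_zero]
  exact ⟨γ', hcl, by rwa [show (2 * m + 1) / 2 = m by omega], (cohClass_eq_iff _ _).2 hex⟩

theorem halfFiltration_eq_bot (B : LieSubalgebroid EM F V) {q : ℕ} (hq : B.HasCodim q) {l : ℕ}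
    (hl : 2 * q < l) : halfFiltration B.sections l = ⊥ := by
  rw [eq_bot_iff]
  rintro _ ⟨α, hα, hv, rfl⟩
  obtain rfl := form_eq_zero B hq (by omega) hv
  exact (Submodule.mem_bot ℝ).2 rfl

end Vanishing

end Algebroid

end

theorem mainTheorem7
    {EM : Type*} [NormedAddCommGroup EM] [NormedSpace ℝ EM] [FiniteDimensional ℝ EM]
    {M : Type*} [TopologicalSpace M] [ChartedSpace EM M] [IsManifold 𝓘(ℝ, EM) ∞ M]
    [T2Space M] [SigmaCompactSpace M]
    {FA : Type*} [NormedAddCommGroup FA] [NormedSpace ℝ FA] [FiniteDimensional ℝ FA]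
    {A : M → Type*} [TopologicalSpace (Bundle.TotalSpace FA A)]
    [∀ x, AddCommGroup (A x)] [∀ x, Module ℝ (A x)] [∀ x, TopologicalSpace (A x)]
    [FiberBundle FA A] [VectorBundle ℝ FA A] [ContMDiffVectorBundle ∞ FA A 𝓘(ℝ, EM)]
    [Algebroid.LieAlgebroid EM FA A]
    {n : ℕ} {FE : Fin n → Type*} [∀ i, NormedAddCommGroup (FE i)] [∀ i, NormedSpace ℝ (FE i)]
    [∀ i, FiniteDimensional ℝ (FE i)]
    {E : Fin n → M → Type*} [∀ i, TopologicalSpace (Bundle.TotalSpace (FE i) (E i))]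
    [∀ i x, AddCommGroup (E i x)] [∀ i x, Module ℝ (E i x)] [∀ i x, TopologicalSpace (E i x)]
    [∀ i, FiberBundle (FE i) (E i)] [∀ i, VectorBundle ℝ (FE i) (E i)]
    [∀ i, ContMDiffVectorBundle ∞ (FE i) (E i) 𝓘(ℝ, EM)]
    (B : Algebroid.LieSubalgebroid EM FA A) (q : ℕ) (hq : B.HasCodim q)
    (D : Module.End ℝ (Algebroid.GForm (Algebroid.Fun EM M) B.sections
      fun i => Algebroid.Sec EM (FE i) (E i)))
    (hD : Algebroid.IsRepresentation D)
    (l : ℕ) (hl : 2 * q < l) :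
    Algebroid.pontryagin EM FA A FE E l = ⊥ := by
  rw [eq_bot_iff, ← Algebroid.halfFiltration_eq_bot B hq hl]
  -- The Pontryagin algebra is an intersection of subalgebras containing the characters, and the
  -- half-degree filtration is one of them.
  exact sInf_le ⟨_, Algebroid.halfFiltration_isSubalgebra B.sections,
    fun m hm c hc => Algebroid.character_mem_halfFiltration B hq hD hm hc, rfl⟩
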